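/- Let $P_k$ be the path on $k$ vertices, labelled $1,\dots,k$ from one leaf to the other. Draw the grid graph $P_\ell\square P_m$ in the plane in the standard way, with the boustrophedon labelling: $(p,q)\in[\ell]\times[m]$ has label $(q-1)\ell+p$ if $q$ is odd and $q\ell-p+1$ if $q$ is even. Let $G$ be the Cartesian product of $G_1=P_\ell\square P_m$ with $G_2=P_n$ (draw $P_n$ along a line). Give every vertex of $G$ the weight $x$ and the edges of $G$ parallel to the edges of $P_\ell,P_m,P_n$ the weights $a,b,c$ respectively. *Configurations.* A configuration is a set of pairwise vertex-disjoint directed loops of even length in $G$ (a loop of length two is a doubled edge); its isolated vertices are the vertices on none of its loops. Its weight is the product of the weights of its loops and of the vertex weights of its isolated vertices, and the partition function is the sum of the weights of all configurations. *Monopole-dimer model.* The weight of a loop $L$ is $\mathrm{sgn}(L)$ times the product of its edge weights (along the steps of $L$; a doubled edge has two steps), where $$\mathrm{sgn}(L)=-(-1)^{e_1}\,\mathrm{sgn}(\mathcal D_1)\,\mathrm{sgn}(\mathcal D_2).$$ Here $e_1$ is the number of edges of $L$ lying in copies $G_1\times\{w\}$ for which (label of $w$) $+1$ is odd. The set $\mathcal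 D_i$ is any decomposition, into directed cycles whose directions are inherited from $L$, of the projection of $L$ to $G_i$; this projection is a closed trail in $G_i$ with parallel copies of edges allowed. The sign $\mathrm{sgn}(\mathcal D)$ is $\prod_{d\in\mathcal D}(-1)^{\chi(d)+1}$, where the factor is $(-1)^{\chi(d)}$ instead if $d$ is a clockwise cycle of odd length, and $\chi(d)$ is the number of vertices of $G_i$ enclosed by $d$ in the plane (none if $d$ consists of two parallel edges). *Oriented product.* Orient $G_1$ and $G_2$ from lower to higher label, and let $\mathcal O$ be the oriented product orientation on $G$: an arrow $w\to w'$ of $G_2$ gives $(u,w)\to(u,w')$, and an arrow $u\to u'$ of $G_1$ gives $(u,w)\to(u',w)$ if (label of $w$) $+1$ is even and $(u',w)\to(u,w)$ otherwise. In the loop-vertex model of $(G,\mathcal O)$ the weight of a directed loop is minus the product of its edge weights, times $-1$ for each step taken against $\mathcal O$. **Theorem.** For all $\ell,m,n$, $\mathrm{sgn}(L)$ is well defined for every directed even loop $L$ of $G$ (decompositions $\mathcal D_1,\mathcal D_2$ exist, and the sign does not depend on their choice). The partition function $\mathcal Z_{\ell,m,n}$ of the monopole-dimer model on $G$, and also that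 of the loop-vertex model of $(G,\mathcal O)$, is given for all real $x,a,b,c$ by $$\prod_{j=1}^{\lfloor n/2\rfloor}\prod_{s=1}^{\lfloor m/2\rfloor}\prod_{k=1}^{\lfloor \ell/2\rfloor}\Bigl(x^2+4a^2\cos^2\tfrac{\pi k}{\ell+1}+4b^2\cos^2\tfrac{\pi s}{m+1}+4c^2\cos^2\tfrac{\pi j}{n+1}\Bigr)^4$$ times $$\begin{cases} 1 & \ell,m,n \text{ even},\\ T_{n,m}^2(b,c;x) & \ell \text{ odd},\ m,n \text{ even},\\ T_{n,\ell}^2(a,c;x) & m \text{ odd},\ \ell,n \text{ even},\\ T_{n,m}^2(b,c;x)\,T_{n,\ell}^2(a,c;x)\,S_n(c;x) & \ell,m \text{ odd},\ n \text{ even},\\ T_{m,\ell}^2(a,b;x) & n \text{ odd},\ \ell,m \text{ even},\\ T_{n,m}^2(b,c;x)\,T_{m,\ell}^2(a,b;x)\,S_m(b;x) & \ell,n \text{ odd},\ m \text{ even},\\ T_{n,\ell}^2(a,c;x)\,T_{m,\ell}^2(a,b;x)\,S_\ell(a;x) & m,n \text{ odd},\ \ell \text{ even},\\ x\,T_{n,m}^2(b,c;x)\,T_{n,\ell}^2(a,c;x)\,T_{m,\ell}^2(a,b;x)\,S_n(c;x)\,S_m(b;x)\,S_\ell(a;x)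 & \ell,m,n \text{ odd}, \end{cases}$$ where $$S_n(c;x)=\prod_{k=1}^{\lfloor n/2\rfloor}\Bigl(x^2+4c^2\cos^2\tfrac{\pi k}{n+1}\Bigr),$$ $$T_{n,\ell}(a,b;x)=\prod_{j=1}^{\lfloor n/2\rfloor}\prod_{k=1}^{\lfloor \ell/2\rfloor}\Bigl(x^2+4a^2\cos^2\tfrac{\pi k}{\ell+1}+4b^2\cos^2\tfrac{\pi j}{n+1}\Bigr).$$ In particular, if $\ell,m,n$ are all even, $\mathcal Z_{\ell,m,n}$ is the fourth power of a polynomial in $x,a,b,c$ with real coefficients. -/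

import Mathlib

open scoped BigOperators

/-- A finite plane graph with a natural vertex labelling: a simple graph whose vertices are placed at
distinct points of the plane and whose edges are drawn as straight segments which meet only in common
end points, together with a labelling of the vertices by `1, …, |V|`. -/
structure LabelledPlaneGraph (V : Type) where
  graph : SimpleGraph V
  label : V → ℕ
  pos : V → ℝ × ℝ
  label_bij : Set.BijOn label Set.univ (Set.Icc 1 (Nat.card V))
  pos_injective : Function.Injective pos
  vertex_on_edge : ∀ u v w, graph.Adj u v → pos w ∈ segment ℝ (pos u) (pos v) → w = u ∨ w = v
  noncrossing : ∀ u v u' v', graph.Adj u v → graph.Adj u' v' → ∀ z,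
    z ∈ segment ℝ (pos u) (pos v) → z ∈ segment ℝ (pos u') (pos v') →
    s(u, v) = s(u', v') ∨ ∃ w, z = pos w ∧ (w = u ∨ w = v) ∧ (w = u' ∨ w = v')

namespace MonopoleDimer

/-! ### Directed cycles and loop-vertex configurations -/

section Configurations

variable {V : Type}

/-- A directed cycle `v₀ → v₁ → ⋯ → v₀` (with distinct vertices) in `G`, given by the cyclic permutation
which sends each vertex of the cycle to the next one and fixes all other vertices.
A cycle of length two is a doubled edge. -/
def IsDirectedCycle (G : SimpleGraph V) (f : Equiv.Perm V) : Prop :=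
  f.IsCycle ∧ ∀ v, f v ≠ v → G.Adj v (f v)

variable [Fintype V] [DecidableEq V]

/-- A directed loop of even length (doubled edges included). -/
def IsEvenLoop (G : SimpleGraph V) (f : Equiv.Perm V) : Prop :=
  IsDirectedCycle G f ∧ Even f.support.card

open Classical in
/-- The loop-vertex configurations of `G`: sets of pairwise vertex-disjoint directed even loops.
The isolated vertices of a configuration are the vertices on none of its loops. -/
noncomputable def configurations (G : SimpleGraph V) : Finset (Finset (Equiv.Perm V)) :=
  Finset.univ.filter fun C =>
    (∀ f ∈ C, IsEvenLoop G f) ∧ ∀ f ∈ C, ∀ g ∈ C, f ≠ g → Disjoint f.support g.support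

/-- The weight of a configuration, for loop weights `w` and vertex weights `x`. -/
noncomputable def configWeight (w : Equiv.Perm V → ℝ) (x : V → ℝ) (C : Finset (Equiv.Perm V)) : ℝ :=
  (∏ f ∈ C, w f) * ∏ v ∈ Finset.univ.filter (fun v => ∀ f ∈ C, v ∉ f.support), x v

/-- The sum of the weights of all loop-vertex configurations of `G`. -/
noncomputable def partitionSum (G : SimpleGraph V) (w : Equiv.Perm V → ℝ) (x : V → ℝ) : ℝ :=
  ∑ C ∈ configurations G, configWeight w x C

/-! ### The loop-vertex model of an oriented graph -/

open Classical in
/-- The sign of the step from `v` to the adjacent vertex `v'`, for the orientation whose arrows are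
`v → v'` whenever `arc v v'` holds. -/
noncomputable def stepSign (arc : V → V → Prop) (v v' : V) : ℝ :=
  if arc v v' then 1 else -1

/-- The weight of a directed loop in the loop-vertex model, for symmetric edge weights `a`. -/
noncomputable def loopVertexWeight (arc : V → V → Prop) (a : V → V → ℝ) (f : Equiv.Perm V) : ℝ :=
  -∏ v ∈ f.support, stepSign arc v (f v) * a v (f v)

/-- The partition function of the loop-vertex model. -/
noncomputable def loopVertexPartition (G : SimpleGraph V) (arc : V → V → Prop)
    (x : V → ℝ) (a : V → V → ℝ) : ℝ :=
  partitionSum G (loopVertexWeight arc a) x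

/-- The directed edges of a directed cycle. -/
def darts (d : Equiv.Perm V) : Multiset (V × V) :=
  d.support.val.map fun v => (v, d v)

end Configurations

/-! ### Signs of cycles in a plane graph -/

section Plane

variable {V : Type} [Fintype V] [DecidableEq V]

/-- The closed curve drawn by a cycle. -/
def curve (Γ : LabelledPlaneGraph V) (d : Equiv.Perm V) : Set (ℝ × ℝ) :=
  ⋃ v ∈ d.support, segment ℝ (Γ.pos v) (Γ.pos (d v))

/-- A vertex is enclosed by a cycle if it lies in a bounded connected component of the complement of
the curve drawn by the cycle. -/
def Encloses (Γ : LabelledPlaneGraph V) (d : Equiv.Perm V) (v : V) : Prop :=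
  Γ.pos v ∉ curve Γ d ∧
    Bornology.IsBounded (connectedComponentIn (curve Γ d)ᶜ (Γ.pos v))

/-- The number of vertices of the graph enclosed by a cycle. -/
noncomputable def enclosedCount (Γ : LabelledPlaneGraph V) (d : Equiv.Perm V) : ℕ :=
  Set.ncard {v | Encloses Γ d v}

/-- Twice the signed area of the polygon drawn by a cycle; it is negative for a clockwise cycle. -/
noncomputable def signedArea (Γ : LabelledPlaneGraph V) (d : Equiv.Perm V) : ℝ :=
  ∑ v ∈ d.support, ((Γ.pos v).1 * (Γ.pos (d v)).2 - (Γ.pos (d v)).1 * (Γ.pos v).2)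

open Classical in
/-- The sign of a directed cycle of a plane graph. -/
noncomputable def cycleSign (Γ : LabelledPlaneGraph V) (d : Equiv.Perm V) : ℤ :=
  if Odd d.support.card ∧ signedArea Γ d < 0 then (-1) ^ enclosedCount Γ d
  else (-1) ^ (enclosedCount Γ d + 1)

/-- The sign of a family of directed cycles. -/
noncomputable def familySign (Γ : LabelledPlaneGraph V) (D : Multiset (Equiv.Perm V)) : ℤ :=
  (D.map (cycleSign Γ)).prod

/-- `D` is a directed cycle decomposition compatible with the closed trail whose directed edges are `T`:
its members are directed cycles, and together they use exactly the directed edges in `T`. The trail lives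
in the multigraph obtained from the plane graph by allowing parallel copies of edges, so a directed edge
of the graph may occur several times in `T`, and two oppositely directed copies of one edge form a cycle
of length two, which encloses nothing. -/
def IsCompatibleDecomposition (Γ : LabelledPlaneGraph V) (T : Multiset (V × V))
    (D : Multiset (Equiv.Perm V)) : Prop :=
  (∀ d ∈ D, IsDirectedCycle Γ.graph d) ∧ D.bind darts = T

/-- The canonical orientation: from lower to higher label. -/
def canonicalArc (Γ : LabelledPlaneGraph V) (u v : V) : Prop :=
  Γ.graph.Adj u v ∧ Γ.label u < Γ.label v

end Plane

/-! ### The monopole-dimer model on the Cartesian product of two plane graphs -/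

section Product

variable {V₁ V₂ : Type} [Fintype V₁] [DecidableEq V₁] [Fintype V₂] [DecidableEq V₂]

/-- The oriented Cartesian product of two labelled plane graphs with their canonical orientations:
arrows of the first factor are reversed in the copies at the vertices `w` of the second factor
for which `label w + 1` is odd. -/
def productArc (Γ₁ : LabelledPlaneGraph V₁) (Γ₂ : LabelledPlaneGraph V₂) (u v : V₁ × V₂) : Prop :=
  (u.2 = v.2 ∧ Even (Γ₂.label u.2 + 1) ∧ canonicalArc Γ₁ u.1 v.1) ∨
  (u.2 = v.2 ∧ Odd (Γ₂.label u.2 + 1) ∧ canonicalArc Γ₁ v.1 u.1) ∨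
  (u.1 = v.1 ∧ canonicalArc Γ₂ u.2 v.2)

/-- The directed edges of the projection of a loop to the first factor: contract all edges of the loop
that are not parallel to the first factor. -/
def projection₁ (f : Equiv.Perm (V₁ × V₂)) : Multiset (V₁ × V₁) :=
  (f.support.filter fun v => (f v).2 = v.2).val.map fun v => (v.1, (f v).1)

/-- The directed edges of the projection of a loop to the second factor. -/
def projection₂ (f : Equiv.Perm (V₁ × V₂)) : Multiset (V₂ × V₂) :=
  (f.support.filter fun v => (f v).1 = v.1).val.map fun v => (v.2, (f v).2)

/-- The number of edges of the loop `f` that lie in a copy of the first factor at a vertex `w` of the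
second factor with `label w + 1` odd. -/
def reversedCount (Γ₂ : LabelledPlaneGraph V₂) (f : Equiv.Perm (V₁ × V₂)) : ℕ :=
  (f.support.filter fun v => (f v).2 = v.2 ∧ Odd (Γ₂.label v.2 + 1)).card

/-- `ε` is the sign of the loop `f`, computed from some compatible directed cycle decompositions of its
two projections. -/
def IsLoopSign (Γ₁ : LabelledPlaneGraph V₁) (Γ₂ : LabelledPlaneGraph V₂)
    (f : Equiv.Perm (V₁ × V₂)) (ε : ℤ) : Prop :=
  ∃ D₁ D₂, IsCompatibleDecomposition Γ₁ (projection₁ f) D₁ ∧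
    IsCompatibleDecomposition Γ₂ (projection₂ f) D₂ ∧
    ε = -((-1) ^ reversedCount Γ₂ f * (familySign Γ₁ D₁ * familySign Γ₂ D₂))

open Classical in
/-- The sign of a loop: the value computed from an arbitrary choice of decompositions. -/
noncomputable def loopSign (Γ₁ : LabelledPlaneGraph V₁) (Γ₂ : LabelledPlaneGraph V₂)
    (f : Equiv.Perm (V₁ × V₂)) : ℤ :=
  if h : ∃ ε, IsLoopSign Γ₁ Γ₂ f ε then h.choose else 0

/-- The weight of a loop in the monopole-dimer model, for symmetric edge weights `a`. -/
noncomputable def monopoleDimerWeight (Γ₁ : LabelledPlaneGraph V₁) (Γ₂ : LabelledPlaneGraph V₂)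
    (a : V₁ × V₂ → V₁ × V₂ → ℝ) (f : Equiv.Perm (V₁ × V₂)) : ℝ :=
  (loopSign Γ₁ Γ₂ f : ℝ) * ∏ v ∈ f.support, a v (f v)

/-- The partition function of the monopole-dimer model on the Cartesian product. -/
noncomputable def monopoleDimerPartition (Γ₁ : LabelledPlaneGraph V₁) (Γ₂ : LabelledPlaneGraph V₂)
    (x : V₁ × V₂ → ℝ) (a : V₁ × V₂ → V₁ × V₂ → ℝ) : ℝ :=
  partitionSum (Γ₁.graph.boxProd Γ₂.graph) (monopoleDimerWeight Γ₁ Γ₂ a) x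

end Product

/-! ### Paths and grids -/

/-- The point of the plane at which the grid vertex is drawn (coordinates are counted from `0`). -/
def gridPos {ℓ m : ℕ} (u : Fin ℓ × Fin m) : ℝ × ℝ := ((u.1 : ℕ), (u.2 : ℕ))

/-- The boustrophedon label of the vertex in column `p` and row `q` (both counted from `0`). -/
def boustrophedon {ℓ m : ℕ} (u : Fin ℓ × Fin m) : ℕ :=
  if Even (u.2 : ℕ) then (u.2 : ℕ) * ℓ + (u.1 : ℕ) + 1
  else ((u.2 : ℕ) + 1) * ℓ - (u.1 : ℕ)

theorem boustrophedon_eq {ℓ m : ℕ} (u : Fin ℓ × Fin m) :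
    ∃ r, r < ℓ ∧ boustrophedon u = (u.2 : ℕ) * ℓ + r + 1 ∧
      (r = (u.1 : ℕ) ∧ Even (u.2 : ℕ) ∨ r = ℓ - 1 - (u.1 : ℕ) ∧ ¬ Even (u.2 : ℕ)) := by
  obtain ⟨⟨p, hp⟩, ⟨q, hq⟩⟩ := u
  by_cases h : Even q
  · exact ⟨p, hp, by simp [boustrophedon, h], Or.inl ⟨rfl, h⟩⟩
  · refine ⟨ℓ - 1 - p, by omega, ?_, Or.inr ⟨rfl, h⟩⟩
    simp only [boustrophedon, h, if_false, Nat.add_mul, Nat.one_mul]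
    omega

theorem boustrophedon_bij (ℓ m : ℕ) :
    Set.BijOn (boustrophedon (ℓ := ℓ) (m := m)) Set.univ
      (Set.Icc 1 (Nat.card (Fin ℓ × Fin m))) := by
  have hmaps : Set.MapsTo (boustrophedon (ℓ := ℓ) (m := m)) Set.univ
      (Set.Icc 1 (Nat.card (Fin ℓ × Fin m))) := by
    intro u _
    obtain ⟨r, hr, h, -⟩ := boustrophedon_eq u
    have hq : ((u.2 : ℕ) + 1) * ℓ ≤ m * ℓ := Nat.mul_le_mul_right _ u.2.2
    simp only [Nat.card_eq_fintype_card, Fintype.card_prod, Fintype.card_fin, Set.mem_Icc, h]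
    rw [Nat.add_mul] at hq
    rw [Nat.mul_comm ℓ m]
    omega
  have hinj : Function.Injective (boustrophedon (ℓ := ℓ) (m := m)) := by
    intro u v huv
    obtain ⟨r, hr, h, hu⟩ := boustrophedon_eq u
    obtain ⟨r', hr', h', hv⟩ := boustrophedon_eq v
    have e : (u.2 : ℕ) * ℓ + r = (v.2 : ℕ) * ℓ + r' := by omega
    have hpos : 0 < ℓ := by omega
    have e2 : (u.2 : ℕ) = v.2 := by
      have := congrArg (· / ℓ) e
      simpa [Nat.add_comm _ r, Nat.add_comm _ r', Nat.add_mul_div_right _ _ hpos,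
        Nat.div_eq_of_lt hr, Nat.div_eq_of_lt hr'] using this
    have e1 : r = r' := by rw [e2] at e; omega
    have := u.1.2
    have := v.1.2
    refine Prod.ext (Fin.ext ?_) (Fin.ext e2)
    rw [e2] at hu
    rcases hu with ⟨a, b⟩ | ⟨a, b⟩ <;> rcases hv with ⟨a', b'⟩ | ⟨a', b'⟩ <;>
      first | omega | exact absurd b b' | exact absurd b' b
  refine ⟨hmaps, hinj.injOn, ?_⟩
  have himg : Finset.univ.image (boustrophedon (ℓ := ℓ) (m := m)) =
      Finset.Icc 1 (Nat.card (Fin ℓ × Fin m)) := by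
    apply Finset.eq_of_subset_of_card_le
    · intro k hk
      obtain ⟨u, -, rfl⟩ := Finset.mem_image.1 hk
      exact Finset.mem_Icc.2 (hmaps (Set.mem_univ u))
    · rw [Finset.card_image_of_injective _ hinj]
      simp
  intro k hk
  have : k ∈ Finset.univ.image (boustrophedon (ℓ := ℓ) (m := m)) := by
    rw [himg]; exact Finset.mem_Icc.2 hk
  obtain ⟨u, -, hu⟩ := Finset.mem_image.1 this
  exact ⟨u, Set.mem_univ u, hu⟩

theorem mem_segment_prod {y z w : ℝ × ℝ} (h : z ∈ segment ℝ y w) :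
    (y.1 ≤ w.1 → y.1 ≤ z.1 ∧ z.1 ≤ w.1) ∧ (w.1 ≤ y.1 → w.1 ≤ z.1 ∧ z.1 ≤ y.1) ∧
    (y.2 ≤ w.2 → y.2 ≤ z.2 ∧ z.2 ≤ w.2) ∧ (w.2 ≤ y.2 → w.2 ≤ z.2 ∧ z.2 ≤ y.2) := by
  obtain ⟨s, t, hs, ht, hst, rfl⟩ := h
  have hs' : s = 1 - t := by linarith
  subst hs'
  simp only [Prod.fst_add, Prod.snd_add, Prod.smul_fst, Prod.smul_snd, smul_eq_mul]
  refine ⟨fun h => ⟨?_, ?_⟩, fun h => ⟨?_, ?_⟩, fun h => ⟨?_, ?_⟩, fun h => ⟨?_, ?_⟩⟩ <;> nlinarith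

/-- A point of a grid edge, in coordinates. -/
theorem grid_edge {ℓ m : ℕ} {u v : Fin ℓ × Fin m} {z : ℝ × ℝ}
    (h : ((SimpleGraph.pathGraph ℓ).boxProd (SimpleGraph.pathGraph m)).Adj u v)
    (hz : z ∈ segment ℝ (gridPos u) (gridPos v)) :
    ∃ a b : Fin ℓ × Fin m, (a = u ∧ b = v ∨ a = v ∧ b = u) ∧
      (((a.1 : ℕ) + 1 = b.1 ∧ (a.2 : ℕ) = b.2 ∧ ((a.1 : ℕ) : ℝ) ≤ z.1 ∧ z.1 ≤ ((b.1 : ℕ) : ℝ) ∧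
          z.2 = ((a.2 : ℕ) : ℝ)) ∨
        ((a.1 : ℕ) = b.1 ∧ (a.2 : ℕ) + 1 = b.2 ∧ ((a.2 : ℕ) : ℝ) ≤ z.2 ∧ z.2 ≤ ((b.2 : ℕ) : ℝ) ∧
          z.1 = ((a.1 : ℕ) : ℝ))) := by
  rw [SimpleGraph.boxProd_adj, SimpleGraph.pathGraph_adj, SimpleGraph.pathGraph_adj] at h
  obtain ⟨h1, h2, h3, h4⟩ := mem_segment_prod hz
  simp only [gridPos, Nat.cast_le] at h1 h2 h3 h4
  rcases h with ⟨h | h, e⟩ | ⟨h | h, e⟩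
  · have e' : (u.2 : ℕ) = v.2 := by rw [e]
    refine ⟨u, v, Or.inl ⟨rfl, rfl⟩, Or.inl ⟨h, e', (h1 (by omega)).1, (h1 (by omega)).2, ?_⟩⟩
    exact le_antisymm (h4 (by omega)).2 (h3 (by omega)).1
  · have e' : (u.2 : ℕ) = v.2 := by rw [e]
    refine ⟨v, u, Or.inr ⟨rfl, rfl⟩, Or.inl ⟨h, e'.symm, (h2 (by omega)).1, (h2 (by omega)).2, ?_⟩⟩
    exact le_antisymm (h3 (by omega)).2 (h4 (by omega)).1
  · have e' : (u.1 : ℕ) = v.1 := by rw [e]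
    refine ⟨u, v, Or.inl ⟨rfl, rfl⟩, Or.inr ⟨e', h, (h3 (by omega)).1, (h3 (by omega)).2, ?_⟩⟩
    exact le_antisymm (h2 (by omega)).2 (h1 (by omega)).1
  · have e' : (u.1 : ℕ) = v.1 := by rw [e]
    refine ⟨v, u, Or.inr ⟨rfl, rfl⟩, Or.inr ⟨e'.symm, h, (h4 (by omega)).1, (h4 (by omega)).2, ?_⟩⟩
    exact le_antisymm (h1 (by omega)).2 (h2 (by omega)).1

theorem gridPos_injective (ℓ m : ℕ) : Function.Injective (gridPos (ℓ := ℓ) (m := m)) := by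
  intro u v h
  simp only [gridPos, Prod.mk.injEq, Nat.cast_inj] at h
  exact Prod.ext (Fin.ext h.1) (Fin.ext h.2)

theorem grid_vertex_on_edge {ℓ m : ℕ} (u v w : Fin ℓ × Fin m)
    (h : ((SimpleGraph.pathGraph ℓ).boxProd (SimpleGraph.pathGraph m)).Adj u v)
    (hw : gridPos w ∈ segment ℝ (gridPos u) (gridPos v)) : w = u ∨ w = v := by
  obtain ⟨a, b, hab, H⟩ := grid_edge h hw
  simp only [gridPos, Nat.cast_le, Nat.cast_inj] at H
  have key : w = a ∨ w = b := by
    simp only [Prod.ext_iff, Fin.ext_iff]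
    omega
  rcases hab with ⟨rfl, rfl⟩ | ⟨rfl, rfl⟩
  · exact key
  · exact key.symm

theorem nat_le_of_between {i j : ℕ} {t : ℝ} (h : (i : ℝ) ≤ t) (h' : t ≤ (j : ℝ)) : i ≤ j := by
  exact_mod_cast h.trans h'

theorem grid_noncrossing {ℓ m : ℕ} (u v u' v' : Fin ℓ × Fin m)
    (h : ((SimpleGraph.pathGraph ℓ).boxProd (SimpleGraph.pathGraph m)).Adj u v)
    (h' : ((SimpleGraph.pathGraph ℓ).boxProd (SimpleGraph.pathGraph m)).Adj u' v') (z : ℝ × ℝ)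
    (hz : z ∈ segment ℝ (gridPos u) (gridPos v)) (hz' : z ∈ segment ℝ (gridPos u') (gridPos v')) :
    s(u, v) = s(u', v') ∨ ∃ w, z = gridPos w ∧ (w = u ∨ w = v) ∧ (w = u' ∨ w = v') := by
  -- `z` is a grid vertex as soon as both its coordinates are natural numbers `i`, `j` of a vertex `w`
  have vert : ∀ w : Fin ℓ × Fin m, z = gridPos w →
      s(u, v) = s(u', v') ∨ ∃ w, z = gridPos w ∧ (w = u ∨ w = v) ∧ (w = u' ∨ w = v') := by
    intro w hw
    exact Or.inr ⟨w, hw, grid_vertex_on_edge u v w h (hw ▸ hz),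
      grid_vertex_on_edge u' v' w h' (hw ▸ hz')⟩
  obtain ⟨a, b, hab, H⟩ := grid_edge h hz
  obtain ⟨a', b', hab', H'⟩ := grid_edge h' hz'
  have same : a = a' → b = b' → s(u, v) = s(u', v') := by
    rintro rfl rfl
    rcases hab with ⟨rfl, rfl⟩ | ⟨rfl, rfl⟩ <;> rcases hab' with ⟨rfl, rfl⟩ | ⟨h1, h2⟩ <;>
      simp_all [Sym2.eq_swap]
  rcases H with ⟨H1, H2, H3, H4, H5⟩ | ⟨H1, H2, H3, H4, H5⟩ <;>
    rcases H' with ⟨K1, K2, K3, K4, K5⟩ | ⟨K1, K2, K3, K4, K5⟩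
  · have e2 : (a.2 : ℕ) = a'.2 := by rw [H5] at K5; exact_mod_cast K5
    have := nat_le_of_between H3 K4
    have := nat_le_of_between K3 H4
    rcases lt_trichotomy (a.1 : ℕ) a'.1 with c | c | c
    · have c' : (b.1 : ℕ) = a'.1 := by omega
      exact vert a' (Prod.ext (le_antisymm (by rw [c'] at H4; exact H4) K3) K5)
    · exact Or.inl (same (Prod.ext (Fin.ext c) (Fin.ext e2))
        (Prod.ext (Fin.ext (by omega)) (Fin.ext (by omega))))
    · have c' : (b'.1 : ℕ) = a.1 := by omega
      exact vert a (Prod.ext (le_antisymm (by rw [c'] at K4; exact K4) H3) H5)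
  · exact vert (a'.1, a.2) (Prod.ext K5 H5)
  · exact vert (a.1, a'.2) (Prod.ext H5 K5)
  · have e1 : (a.1 : ℕ) = a'.1 := by rw [H5] at K5; exact_mod_cast K5
    have := nat_le_of_between H3 K4
    have := nat_le_of_between K3 H4
    rcases lt_trichotomy (a.2 : ℕ) a'.2 with c | c | c
    · have c' : (b.2 : ℕ) = a'.2 := by omega
      exact vert a' (Prod.ext K5 (le_antisymm (by rw [c'] at H4; exact H4) K3))
    · exact Or.inl (same (Prod.ext (Fin.ext e1) (Fin.ext c))
        (Prod.ext (Fin.ext (by omega)) (Fin.ext (by omega))))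
    · have c' : (b'.2 : ℕ) = a.2 := by omega
      exact vert a (Prod.ext H5 (le_antisymm (by rw [c'] at K4; exact K4) H3))

/-- The grid graph `P_ℓ □ P_m`, drawn in the plane in the standard way, with its boustrophedon
labelling. -/
def planeGrid (ℓ m : ℕ) : LabelledPlaneGraph (Fin ℓ × Fin m) where
  graph := (SimpleGraph.pathGraph ℓ).boxProd (SimpleGraph.pathGraph m)
  label := boustrophedon
  pos := gridPos
  label_bij := boustrophedon_bij ℓ m
  pos_injective := gridPos_injective ℓ m
  vertex_on_edge := grid_vertex_on_edge
  noncrossing := grid_noncrossing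

theorem path_label_bij (n : ℕ) :
    Set.BijOn (fun r : Fin n => (r : ℕ) + 1) Set.univ (Set.Icc 1 (Nat.card (Fin n))) := by
  refine ⟨?_, ?_, ?_⟩
  · intro r _
    simp only [Nat.card_eq_fintype_card, Fintype.card_fin, Set.mem_Icc]
    omega
  · intro r _ s _ h
    exact Fin.ext (by simpa using h)
  · intro k hk
    simp only [Nat.card_eq_fintype_card, Fintype.card_fin, Set.mem_Icc] at hk
    exact ⟨⟨k - 1, by omega⟩, Set.mem_univ _, by simp; omega⟩

/-- The path graph `P_n`, drawn along a line and labelled `1, …, n` from one leaf to the other. -/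
def planePath (n : ℕ) : LabelledPlaneGraph (Fin n) where
  graph := SimpleGraph.pathGraph n
  label r := (r : ℕ) + 1
  pos r := gridPos (r, (0 : Fin 1))
  label_bij := path_label_bij n
  pos_injective := fun r s h => by simpa using gridPos_injective n 1 h
  vertex_on_edge := fun u v w h hw => by
    simpa using grid_vertex_on_edge (u, (0 : Fin 1)) (v, 0) (w, 0)
      (SimpleGraph.boxProd_adj.2 (Or.inl ⟨h, rfl⟩)) hw
  noncrossing := fun u v u' v' h h' z hz hz' => by
    rcases grid_noncrossing (u, (0 : Fin 1)) (v, 0) (u', 0) (v', 0)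
      (SimpleGraph.boxProd_adj.2 (Or.inl ⟨h, rfl⟩))
      (SimpleGraph.boxProd_adj.2 (Or.inl ⟨h', rfl⟩)) z hz hz' with h | ⟨⟨w, i⟩, hw, h1, h2⟩
    · left; simpa using h
    · right
      obtain rfl : i = 0 := Subsingleton.elim _ _
      exact ⟨w, hw, by simpa using h1, by simpa using h2⟩

/-- Edge weights of the three-dimensional grid: `a`, `b`, `c` for the edges along the three axes. -/
def axisWeight {ℓ m n : ℕ} (a b c : ℝ) (u v : (Fin ℓ × Fin m) × Fin n) : ℝ :=
  if u.2 ≠ v.2 then c else if u.1.2 ≠ v.1.2 then b else a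

/-- The monopole-dimer partition function of the Cartesian product of `P_ℓ □ P_m` with `P_n`. -/
noncomputable def gridPartition (ℓ m n : ℕ) (x a b c : ℝ) : ℝ :=
  monopoleDimerPartition (planeGrid ℓ m) (planePath n) (fun _ => x) (axisWeight a b c)

/-! ### The product formula -/

open Real

/-- `S_n(c; x)` -/
noncomputable def gridS (n : ℕ) (c x : ℝ) : ℝ :=
  ∏ k ∈ Finset.Icc 1 (n / 2), (x ^ 2 + 4 * c ^ 2 * cos (π * k / (n + 1)) ^ 2)

/-- `T_{n,ℓ}(a, b; x)` -/
noncomputable def gridT (n ℓ : ℕ) (a b x : ℝ) : ℝ :=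
  ∏ j ∈ Finset.Icc 1 (n / 2), ∏ k ∈ Finset.Icc 1 (ℓ / 2),
    (x ^ 2 + 4 * a ^ 2 * cos (π * k / (ℓ + 1)) ^ 2 + 4 * b ^ 2 * cos (π * j / (n + 1)) ^ 2)

/-- The factor depending on the parities of `ℓ`, `m`, `n`. -/
noncomputable def parityFactor (ℓ m n : ℕ) (x a b c : ℝ) : ℝ :=
  if Even ℓ then
    if Even m then
      if Even n then 1
      else gridT m ℓ a b x ^ 2
    else
      if Even n then gridT n ℓ a c x ^ 2
      else gridT n ℓ a c x ^ 2 * gridT m ℓ a b x ^ 2 * gridS ℓ a x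
  else
    if Even m then
      if Even n then gridT n m b c x ^ 2
      else gridT n m b c x ^ 2 * gridT m ℓ a b x ^ 2 * gridS m b x
    else
      if Even n then gridT n m b c x ^ 2 * gridT n ℓ a c x ^ 2 * gridS n c x
      else x * gridT n m b c x ^ 2 * gridT n ℓ a c x ^ 2 * gridT m ℓ a b x ^ 2 *
        gridS n c x * gridS m b x * gridS ℓ a x

/-- The right-hand side of the product formula. -/
noncomputable def gridFormula (ℓ m n : ℕ) (x a b c : ℝ) : ℝ :=
  (∏ j ∈ Finset.Icc 1 (n / 2), ∏ s ∈ Finset.Icc 1 (m / 2), ∏ k ∈ Finset.Icc 1 (ℓ / 2),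
    (x ^ 2 + 4 * a ^ 2 * cos (π * k / (ℓ + 1)) ^ 2 + 4 * b ^ 2 * cos (π * s / (m + 1)) ^ 2 +
      4 * c ^ 2 * cos (π * j / (n + 1)) ^ 2) ^ 4) * parityFactor ℓ m n x a b c

end MonopoleDimer

/-! Both partition functions equal det(x + K), where K is the weighted adjacency matrix of G with
signs given by `productArc`. This determinant is then computed one axis at a time.

The expansion: G is bipartite, so the permutations that survive in det(x + K) are exactly those
whose nontrivial cycles are even loops. An even cycle is an odd permutation, and this is the minus
sign in the loop weight (`loopVertexPartition_eq_det`).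

The two models: it suffices that sgn(L) is minus the product of the orientation signs along L
(`isLoopSign_cast`). This follows from a Kasteleyn property of the factors: the sign of each
directed cycle is the product of its orientation signs. The sign of a decomposition is then a
product over the directed edges of the projection, so the choice of decomposition drops out. A
decomposition exists because the projection has equal in- and out-degrees
(`exists_cycle_decomposition`). A path has only doubled edges as cycles. For the grid
(`cycleSign_planeGrid`), the exponent modulo 2 of a step's sign is the change of the product of the
coordinates, plus the abscissa of a vertical step, plus 1 for a step to the left or down. Around a
cycle of length N > 2 the first term cancels and the last gives N/2. The abscissas count the
crossings of the cycle with the rays to the right of all grid points. Points on the cycle contribute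
N/2 + 1 (`sum_rowSum_eq`) and the others contribute the number of enclosed vertices, so enclosed + 1
remains. The topology is discrete: a Hopf secant argument for the turning number modulo 2, and a
Jordan theorem for grid polygons (`encloses_iff`).

The determinant: K is block tridiagonal, with diagonal blocks alternating between M and -M and with
off-diagonal blocks c and -c. The blocks commute, so the determinant may first be taken over ℝ[X],
where zeros of Chebyshev polynomials factor it (`det_blockPath`). For skew M, det(t - M²) = det(√t +
M)², which leads back to the same problem in one dimension less. Each of the two outer axes squares
the generic factor, whence the fourth power. -/

namespace MonopoleDimer

/-! ### Tridiagonal determinants -/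

section Tridiagonal

variable {S : Type*} [CommRing S]

/-- The tridiagonal matrix with diagonal `d`, constant superdiagonal `c` and subdiagonal `-c`. -/
def skewTridiagonal (n : ℕ) (d : ℕ → S) (c : S) : Matrix (Fin n) (Fin n) S :=
  Matrix.of fun i j =>
    if i = j then d i else if (i : ℕ) + 1 = j then c else if (j : ℕ) + 1 = i then -c else 0

/-- Laplace expansion along the first row, which has two nonzero entries; the only nonzero entry in
the first column of the second minor is -c. -/
theorem det_skewTridiagonal_succ_succ (n : ℕ) (d : ℕ → S) (c : S) :
    (skewTridiagonal (n + 2) d c).det =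
      d 0 * (skewTridiagonal (n + 1) (fun i => d (i + 1)) c).det +
        c ^ 2 * (skewTridiagonal n (fun i => d (i + 2)) c).det := by
  have h0 : (skewTridiagonal (n + 2) d c).submatrix Fin.succ (Fin.succAbove 0) =
      skewTridiagonal (n + 1) (fun i => d (i + 1)) c := by
    ext i j
    simp [skewTridiagonal, Fin.ext_iff]
  have h1 : ((skewTridiagonal (n + 2) d c).submatrix Fin.succ (Fin.succAbove 1)).det =
      -c * (skewTridiagonal n (fun i => d (i + 2)) c).det := by
    rw [Matrix.det_succ_column_zero, Fin.sum_univ_succ, Finset.sum_eq_zero]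
    · have : ((skewTridiagonal (n + 2) d c).submatrix Fin.succ (Fin.succAbove 1)).submatrix
          (Fin.succAbove 0) Fin.succ = skewTridiagonal n (fun i => d (i + 2)) c := by
        ext i j
        simp [skewTridiagonal, Fin.ext_iff, Fin.succAbove, Fin.lt_def]
      rw [this]
      simp [skewTridiagonal, Fin.ext_iff, Fin.succAbove]
    · intro i _
      simp [skewTridiagonal, Fin.ext_iff, Fin.succAbove]
  rw [Matrix.det_succ_row_zero, Fin.sum_univ_succ, Fin.sum_univ_succ, Finset.sum_eq_zero, h0]
  · have : (Fin.succ 0 : Fin (n + 2)) = 1 := rfl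
    rw [this, h1]
    simp [skewTridiagonal, Fin.ext_iff]
    ring
  · intro i _
    simp [skewTridiagonal, Fin.ext_iff]

/-- The polynomials governing the determinant of a skew tridiagonal matrix with alternating diagonal. -/
def pathPoly (w e : S) : ℕ → S
  | 0 => 1
  | 1 => 1
  | n + 2 => (if Even n then w else 1) * pathPoly w e (n + 1) + e * pathPoly w e n

/-- Deleting the first row and column replaces y by -y and fixes x² - y². In the recursion the
leading factor x + y therefore alternately meets x - y, giving x² - y², or stays in front. -/
theorem det_skewTridiagonal_alternating (n : ℕ) (x y c : S) :
    (skewTridiagonal n (fun i => x + (-1) ^ i * y) c).det =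
      (x + y) ^ (n % 2) * pathPoly (x ^ 2 - y ^ 2) (c ^ 2) n := by
  -- The induction must range over all y, because the tail has -y in place of y.
  suffices H : ∀ y, (skewTridiagonal n (fun i => x + (-1) ^ i * y) c).det =
      (x + y) ^ (n % 2) * pathPoly (x ^ 2 - y ^ 2) (c ^ 2) n from H y
  induction n using Nat.twoStepInduction with
  | zero => intro y; simp [pathPoly]
  | one => intro y; simp [pathPoly, skewTridiagonal]
  | more n ih0 ih1 =>
    intro y
    rw [det_skewTridiagonal_succ_succ]
    have e1 : (fun i : ℕ => x + (-1) ^ (i + 1) * y) = fun i => x + (-1) ^ i * (-y) := by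
      ext i; simp [pow_succ]
    have e2 : (fun i : ℕ => x + (-1) ^ (i + 2) * y) = fun i => x + (-1) ^ i * y := by
      ext i; simp [pow_succ]
    rw [e1, e2, ih0, ih1, neg_sq]
    rcases Nat.even_or_odd n with h | h
    · have a : n % 2 = 0 := Nat.even_iff.1 h
      have b : (n + 1) % 2 = 1 := by omega
      have c : (n + 2) % 2 = 0 := by omega
      simp only [a, b, c, pathPoly, h, if_true]
      ring
    · have a : n % 2 = 1 := Nat.odd_iff.1 h
      have b : (n + 1) % 2 = 0 := by omega
      have c : (n + 2) % 2 = 1 := by omega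
      simp only [a, b, c, pathPoly, Nat.not_even_iff_odd.2 h, if_false]
      ring

/-! ### Factorisation of the path polynomials through Chebyshev polynomials. -/

theorem map_pathPoly {S' : Type*} [CommRing S'] (f : S →+* S') (w e : S) (n : ℕ) :
    f (pathPoly w e n) = pathPoly (f w) (f e) n := by
  induction n using Nat.twoStepInduction with
  | zero => simp [pathPoly]
  | one => simp [pathPoly]
  | more n ih0 ih1 => simp [pathPoly, ih0, ih1, apply_ite f]

theorem pathPoly_zero_right (w : S) (n : ℕ) : pathPoly w 0 n = w ^ (n / 2) := by
  induction n using Nat.twoStepInduction with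
  | zero => simp [pathPoly]
  | one => simp [pathPoly]
  | more n ih0 ih1 =>
    simp only [pathPoly, ih1, zero_mul, add_zero]
    rcases Nat.even_or_odd' n with ⟨k, rfl | rfl⟩
    · have a : (2 * k + 1) / 2 = k := by omega
      have b : (2 * k + 2) / 2 = k + 1 := by omega
      simp [a, b, pow_succ']
    · have a : (2 * k + 1 + 1) / 2 = k + 1 := by omega
      have b : (2 * k + 1 + 2) / 2 = k + 1 := by omega
      simp [a, b]

-- The three-term recurrence of U, rescaled so that apart from a parity factor only y² occurs. It
-- ties `pathPoly` to polynomials with known zeros.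
open Polynomial in
theorem chebyshevU_eq_pathPoly (c y : ℝ) (n : ℕ) :
    (-c ^ 2) ^ (n / 2) * (Chebyshev.U ℝ n).eval y =
      (2 * y) ^ (n % 2) * pathPoly (-4 * c ^ 2 * y ^ 2) (c ^ 2) n := by
  induction n using Nat.twoStepInduction with
  | zero => simp [pathPoly]
  | one => simp [pathPoly]
  | more n ih0 ih1 =>
    have h : (Chebyshev.U ℝ ((n + 2 : ℕ) : ℤ)).eval y =
        2 * y * (Chebyshev.U ℝ ((n + 1 : ℕ) : ℤ)).eval y - (Chebyshev.U ℝ (n : ℤ)).eval y := by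
      push_cast
      rw [Chebyshev.U_add_two]
      simp
    rw [h]
    rcases Nat.even_or_odd' n with ⟨k, rfl | rfl⟩
    · have a : (2 * k + 1) / 2 = k := by omega
      have b : (2 * k + 2) / 2 = k + 1 := by omega
      have a' : (2 * k + 1) % 2 = 1 := by omega
      have b' : (2 * k + 2) % 2 = 0 := by omega
      have d : 2 * k / 2 = k := by omega
      have d' : 2 * k % 2 = 0 := by omega
      rw [a, a'] at ih1
      rw [d, d'] at ih0
      rw [b, b']
      simp only [pathPoly, even_two_mul, if_true]
      linear_combination (-c ^ 2 * 2 * y) * ih1 + c ^ 2 * ih0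
    · have a : (2 * k + 1 + 1) / 2 = k + 1 := by omega
      have b : (2 * k + 1 + 2) / 2 = k + 1 := by omega
      have a' : (2 * k + 1 + 1) % 2 = 0 := by omega
      have b' : (2 * k + 1 + 2) % 2 = 1 := by omega
      have d : (2 * k + 1) / 2 = k := by omega
      have d' : (2 * k + 1) % 2 = 1 := by omega
      have hne : ¬ Even (2 * k + 1) := by simp
      rw [a, a'] at ih1
      rw [d, d'] at ih0
      rw [b, b']
      simp only [pathPoly, hne, if_false]
      simp only [pathPoly] at ih1
      linear_combination (2 * y) * ih1 + c ^ 2 * ih0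

open Real Polynomial in
theorem chebyshevU_eval_eq_prod (n : ℕ) (y : ℝ) :
    (Chebyshev.U ℝ n).eval y = ∏ k ∈ Finset.range n, (2 * y - 2 * cos ((k + 1) * π / (n + 1))) := by
  have hcard : (Chebyshev.U ℝ n).roots.card = (Chebyshev.U ℝ n).natDegree := by
    rw [Chebyshev.roots_U_real, Chebyshev.natDegree_U_natCast, Finset.card_val,
      Finset.card_image_of_injOn, Finset.card_range]
    exact (Finset.range n).nodup_map_iff_injOn.mp (Chebyshev.roots_U_real_nodup n)
  have h := C_leadingCoeff_mul_prod_multiset_X_sub_C hcard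
  rw [Chebyshev.roots_U_real, Chebyshev.leadingCoeff_U_natCast, Finset.image_val_of_injOn
    ((Finset.range n).nodup_map_iff_injOn.mp (Chebyshev.roots_U_real_nodup n)), Multiset.map_map] at h
  rw [← h]
  change eval y (C (2 ^ n) * ∏ k ∈ Finset.range n, (X - C (cos ((k + 1) * π / (n + 1))))) = _
  simp only [eval_mul, eval_C, eval_prod, eval_sub, eval_X]
  simp_rw [← mul_sub, Finset.prod_mul_distrib]
  simp

-- The zeros with indices k and n - 1 - k are opposite; for odd n the middle zero is 0 and leaves
-- the factor 2y.
open Real in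
theorem prod_two_mul_sub_two_mul_cos (n : ℕ) (y : ℝ) :
    ∏ k ∈ Finset.range n, (2 * y - 2 * cos ((k + 1) * π / (n + 1))) =
      (2 * y) ^ (n % 2) *
        ∏ k ∈ Finset.Icc 1 (n / 2), (4 * y ^ 2 - 4 * cos (π * k / (n + 1)) ^ 2) := by
  set h := n / 2 with hh
  have hicc : ∏ k ∈ Finset.Icc 1 h, (4 * y ^ 2 - 4 * cos (π * k / (n + 1)) ^ 2) =
      ∏ k ∈ Finset.range h, (4 * y ^ 2 - 4 * cos ((k + 1) * π / (n + 1)) ^ 2) := by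
    rw [← Finset.Ico_succ_right_eq_Icc, Finset.prod_Ico_eq_prod_range]
    refine Finset.prod_congr (by simp) fun k _ => ?_
    push_cast
    rw [mul_comm π, add_comm (1 : ℝ)]
  have hsplit : ∀ F : ℕ → ℝ, ∏ k ∈ Finset.range n, F k =
      (if n % 2 = 1 then F h else 1) *
        ((∏ k ∈ Finset.range h, F k) * ∏ k ∈ Finset.range h, F (n - 1 - k)) := by
    intro F
    have hrefl : ∏ k ∈ Finset.range h, F (n - 1 - k) =
        ∏ k ∈ Finset.range h, F (h + n % 2 + k) := by
      rw [← Finset.prod_range_reflect]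
      refine Finset.prod_congr rfl fun k hk => ?_
      rw [Finset.mem_range] at hk
      congr 1
      omega
    rw [hrefl]
    have hn : n = h + n % 2 + h := by omega
    conv_lhs => rw [hn, Finset.prod_range_add]
    rcases Nat.mod_two_eq_zero_or_one n with e | e
    · simp [e]
    · simp only [e, if_true, Finset.prod_range_succ]
      ring
  rw [hicc, hsplit, ← Finset.prod_mul_distrib]
  have hpos : (n : ℝ) + 1 ≠ 0 := by positivity
  congr 1
  · rcases Nat.mod_two_eq_zero_or_one n with e | e
    · simp [e]
    · have : (n : ℝ) = 2 * h + 1 := by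
        have : n = 2 * h + 1 := by omega
        exact_mod_cast this
      have e2 : ((h : ℝ) + 1) * π / (n + 1) = π / 2 := by
        rw [this]; field_simp; ring
      simp [e, e2]
  · refine Finset.prod_congr rfl fun k hk => ?_
    rw [Finset.mem_range] at hk
    have e : ((n - 1 - k : ℕ) : ℝ) = n - 1 - k := by
      rw [Nat.sub_sub, Nat.cast_sub (by omega)]; push_cast; ring
    have e2 : (((n - 1 - k : ℕ) : ℝ) + 1) * π / (n + 1) = π - (k + 1) * π / (n + 1) := by
      rw [e]; field_simp; ring
    rw [e2, cos_pi_sub]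
    ring

-- Both sides are polynomials in w. For c ≠ 0 and w < 0, writing w = -4c²y² with y ≠ 0 reduces the
-- claim to the factorisation of U, after cancelling a power of 2y; infinitely many w suffice.
open Real Polynomial in
theorem pathPoly_real (w c : ℝ) (n : ℕ) :
    pathPoly w (c ^ 2) n =
      ∏ k ∈ Finset.Icc 1 (n / 2), (w + 4 * c ^ 2 * cos (π * k / (n + 1)) ^ 2) := by
  rcases eq_or_ne c 0 with rfl | hc
  · simp [pathPoly_zero_right]
  have key : pathPoly (X : ℝ[X]) (C (c ^ 2)) n =
      ∏ k ∈ Finset.Icc 1 (n / 2), (X + C (4 * c ^ 2 * cos (π * k / (n + 1)) ^ 2)) := by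
    apply Polynomial.eq_of_infinite_eval_eq
    refine (Set.Iio_infinite (0 : ℝ)).mono fun t ht => ?_
    rw [Set.mem_Iio] at ht
    obtain ⟨y, hy, rfl⟩ : ∃ y : ℝ, y ≠ 0 ∧ -4 * c ^ 2 * y ^ 2 = t := by
      have hc2 : 0 < c ^ 2 := by positivity
      refine ⟨√(-t / (4 * c ^ 2)), (Real.sqrt_pos.2 (div_pos (by linarith) (by positivity))).ne', ?_⟩
      rw [Real.sq_sqrt (div_nonneg (by linarith) (by positivity))]
      field_simp
    change evalRingHom _ _ = evalRingHom _ _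
    rw [map_pathPoly, map_prod]
    simp only [coe_evalRingHom, eval_X, eval_C, eval_add]
    have h := chebyshevU_eq_pathPoly c y n
    rw [chebyshevU_eval_eq_prod, prod_two_mul_sub_two_mul_cos] at h
    have h2 : (2 * y) ^ (n % 2) ≠ 0 := pow_ne_zero _ (by simpa using hy)
    refine (mul_left_cancel₀ h2 ?_)
    rw [← h, mul_left_comm]
    congr 1
    have : (-c ^ 2) ^ (n / 2) = ∏ k ∈ Finset.Icc 1 (n / 2), (-c ^ 2) := by simp
    rw [this, ← Finset.prod_mul_distrib]
    refine Finset.prod_congr rfl fun k _ => by ring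
  have := congrArg (evalRingHom w) key
  rw [map_pathPoly, map_prod] at this
  simpa using this

open Real in
/-- The factorisation of `pathPoly` over a commutative real algebra. -/
theorem pathPoly_algebraMap [Algebra ℝ S] (w : S) (c : ℝ) (n : ℕ) :
    pathPoly w (algebraMap ℝ S c ^ 2) n =
      ∏ k ∈ Finset.Icc 1 (n / 2), (w + algebraMap ℝ S (4 * c ^ 2 * cos (π * k / (n + 1)) ^ 2)) := by
  -- An identity in ℝ[X] can be evaluated at `w` in any commutative real algebra.
  have key : pathPoly (Polynomial.X : Polynomial ℝ) (Polynomial.C (c ^ 2)) n =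
      ∏ k ∈ Finset.Icc 1 (n / 2),
        (Polynomial.X + Polynomial.C (4 * c ^ 2 * cos (π * k / (n + 1)) ^ 2)) := by
    refine Polynomial.funext fun t => ?_
    change Polynomial.evalRingHom t _ = Polynomial.evalRingHom t _
    rw [map_pathPoly, map_prod]
    simpa using pathPoly_real t c n
  have := congrArg ((Polynomial.aeval w : Polynomial ℝ →ₐ[ℝ] S) : Polynomial ℝ →+* S) key
  rw [map_pathPoly, map_prod] at this
  simpa using this

end Tridiagonal

/-! ### The determinant of the signed adjacency matrix of a grid -/

section BlockDeterminant

variable {ι : Type*} [Fintype ι] [DecidableEq ι]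

/-- The block tridiagonal matrix with diagonal blocks `x ± M` and off-diagonal blocks `± c`. -/
def blockPath (M : Matrix ι ι ℝ) (x c : ℝ) (n : ℕ) : Matrix (ι × Fin n) (ι × Fin n) ℝ :=
  Matrix.of fun u v =>
    if u.2 = v.2 then x * (1 : Matrix ι ι ℝ) u.1 v.1 + (-1) ^ (u.2 : ℕ) * M u.1 v.1
    else if (u.2 : ℕ) + 1 = v.2 then c * (1 : Matrix ι ι ℝ) u.1 v.1
    else if (v.2 : ℕ) + 1 = u.2 then -(c * (1 : Matrix ι ι ℝ) u.1 v.1) else 0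

-- All blocks are polynomials in M, hence commute. `Matrix.det_det` allows the determinant to be
-- taken first over ℝ[X], where the matrix is tridiagonal with diagonal x ± X, and then again after
-- the substitution of M for X.
open Real Polynomial in
theorem det_blockPath (M : Matrix ι ι ℝ) (x c : ℝ) (n : ℕ) :
    (blockPath M x c n).det = (x • 1 + M).det ^ (n % 2) *
      ∏ j ∈ Finset.Icc 1 (n / 2),
        ((x ^ 2 + 4 * c ^ 2 * cos (π * j / (n + 1)) ^ 2) • 1 - M ^ 2).det := by
  set f : ℝ[X] →+* Matrix ι ι ℝ := ((aeval M : ℝ[X] →ₐ[ℝ] Matrix ι ι ℝ) : ℝ[X] →+* Matrix ι ι ℝ)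
    with hf
  have fC : ∀ r : ℝ, f (C r) = r • 1 := fun r => by simp [hf, Algebra.algebraMap_eq_smul_one]
  have fX : f X = M := by simp [hf]
  set g : ℝ[X] →* ℝ := Matrix.detMonoidHom.comp (f : ℝ[X] →* Matrix ι ι ℝ) with hg
  have gdet : ∀ p, g p = (f p).det := fun p => rfl
  have h := Matrix.det_det (M := skewTridiagonal n (fun i => C x + (-1) ^ i * X) (C c)) (f := f)
  rw [det_skewTridiagonal_alternating, ← algebraMap_eq, pathPoly_algebraMap, algebraMap_eq,
    ← gdet, map_mul, map_pow, map_prod] at h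
  have hb : (blockPath M x c n).det =
      (((skewTridiagonal n (fun i => C x + (-1) ^ i * X) (C c)).map f).comp
        (Fin n) (Fin n) ι ι ℝ).det := by
    rw [← Matrix.det_submatrix_equiv_self (Equiv.prodComm ι (Fin n))]
    congr 1
    ext ⟨u, r⟩ ⟨v, s⟩
    simp only [blockPath, skewTridiagonal, Matrix.of_apply, Matrix.submatrix_apply, Matrix.comp_apply,
      Matrix.map_apply, Equiv.prodComm_apply, Prod.swap]
    split_ifs with h1 h2 h3
    · rcases Nat.even_or_odd (r : ℕ) with e | e <;> simp [fC, fX, e.neg_one_pow]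
    · simp [fC]
    · simp [fC]
    · simp
  rw [hb, ← h]
  congr 1
  · simp [gdet, fC, fX]
  · refine Finset.prod_congr rfl fun j _ => ?_
    rw [gdet, map_add, map_sub, map_pow, map_pow, fC, fX, fC, add_smul, _root_.smul_pow, one_pow]
    congr 1
    abel

omit [Fintype ι] in
theorem smul_one_add_blockPath (M : Matrix ι ι ℝ) (x c : ℝ) (n : ℕ) :
    x • 1 + blockPath M 0 c n = blockPath M x c n := by
  ext ⟨u, r⟩ ⟨v, s⟩
  simp only [blockPath, Matrix.add_apply, Matrix.smul_apply, Matrix.of_apply, Matrix.one_apply,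
    Prod.mk.injEq, smul_eq_mul]
  by_cases h : r = s <;> by_cases h' : u = v <;> simp [h, h']

omit [Fintype ι] in
theorem blockPath_transpose {M : Matrix ι ι ℝ} (hM : M.transpose = -M) (c : ℝ) (n : ℕ) :
    (blockPath M 0 c n).transpose = -blockPath M 0 c n := by
  have hM' : ∀ u v, M u v = -M v u := fun u v => by
    simpa using congrFun (congrFun hM v) u
  ext ⟨u, r⟩ ⟨v, s⟩
  simp only [blockPath, Matrix.transpose_apply, Matrix.neg_apply, Matrix.of_apply, Matrix.one_apply,
    eq_comm (a := v) (b := u), eq_comm (a := s) (b := r)]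
  by_cases h : r = s
  · subst h
    simp [hM' v u]
  · simp only [h, if_false]
    split_ifs <;> first | omega | simp

/-- The two factors √t + M and √t - M of t - M² are transposes of each other. -/
theorem det_sub_sq_of_skew {M : Matrix ι ι ℝ} (hM : M.transpose = -M) {t : ℝ} (ht : 0 ≤ t) :
    (t • 1 - M ^ 2).det = (√t • 1 + M).det ^ 2 := by
  have e : t • 1 - M ^ 2 = (√t • 1 + M) * (√t • 1 - M) := by
    rw [add_mul, mul_sub, mul_sub, smul_mul_smul_comm, Real.mul_self_sqrt ht]
    simp [pow_two]
  have e2 : (√t • (1 : Matrix ι ι ℝ) - M) = (√t • 1 + M).transpose := by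
    simp [hM, sub_eq_add_neg]
  rw [e, Matrix.det_mul, e2, Matrix.det_transpose, pow_two]

-- The recursion over the axes: removing an axis leaves the same kind of determinant for M, with x²
-- shifted by 4c²cos² of the angles of the removed path.
open Real in
theorem det_smul_one_add_blockPath {M : Matrix ι ι ℝ} (hM : M.transpose = -M) (x c : ℝ) (n : ℕ) :
    (x • 1 + blockPath M 0 c n).det = (x • 1 + M).det ^ (n % 2) *
      ∏ j ∈ Finset.Icc 1 (n / 2),
        (√(x ^ 2 + 4 * c ^ 2 * cos (π * j / (n + 1)) ^ 2) • 1 + M).det ^ 2 := by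
  rw [smul_one_add_blockPath, det_blockPath]
  congr 1
  exact Finset.prod_congr rfl fun j _ => det_sub_sq_of_skew hM (by positivity)

theorem skewTridiagonal_transpose (ℓ : ℕ) (a : ℝ) :
    (skewTridiagonal ℓ (fun _ => 0) a).transpose = -skewTridiagonal ℓ (fun _ => 0) a := by
  ext u v
  simp only [skewTridiagonal, Matrix.transpose_apply, Matrix.neg_apply, Matrix.of_apply,
    Fin.ext_iff]
  split_ifs <;> first | omega | simp

theorem det_smul_one_add_skewTridiagonal (ℓ : ℕ) (a x : ℝ) :
    (x • 1 + skewTridiagonal ℓ (fun _ => 0) a).det = x ^ (ℓ % 2) * gridS ℓ a x := by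
  have e : x • 1 + skewTridiagonal ℓ (fun _ => 0) a =
      skewTridiagonal ℓ (fun i => x + (-1) ^ i * 0) a := by
    ext u v
    simp only [skewTridiagonal, Matrix.add_apply, Matrix.smul_apply, Matrix.of_apply,
      Matrix.one_apply, smul_eq_mul]
    by_cases h : u = v <;> simp [h]
  rw [e, det_skewTridiagonal_alternating, pathPoly_real, gridS]
  simp

open Real in
theorem det_smul_one_add_skewTridiagonal_sqrt (ℓ : ℕ) (a : ℝ) {t : ℝ} (ht : 0 ≤ t) :
    (√t • 1 + skewTridiagonal ℓ (fun _ => 0) a).det ^ 2 = t ^ (ℓ % 2) *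
      (∏ k ∈ Finset.Icc 1 (ℓ / 2), (t + 4 * a ^ 2 * cos (π * k / (ℓ + 1)) ^ 2)) ^ 2 := by
  rw [det_smul_one_add_skewTridiagonal, mul_pow, ← pow_mul, mul_comm (ℓ % 2), pow_mul, gridS,
    Real.sq_sqrt ht]

/-- The signed adjacency matrix of the three-dimensional grid. -/
def gridMatrix (ℓ m n : ℕ) (a b c : ℝ) :
    Matrix ((Fin ℓ × Fin m) × Fin n) ((Fin ℓ × Fin m) × Fin n) ℝ :=
  blockPath (blockPath (skewTridiagonal ℓ (fun _ => 0) a) 0 b m) 0 c n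

open Real in
theorem det_gridMatrix (ℓ m n : ℕ) (x a b c : ℝ) :
    (x • 1 + gridMatrix ℓ m n a b c).det = gridFormula ℓ m n x a b c := by
  have h1 := skewTridiagonal_transpose ℓ a
  have h2 := blockPath_transpose h1 b m
  -- The cosine terms become opaque, so that only sums of A, B, C have to be rearranged.
  obtain ⟨A, hA⟩ : ∃ A : ℕ → ℝ, ∀ k : ℕ, 4 * a ^ 2 * cos (π * k / (ℓ + 1)) ^ 2 = A k := ⟨_, fun _ => rfl⟩
  obtain ⟨B, hB⟩ : ∃ B : ℕ → ℝ, ∀ s : ℕ, 4 * b ^ 2 * cos (π * s / (m + 1)) ^ 2 = B s := ⟨_, fun _ => rfl⟩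
  obtain ⟨C, hC⟩ : ∃ C : ℕ → ℝ, ∀ j : ℕ, 4 * c ^ 2 * cos (π * j / (n + 1)) ^ 2 = C j := ⟨_, fun _ => rfl⟩
  have B0 : ∀ s, 0 ≤ B s := fun s => hB s ▸ by positivity
  have C0 : ∀ j, 0 ≤ C j := fun j => hC j ▸ by positivity
  have d1 : ∀ t : ℝ, 0 ≤ t → (√t • 1 + skewTridiagonal ℓ (fun _ => 0) a).det ^ 2 =
      t ^ (ℓ % 2) * (∏ k ∈ Finset.Icc 1 (ℓ / 2), (t + A k)) ^ 2 := fun t ht => by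
    rw [det_smul_one_add_skewTridiagonal_sqrt ℓ a ht]
    simp only [hA]
  have d2 : ∀ y : ℝ, (y • 1 + blockPath (skewTridiagonal ℓ (fun _ => 0) a) 0 b m).det =
      (y ^ (ℓ % 2) * gridS ℓ a y) ^ (m % 2) * ∏ s ∈ Finset.Icc 1 (m / 2),
        ((y ^ 2 + B s) ^ (ℓ % 2) * (∏ k ∈ Finset.Icc 1 (ℓ / 2), (y ^ 2 + B s + A k)) ^ 2) := by
    intro y
    rw [det_smul_one_add_blockPath h1, det_smul_one_add_skewTridiagonal]
    congr 1
    refine Finset.prod_congr rfl fun s _ => ?_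
    rw [hB, d1 _ (add_nonneg (sq_nonneg y) (B0 s))]
  have S1 : ∀ y : ℝ, gridS ℓ a y = ∏ k ∈ Finset.Icc 1 (ℓ / 2), (y ^ 2 + A k) := fun y => by
    simp only [gridS, hA]
  have d3 : ∀ t : ℝ, 0 ≤ t →
      (√t • 1 + blockPath (skewTridiagonal ℓ (fun _ => 0) a) 0 b m).det ^ 2 =
      (t ^ (ℓ % 2) * (∏ k ∈ Finset.Icc 1 (ℓ / 2), (t + A k)) ^ 2) ^ (m % 2) *
        (∏ s ∈ Finset.Icc 1 (m / 2),
          ((t + B s) ^ (ℓ % 2) * (∏ k ∈ Finset.Icc 1 (ℓ / 2), (t + B s + A k)) ^ 2)) ^ 2 := by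
    intro t ht
    rw [d2, S1, Real.sq_sqrt ht, mul_pow, ← pow_mul, mul_comm (m % 2), pow_mul, mul_pow, ← pow_mul,
      mul_comm (ℓ % 2), pow_mul, Real.sq_sqrt ht]
  have e1 : ∀ j s k, x ^ 2 + B s + C j + A k = x ^ 2 + A k + B s + C j := fun j s k => by ring
  have e2 : ∀ j k, x ^ 2 + C j + A k = x ^ 2 + A k + C j := fun j k => by ring
  have e3 : ∀ j s, x ^ 2 + C j + B s = x ^ 2 + B s + C j := fun j s => by ring
  have e4 : ∀ s k, x ^ 2 + B s + A k = x ^ 2 + A k + B s := fun s k => by ring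
  have d4 : (x • 1 + gridMatrix ℓ m n a b c).det =
      ((x ^ (ℓ % 2) * ∏ k ∈ Finset.Icc 1 (ℓ / 2), (x ^ 2 + A k)) ^ (m % 2) *
        ∏ s ∈ Finset.Icc 1 (m / 2), ((x ^ 2 + B s) ^ (ℓ % 2) *
          (∏ k ∈ Finset.Icc 1 (ℓ / 2), (x ^ 2 + A k + B s)) ^ 2)) ^ (n % 2) *
      ∏ j ∈ Finset.Icc 1 (n / 2),
        (((x ^ 2 + C j) ^ (ℓ % 2) * (∏ k ∈ Finset.Icc 1 (ℓ / 2), (x ^ 2 + A k + C j)) ^ 2) ^ (m % 2) *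
        (∏ s ∈ Finset.Icc 1 (m / 2), ((x ^ 2 + B s + C j) ^ (ℓ % 2) *
          (∏ k ∈ Finset.Icc 1 (ℓ / 2), (x ^ 2 + A k + B s + C j)) ^ 2)) ^ 2) := by
    rw [gridMatrix, det_smul_one_add_blockPath h2, d2, S1]
    simp only [e4]
    congr 1
    refine Finset.prod_congr rfl fun j _ => ?_
    rw [hC, d3 _ (add_nonneg (sq_nonneg x) (C0 j))]
    simp only [e1, e2, e3]
  rw [d4]
  simp only [gridFormula, parityFactor, gridT, gridS, hA, hB, hC]
  rcases Nat.even_or_odd ℓ with p | p <;> rcases Nat.even_or_odd m with q | q <;>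
    rcases Nat.even_or_odd n with r | r <;>
    simp only [p, q, r, if_true, if_false, Nat.even_iff.1, Nat.odd_iff.1, Nat.not_even_iff_odd.2,
      pow_zero, pow_one, one_mul, Finset.prod_mul_distrib, Finset.prod_pow] <;>
    ring

end BlockDeterminant

/-! ### The partition function of the loop-vertex model as a determinant -/

section Determinant

variable {V : Type} [Fintype V] [DecidableEq V]

open Equiv.Perm

theorem mem_support_iff_exists_mem_cycleFactorsFinset {σ : Equiv.Perm V} {v : V} :
    v ∈ σ.support ↔ ∃ f ∈ σ.cycleFactorsFinset, v ∈ f.support := by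
  rw [mem_support_iff_mem_support_of_mem_cycleFactorsFinset]

theorem support_eq_biUnion_cycleFactorsFinset (σ : Equiv.Perm V) :
    σ.support = σ.cycleFactorsFinset.biUnion support := by
  ext v
  rw [Finset.mem_biUnion, mem_support_iff_exists_mem_cycleFactorsFinset]

theorem sign_eq_prod_cycleFactorsFinset (σ : Equiv.Perm V) :
    sign σ = ∏ f ∈ σ.cycleFactorsFinset, sign f := by
  conv_lhs => rw [← cycleFactorsFinset_noncommProd σ]
  rw [Finset.map_noncommProd, Finset.noncommProd_eq_prod]
  rfl

theorem disjoint_support_of_mem_cycleFactorsFinset {σ f g : Equiv.Perm V}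
    (hf : f ∈ σ.cycleFactorsFinset) (hg : g ∈ σ.cycleFactorsFinset) (h : f ≠ g) :
    Disjoint f.support g.support :=
  disjoint_iff_disjoint_support.1 (cycleFactorsFinset_pairwise_disjoint σ hf hg h)

theorem exists_cycleFactorsFinset_eq {C : Finset (Equiv.Perm V)} (hC : ∀ f ∈ C, f.IsCycle)
    (hd : ∀ f ∈ C, ∀ g ∈ C, f ≠ g → Disjoint f.support g.support) :
    ∃ σ : Equiv.Perm V, σ.cycleFactorsFinset = C :=
  ⟨_, cycleFactorsFinset_eq_finset.2 ⟨hC, fun f hf g hg h =>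
    disjoint_iff_disjoint_support.2 (hd f hf g hg h), rfl⟩⟩

theorem mem_configurations {G : SimpleGraph V} {C : Finset (Equiv.Perm V)} :
    C ∈ configurations G ↔ (∀ f ∈ C, IsEvenLoop G f) ∧
      ∀ f ∈ C, ∀ g ∈ C, f ≠ g → Disjoint f.support g.support := by
  simp only [configurations, Finset.mem_filter, Finset.mem_univ, true_and]

theorem forall_adj_iff_cycleFactorsFinset (G : SimpleGraph V) (σ : Equiv.Perm V) :
    (∀ v, σ v ≠ v → G.Adj v (σ v)) ↔ ∀ f ∈ σ.cycleFactorsFinset, IsDirectedCycle G f := by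
  constructor
  · intro h f hf
    obtain ⟨h1, h2⟩ := mem_cycleFactorsFinset_iff.1 hf
    refine ⟨h1, fun v hv => ?_⟩
    have := h2 v (mem_support.2 hv)
    rw [this] at hv ⊢
    exact h v hv
  · intro h v hv
    obtain ⟨f, hf, hvf⟩ := mem_support_iff_exists_mem_cycleFactorsFinset.1 (mem_support.2 hv)
    rw [← (mem_cycleFactorsFinset_iff.1 hf).2 v hvf]
    exact (h f hf).2 v (mem_support.1 hvf)

/-- If all directed cycles of `G` are even, then the partition function of the loop-vertex model is the
determinant of the signed adjacency matrix plus the diagonal matrix of vertex weights. -/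
theorem loopVertexPartition_eq_det (G : SimpleGraph V) (arc : V → V → Prop) (x : V → ℝ)
    (a : V → V → ℝ) (heven : ∀ f, IsDirectedCycle G f → Even f.support.card) (K : Matrix V V ℝ)
    (hK : ∀ u v, G.Adj u v → K u v = stepSign arc u v * a u v)
    (hK' : ∀ u v, ¬ G.Adj u v → K u v = 0) :
    loopVertexPartition G arc x a = (Matrix.diagonal x + K).det := by
  classical
  set M := Matrix.diagonal x + K with hM
  have hMd : ∀ v, M v v = x v := fun v => by simp [hM, hK' v v (G.loopless.irrefl v)]
  have hMa : ∀ u v, u ≠ v → M u v = K u v := fun u v h => by simp [hM, h]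
  have hdet : M.det = ∑ σ ∈ Finset.univ.filter (fun σ : Equiv.Perm V =>
      ∀ v, σ v ≠ v → G.Adj v (σ v)), ((sign σ : ℤ) : ℝ) * ∏ v, M v (σ v) := by
    -- After transposition the entries in a term are M v (σ v), in the direction of the step v → σ
    -- v.
    rw [← Matrix.det_transpose, Matrix.det_apply', Finset.sum_filter]
    refine Finset.sum_congr rfl fun σ _ => ?_
    simp only [Matrix.transpose_apply]
    split_ifs with h
    · rfl
    · push Not at h
      obtain ⟨v, hv, hv'⟩ := h
      rw [Finset.prod_eq_zero (Finset.mem_univ v), mul_zero]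
      rw [hMa _ _ hv.symm, hK' _ _ hv']
  rw [hdet, loopVertexPartition, partitionSum]
  symm
  -- A permutation moving only along edges is the same as its set of nontrivial cycles; its fixed
  -- points are the isolated vertices.
  refine Finset.sum_bij (fun σ _ => σ.cycleFactorsFinset) ?_ ?_ ?_ ?_
  · intro σ hσ
    have h := (forall_adj_iff_cycleFactorsFinset G σ).1 (Finset.mem_filter.1 hσ).2
    refine mem_configurations.2 ⟨fun f hf => ⟨h f hf, heven f (h f hf)⟩, ?_⟩
    exact fun f hf g hg hfg => disjoint_support_of_mem_cycleFactorsFinset hf hg hfg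
  · intro σ _ τ _ h
    exact cycleFactorsFinset_injective h
  · intro C hC
    obtain ⟨h1, h2⟩ := mem_configurations.1 hC
    obtain ⟨σ, rfl⟩ := exists_cycleFactorsFinset_eq (fun f hf => (h1 f hf).1.1) h2
    exact ⟨σ, Finset.mem_filter.2 ⟨Finset.mem_univ _,
      (forall_adj_iff_cycleFactorsFinset G σ).2 fun f hf => (h1 f hf).1⟩, rfl⟩
  · intro σ hσ
    have hadj := (Finset.mem_filter.1 hσ).2
    have h := (forall_adj_iff_cycleFactorsFinset G σ).1 hadj
    rw [configWeight, ← Finset.prod_mul_prod_compl σ.support, ← mul_assoc]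
    congr 1
    · rw [sign_eq_prod_cycleFactorsFinset]
      conv_lhs => rw [support_eq_biUnion_cycleFactorsFinset]
      rw [Finset.prod_biUnion fun f hf g hg hfg =>
        disjoint_support_of_mem_cycleFactorsFinset hf hg hfg]
      push_cast
      rw [← Finset.prod_mul_distrib]
      refine Finset.prod_congr rfl fun f hf => ?_
      -- A cycle of even length has sign -1, which matches the minus sign of the loop weight.
      rw [(h f hf).1.sign, (heven f (h f hf)).neg_one_pow, loopVertexWeight]
      simp only [Units.val_neg, Units.val_one, Int.cast_neg, Int.cast_one, neg_mul, one_mul]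
      congr 1
      refine Finset.prod_congr rfl fun v hv => ?_
      rw [← (mem_cycleFactorsFinset_iff.1 hf).2 v hv, hMa _ _ (mem_support.1 hv).symm,
        hK _ _ ((h f hf).2 v (mem_support.1 hv))]
    · have : (σ.support)ᶜ =
          Finset.univ.filter fun v => ∀ f ∈ σ.cycleFactorsFinset, v ∉ f.support := by
        ext v
        rw [Finset.mem_compl, mem_support_iff_exists_mem_cycleFactorsFinset]
        simp
      rw [this]
      refine Finset.prod_congr rfl fun v hv => ?_
      have hv' : σ v = v := by
        rw [← this, Finset.mem_compl, mem_support, not_not] at hv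
        exact hv
      rw [hv', hMd]

/-- In a properly `2`-coloured graph all directed cycles are even. -/
theorem IsDirectedCycle.even_card {G : SimpleGraph V} {f : Equiv.Perm V} (hf : IsDirectedCycle G f)
    (col : V → ZMod 2) (hcol : ∀ u v, G.Adj u v → col v = col u + 1) : Even f.support.card := by
  have h : ∑ v ∈ f.support, col (f v) = ∑ v ∈ f.support, col v := by
    refine Finset.sum_bij (fun v _ => f v) ?_ ?_ ?_ ?_
    · exact fun v hv => apply_mem_support.2 hv
    · exact fun u _ v _ h => f.injective h
    · exact fun v hv => ⟨f⁻¹ v, apply_mem_support.1 (by simpa using hv), by simp⟩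
    · exact fun _ _ => rfl
  have h2 : ∑ v ∈ f.support, col (f v) = ∑ v ∈ f.support, (col v + 1) :=
    Finset.sum_congr rfl fun v hv => hcol _ _ (hf.2 v (mem_support.1 hv))
  rw [h2, Finset.sum_add_distrib] at h
  have h3 : ((f.support.card : ℕ) : ZMod 2) = 0 := by simpa using h
  exact (ZMod.natCast_eq_zero_iff_even).1 h3

end Determinant

/-! ### Orientation signs of grids and products -/

section Orientation

theorem stepSign_of_arc {V : Type} {arc : V → V → Prop} {u v : V} (h : arc u v) :
    stepSign arc u v = 1 := if_pos h

theorem stepSign_of_not_arc {V : Type} {arc : V → V → Prop} {u v : V} (h : ¬ arc u v) :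
    stepSign arc u v = -1 := if_neg h

theorem _root_.LabelledPlaneGraph.label_injective {V : Type} (Γ : LabelledPlaneGraph V) :
    Function.Injective Γ.label :=
  fun _ _ h => Γ.label_bij.injOn (Set.mem_univ _) (Set.mem_univ _) h

variable {V V₁ V₂ : Type}

theorem stepSign_canonicalArc_swap (Γ : LabelledPlaneGraph V) {u v : V} (h : Γ.graph.Adj u v) :
    stepSign (canonicalArc Γ) v u = -stepSign (canonicalArc Γ) u v := by
  have hne : Γ.label u ≠ Γ.label v := fun e => h.ne (Γ.label_injective e)
  unfold stepSign canonicalArc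
  simp only [h, h.symm, true_and]
  split_ifs <;> first | omega | simp

theorem stepSign_congr {W W' : Type} {arc : W → W → Prop} {arc' : W' → W' → Prop} {u v : W}
    {u' v' : W'} (h : arc u v ↔ arc' u' v') : stepSign arc u v = stepSign arc' u' v' := by
  by_cases hc : arc u v
  · rw [stepSign_of_arc hc, stepSign_of_arc (h.1 hc)]
  · rw [stepSign_of_not_arc hc, stepSign_of_not_arc (mt h.2 hc)]

theorem stepSign_productArc_fst (Γ₁ : LabelledPlaneGraph V₁) (Γ₂ : LabelledPlaneGraph V₂)
    {u v : V₁ × V₂} (h : Γ₁.graph.Adj u.1 v.1) (h2 : u.2 = v.2) :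
    stepSign (productArc Γ₁ Γ₂) u v =
      (-1) ^ (Γ₂.label u.2 + 1) * stepSign (canonicalArc Γ₁) u.1 v.1 := by
  rcases Nat.even_or_odd (Γ₂.label u.2 + 1) with e | e
  · rw [e.neg_one_pow, one_mul]
    refine stepSign_congr ⟨?_, fun hc => Or.inl ⟨h2, e, hc⟩⟩
    rintro (⟨-, -, hc⟩ | ⟨-, ho, -⟩ | ⟨h1, -⟩)
    · exact hc
    · exact absurd e (Nat.not_even_iff_odd.2 ho)
    · exact absurd h1 h.ne
  · rw [e.neg_one_pow, neg_one_mul, ← stepSign_canonicalArc_swap Γ₁ h]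
    refine stepSign_congr ⟨?_, fun hc => Or.inr (Or.inl ⟨h2, e, hc⟩)⟩
    rintro (⟨-, he, -⟩ | ⟨-, -, hc⟩ | ⟨h1, -⟩)
    · exact absurd he (Nat.not_even_iff_odd.2 e)
    · exact hc
    · exact absurd h1 h.ne

theorem stepSign_productArc_snd (Γ₁ : LabelledPlaneGraph V₁) (Γ₂ : LabelledPlaneGraph V₂)
    {u v : V₁ × V₂} (h : Γ₂.graph.Adj u.2 v.2) (h1 : u.1 = v.1) :
    stepSign (productArc Γ₁ Γ₂) u v = stepSign (canonicalArc Γ₂) u.2 v.2 := by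
  refine stepSign_congr ⟨?_, fun hc => Or.inr (Or.inr ⟨h1, hc⟩)⟩
  rintro (⟨h2, -, -⟩ | ⟨h2, -, -⟩ | ⟨-, hc⟩)
  · exact absurd h2 h.ne
  · exact absurd h2 h.ne
  · exact hc

theorem planePath_adj {n : ℕ} {u v : Fin n} :
    (planePath n).graph.Adj u v ↔ (u : ℕ) + 1 = v ∨ (v : ℕ) + 1 = u :=
  SimpleGraph.pathGraph_adj

theorem planeGrid_adj {ℓ m : ℕ} {u v : Fin ℓ × Fin m} :
    (planeGrid ℓ m).graph.Adj u v ↔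
      (((u.1 : ℕ) + 1 = v.1 ∨ (v.1 : ℕ) + 1 = u.1) ∧ u.2 = v.2) ∨
        (((u.2 : ℕ) + 1 = v.2 ∨ (v.2 : ℕ) + 1 = u.2) ∧ u.1 = v.1) := by
  simp only [planeGrid, SimpleGraph.boxProd_adj, SimpleGraph.pathGraph_adj]

theorem stepSign_planePath {n : ℕ} {u v : Fin n} (h : (u : ℕ) + 1 = v) :
    stepSign (canonicalArc (planePath n)) u v = 1 :=
  stepSign_of_arc ⟨planePath_adj.2 (Or.inl h), by simp [planePath]; omega⟩

theorem stepSign_planePath' {n : ℕ} {u v : Fin n} (h : (v : ℕ) + 1 = u) :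
    stepSign (canonicalArc (planePath n)) u v = -1 := by
  rw [stepSign_canonicalArc_swap _ (planePath_adj.2 (Or.inl h)), stepSign_planePath h]

/-- The snake runs from right to left in the rows with odd index, counted from 0. -/
theorem stepSign_planeGrid_right {ℓ m : ℕ} {u v : Fin ℓ × Fin m} (h : (u.1 : ℕ) + 1 = v.1)
    (h2 : u.2 = v.2) : stepSign (canonicalArc (planeGrid ℓ m)) u v = (-1) ^ (u.2 : ℕ) := by
  have hadj : (planeGrid ℓ m).graph.Adj u v := planeGrid_adj.2 (Or.inl ⟨Or.inl h, h2⟩)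
  have hv := v.1.2
  rcases Nat.even_or_odd (u.2 : ℕ) with e | e
  · rw [e.neg_one_pow]
    refine stepSign_of_arc ⟨hadj, ?_⟩
    simp only [planeGrid, boustrophedon, ← h2, e, if_true]
    omega
  · rw [e.neg_one_pow]
    refine stepSign_of_not_arc fun hc => ?_
    have := hc.2
    simp only [planeGrid, boustrophedon, ← h2, Nat.not_even_iff_odd.2 e, if_false] at this
    omega

theorem stepSign_planeGrid_up {ℓ m : ℕ} {u v : Fin ℓ × Fin m} (h : (u.2 : ℕ) + 1 = v.2)
    (h1 : u.1 = v.1) : stepSign (canonicalArc (planeGrid ℓ m)) u v = 1 := by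
  have hadj : (planeGrid ℓ m).graph.Adj u v := planeGrid_adj.2 (Or.inr ⟨Or.inl h, h1⟩)
  refine stepSign_of_arc ⟨hadj, ?_⟩
  obtain ⟨r, hr, e, -⟩ := boustrophedon_eq u
  obtain ⟨r', hr', e', -⟩ := boustrophedon_eq v
  simp only [planeGrid, e, e', ← h, Nat.add_mul]
  omega

theorem stepSign_planeGrid_left {ℓ m : ℕ} {u v : Fin ℓ × Fin m} (h : (v.1 : ℕ) + 1 = u.1)
    (h2 : u.2 = v.2) : stepSign (canonicalArc (planeGrid ℓ m)) u v = -(-1) ^ (u.2 : ℕ) := by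
  rw [stepSign_canonicalArc_swap _ (planeGrid_adj.2 (Or.inl ⟨Or.inl h, h2.symm⟩)),
    stepSign_planeGrid_right h h2.symm, h2]

theorem stepSign_planeGrid_down {ℓ m : ℕ} {u v : Fin ℓ × Fin m} (h : (v.2 : ℕ) + 1 = u.2)
    (h1 : u.1 = v.1) : stepSign (canonicalArc (planeGrid ℓ m)) u v = -1 := by
  rw [stepSign_canonicalArc_swap _ (planeGrid_adj.2 (Or.inr ⟨Or.inl h, h1.symm⟩)),
    stepSign_planeGrid_up h h1.symm]

/-- The reversal of alternate rows by the snake labelling and of alternate layers by the oriented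
product are the alternating signs on the diagonal of the two nested copies of `blockPath`. -/
theorem gridMatrix_of_adj {ℓ m n : ℕ} (a b c : ℝ) {u v : (Fin ℓ × Fin m) × Fin n}
    (h : ((planeGrid ℓ m).graph.boxProd (planePath n).graph).Adj u v) :
    gridMatrix ℓ m n a b c u v =
      stepSign (productArc (planeGrid ℓ m) (planePath n)) u v * axisWeight a b c u v := by
  obtain ⟨⟨p, q⟩, r⟩ := u
  obtain ⟨⟨p', q'⟩, r'⟩ := v
  -- Layer r, counted from 0, has label r + 1, so the oriented product uses the parity of r + 2.
  have hr : (-1 : ℝ) ^ ((r : ℕ) + 1 + 1) = (-1) ^ (r : ℕ) := by ring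
  rcases SimpleGraph.boxProd_adj.1 h with ⟨h1, h2⟩ | ⟨h1, h2⟩
  · rw [stepSign_productArc_fst _ _ h1 h2]
    have hlab : (planePath n).label r + 1 = (r : ℕ) + 1 + 1 := rfl
    simp only at h1 h2 ⊢
    subst h2
    rw [hlab, hr]
    rcases planeGrid_adj.1 h1 with ⟨h3 | h3, h4⟩ | ⟨h3 | h3, h4⟩ <;> simp only at h3 h4 <;> subst h4
    · have hne : p ≠ p' := fun e => by subst e; omega
      rw [stepSign_planeGrid_right (u := (p, q)) (v := (p', q)) h3 rfl]
      simp [gridMatrix, blockPath, skewTridiagonal, axisWeight, h3, hne, Matrix.one_apply]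
      ring
    · have hne : p ≠ p' := fun e => by subst e; omega
      have h3' : ¬ (p : ℕ) + 1 = p' := by omega
      rw [stepSign_planeGrid_left (u := (p, q)) (v := (p', q)) h3 rfl]
      simp [gridMatrix, blockPath, skewTridiagonal, axisWeight, h3, h3', hne, Matrix.one_apply]
      ring
    · have hne : q ≠ q' := fun e => by subst e; omega
      rw [stepSign_planeGrid_up (u := (p, q)) (v := (p, q')) h3 rfl]
      simp [gridMatrix, blockPath, axisWeight, h3, hne, Matrix.one_apply]
    · have hne : q ≠ q' := fun e => by subst e; omega
      have h3' : ¬ (q : ℕ) + 1 = q' := by omega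
      rw [stepSign_planeGrid_down (u := (p, q)) (v := (p, q')) h3 rfl]
      simp [gridMatrix, blockPath, axisWeight, h3, h3', hne, Matrix.one_apply]
  · rw [stepSign_productArc_snd _ _ h1 h2]
    simp only at h1 h2 ⊢
    cases h2
    rcases planePath_adj.1 h1 with h3 | h3
    · have hne : r ≠ r' := fun e => by subst e; omega
      rw [stepSign_planePath h3]
      simp [gridMatrix, blockPath, axisWeight, h3, hne]
    · have hne : r ≠ r' := fun e => by subst e; omega
      have h3' : ¬ (r : ℕ) + 1 = r' := by omega
      rw [stepSign_planePath' h3]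
      simp [gridMatrix, blockPath, axisWeight, h3, h3', hne]

theorem gridMatrix_of_not_adj {ℓ m n : ℕ} (a b c : ℝ) {u v : (Fin ℓ × Fin m) × Fin n}
    (h : ¬ ((planeGrid ℓ m).graph.boxProd (planePath n).graph).Adj u v) :
    gridMatrix ℓ m n a b c u v = 0 := by
  obtain ⟨⟨p, q⟩, r⟩ := u
  obtain ⟨⟨p', q'⟩, r'⟩ := v
  rw [SimpleGraph.boxProd_adj, planeGrid_adj, planePath_adj] at h
  simp only [Prod.mk.injEq] at h
  simp only [gridMatrix, blockPath, skewTridiagonal, Matrix.of_apply, Matrix.one_apply,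
    Prod.mk.injEq]
  by_cases hr : r = r' <;> by_cases hq : q = q' <;> by_cases hp : p = p' <;>
    simp_all

theorem natCast_zmod_two_of_succ {i j : ℕ} (h : i + 1 = j ∨ j + 1 = i) :
    (j : ZMod 2) = i + 1 := by
  have h2 : (1 : ZMod 2) + 1 = 0 := by decide
  rcases h with rfl | rfl
  · push_cast; rfl
  · push_cast
    rw [add_assoc, h2, add_zero]

theorem even_of_planeGrid {ℓ m : ℕ} {f : Equiv.Perm (Fin ℓ × Fin m)}
    (hf : IsDirectedCycle (planeGrid ℓ m).graph f) : Even f.support.card := by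
  refine hf.even_card (fun v => ((v.1 : ℕ) : ZMod 2) + ((v.2 : ℕ) : ZMod 2)) fun u v h => ?_
  rcases planeGrid_adj.1 h with ⟨h, e⟩ | ⟨h, e⟩ <;> rw [e, natCast_zmod_two_of_succ h] <;> ring

theorem even_of_product {ℓ m n : ℕ} {f : Equiv.Perm ((Fin ℓ × Fin m) × Fin n)}
    (hf : IsDirectedCycle ((planeGrid ℓ m).graph.boxProd (planePath n).graph) f) :
    Even f.support.card := by
  refine hf.even_card (fun v => ((v.1.1 : ℕ) : ZMod 2) + ((v.1.2 : ℕ) : ZMod 2) +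
    ((v.2 : ℕ) : ZMod 2)) fun u v h => ?_
  rcases SimpleGraph.boxProd_adj.1 h with ⟨h, e2⟩ | ⟨h, e2⟩
  · rcases planeGrid_adj.1 h with ⟨h, e⟩ | ⟨h, e⟩ <;>
      rw [e, e2, natCast_zmod_two_of_succ h] <;> ring
  · rw [e2, natCast_zmod_two_of_succ (planePath_adj.1 h)]
    ring

theorem loopVertexPartition_grid (ℓ m n : ℕ) (x a b c : ℝ) :
    loopVertexPartition ((planeGrid ℓ m).graph.boxProd (planePath n).graph)
      (productArc (planeGrid ℓ m) (planePath n)) (fun _ => x) (axisWeight a b c) =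
        gridFormula ℓ m n x a b c := by
  rw [loopVertexPartition_eq_det _ _ _ _ (fun f => even_of_product) (gridMatrix ℓ m n a b c)
    (fun u v => gridMatrix_of_adj a b c) (fun u v => gridMatrix_of_not_adj a b c),
    ← det_gridMatrix]
  congr 2
  ext u v
  simp [Matrix.diagonal_apply, Matrix.one_apply]

end Orientation

/-! ### Lattice polygons modulo two -/

section LatticePolygon

/-- The four unit vectors of the square lattice. -/
def IsUnitStep (d : ℤ × ℤ) : Prop := d = (1, 0) ∨ d = (-1, 0) ∨ d = (0, 1) ∨ d = (0, -1)

/-- The number modulo two of crossings of the step `p → q` with the ray to the right of the origin,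
shifted slightly downwards. -/
def rayCross (p q : ℤ × ℤ) : ZMod 2 :=
  if p.1 = q.1 ∧ 0 < p.1 ∧ (p.2 = 0 ∧ q.2 = -1 ∨ p.2 = -1 ∧ q.2 = 0) then 1 else 0

/-- The crossings of the ray caused by a change of direction. -/
def turnCross (s t : ℤ × ℤ) : ZMod 2 := rayCross s (s + t) + rayCross (s + t) t

/-- `1` for the steps to the right and up, `0` for the others. -/
def stepClass (s : ℤ × ℤ) : ZMod 2 := if 0 < s.1 + s.2 then 1 else 0

/-- Discrete homotopy invariance: a (possibly degenerate) unit square with no corner at the origin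
is crossed an even number of times, so both ways round it agree. -/
theorem rayCross_square {p s t : ℤ × ℤ} (hs : IsUnitStep s) (ht : IsUnitStep t) (h0 : p ≠ 0)
    (h1 : p + s ≠ 0) (h2 : p + t ≠ 0) (h3 : p + s + t ≠ 0) :
    rayCross p (p + s) + rayCross (p + s) (p + s + t) =
      rayCross p (p + t) + rayCross (p + t) (p + s + t) := by
  obtain ⟨x, y⟩ := p
  simp only [ne_eq, Prod.ext_iff, Prod.fst_add, Prod.snd_add, Prod.fst_zero, Prod.snd_zero] at h0 h1 h2 h3
  rcases hs with rfl | rfl | rfl | rfl <;> rcases ht with rfl | rfl | rfl | rfl <;>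
    simp only [rayCross, Prod.fst_add, Prod.snd_add] at h1 h2 h3 ⊢ <;>
    split_ifs <;> first | rfl | omega

/-- The ray and its reflection in the origin form a slightly tilted line with right and up on one
side, left and down on the other. A path from s to t avoiding the origin crosses it an odd number of
times exactly when s and t lie on different sides. -/
theorem turnCross_add_neg {s t : ℤ × ℤ} (hs : IsUnitStep s) (ht : IsUnitStep t) (h : s + t ≠ 0) :
    turnCross s t + turnCross (-s) (-t) = stepClass s + stepClass t := by
  revert h
  rcases hs with rfl | rfl | rfl | rfl <;> rcases ht with rfl | rfl | rfl | rfl <;> decide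

theorem zmod_two_add_self (x : ZMod 2) : x + x = 0 := CharTwo.add_self_eq_zero x

theorem sum_range_of_periodic {M : Type*} [AddCommMonoid M] {F : ℕ → M} {N : ℕ}
    (h : ∀ i, F (i + N) = F i) (i : ℕ) : ∑ j ∈ Finset.range N, F (i + j) = ∑ j ∈ Finset.range N, F j := by
  induction i with
  | zero => simp
  | succ i ih =>
    rw [← ih]
    cases N with
    | zero => simp
    | succ N =>
      rw [Finset.sum_range_succ, Finset.sum_range_succ' (fun j => F (i + j))]
      congr 1
      · exact Finset.sum_congr rfl fun j _ => congrArg F (by omega)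
      · rw [show i + 1 + N = i + (N + 1) by omega, h, add_zero]

theorem sum_range_telescope_zmod_two (F : ℕ → ZMod 2) (n : ℕ) :
    ∑ k ∈ Finset.range n, (F k + F (k + 1)) = F 0 + F n := by
  induction n with
  | zero => simp [zmod_two_add_self]
  | succ n ih =>
    rw [Finset.sum_range_succ, ih]
    have := zmod_two_add_self (F n)
    linear_combination this

/-- A closed lattice polygon of even length `N > 2`, traversed periodically. -/
structure LatticeCycle (N : ℕ) (v : ℕ → ℤ × ℤ) : Prop where
  two_lt : 2 < N
  even : Even N
  periodic : ∀ i, v (i + N) = v i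
  inj : ∀ i j, v i = v j → i ≡ j [MOD N]
  step : ∀ i, IsUnitStep (v (i + 1) - v i)

namespace LatticeCycle

/-! ### Crossings of the secant map (i, j) ↦ v j - v i. -/

variable {N : ℕ} {v : ℕ → ℤ × ℤ}

theorem ne_of_lt (h : LatticeCycle N v) {i j : ℕ} (h1 : i < j) (h2 : j < i + N) : v j - v i ≠ 0 := by
  intro e
  have := (h.inj i j (sub_eq_zero.1 e).symm)
  rw [Nat.modEq_iff_dvd' h1.le] at this
  have := Nat.le_of_dvd (by omega) this
  omega

theorem shift (h : LatticeCycle N v) (k : ℕ) : LatticeCycle N fun i => v (k + i) where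
  two_lt := h.two_lt
  even := h.even
  periodic i := by rw [← add_assoc, h.periodic]
  inj i j e := Nat.ModEq.add_left_cancel' k (h.inj _ _ e)
  step i := h.step (k + i)

/-- The crossings of the ray at vertex `i` with edge `j`. -/
def row (v : ℕ → ℤ × ℤ) (i j : ℕ) : ZMod 2 := rayCross (v j - v i) (v (j + 1) - v i)

/-- The crossings of the opposite ray at vertex `j` with edge `i`. -/
def col (v : ℕ → ℤ × ℤ) (i j : ℕ) : ZMod 2 := rayCross (v j - v i) (v j - v (i + 1))

/-- The turn of the polygon at vertex `i + 1`. -/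
def turn (v : ℕ → ℤ × ℤ) (i : ℕ) : ZMod 2 := turnCross (v (i + 1) - v i) (v (i + 2) - v (i + 1))

/-- The turn at vertex `i + 1` of the polygon reflected in the origin. -/
def negTurn (v : ℕ → ℤ × ℤ) (i : ℕ) : ZMod 2 :=
  turnCross (-(v (i + 1) - v i)) (-(v (i + 2) - v (i + 1)))

/-- The crossings of the ray at vertex `i` with the polygon. -/
def rowSum (v : ℕ → ℤ × ℤ) (N i : ℕ) : ZMod 2 := ∑ j ∈ Finset.range N, row v i j

theorem isUnitStep_neg {d : ℤ × ℤ} (h : IsUnitStep d) : IsUnitStep (-d) := by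
  rcases h with rfl | rfl | rfl | rfl <;> simp [IsUnitStep]

/-- Edges i and j have no common end, so the four differences of their ends are the corners of a
square avoiding the origin. -/
theorem row_square (h : LatticeCycle N v) {i j : ℕ} (h1 : i + 2 ≤ j) (h2 : j + 2 ≤ i + N) :
    row v i j + row v (i + 1) j = col v i j + col v i (j + 1) := by
  have e1 : v (j + 1) - v i = v j - v i + (v (j + 1) - v j) := by abel
  have e2 : v j - v (i + 1) = v j - v i + -(v (i + 1) - v i) := by abel
  have e3 : v (j + 1) - v (i + 1) = v j - v i + (v (j + 1) - v j) + -(v (i + 1) - v i) := by abel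
  have key := rayCross_square (p := v j - v i) (h.step j) (isUnitStep_neg (h.step i))
    (h.ne_of_lt (by omega) (by omega)) (e1 ▸ h.ne_of_lt (by omega) (by omega))
    (e2 ▸ h.ne_of_lt (by omega) (by omega)) (e3 ▸ h.ne_of_lt (by omega) (by omega))
  rw [← e3, ← e2, ← e1] at key
  unfold row col
  have a := zmod_two_add_self (rayCross (v j - v (i + 1)) (v (j + 1) - v (i + 1)))
  have b := zmod_two_add_self (rayCross (v (j + 1) - v i) (v (j + 1) - v (i + 1)))
  linear_combination key + a - b

theorem sum_row_square (h : LatticeCycle N v) (i k : ℕ) (hk : k + 3 ≤ N) :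
    ∑ j ∈ Finset.range k, (row v i (i + 2 + j) + row v (i + 1) (i + 2 + j)) =
      col v i (i + 2) + col v i (i + 2 + k) := by
  rw [← sum_range_telescope_zmod_two fun j => col v i (i + 2 + j)]
  refine Finset.sum_congr rfl fun j hj => ?_
  rw [Finset.mem_range] at hj
  exact h.row_square (by omega) (by omega)

theorem turn_eq (v : ℕ → ℤ × ℤ) (i : ℕ) : turn v i = row v i (i + 1) + col v i (i + 2) := by
  have e : v (i + 1) - v i + (v (i + 2) - v (i + 1)) = v (i + 2) - v i := by abel
  rw [turn, turnCross, e]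
  rfl

theorem row_self (v : ℕ → ℤ × ℤ) (i : ℕ) : row v i i = 0 := by
  simp [row, rayCross]

theorem row_add_pred (h : LatticeCycle N v) (i : ℕ) : row v i (i + (N - 1)) = 0 := by
  have e : i + (N - 1) + 1 = i + N := by have := h.two_lt; omega
  rw [row, e, h.periodic, rayCross, if_neg]
  rintro ⟨h1, h2, -⟩
  rw [h1] at h2
  simp at h2

theorem row_periodic (h : LatticeCycle N v) (i j : ℕ) : row v i (j + N) = row v i j := by
  have e : j + N + 1 = j + 1 + N := by omega
  rw [row, e, h.periodic, h.periodic, row]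

/-- The two edges at vertex i are never crossed: if vertical, they have abscissa 0 relative to it.
-/
theorem rowSum_eq (h : LatticeCycle N v) (i : ℕ) :
    rowSum v N i = row v i (i + 1) + ∑ j ∈ Finset.range (N - 3), row v i (i + 2 + j) := by
  obtain ⟨M, rfl⟩ : ∃ M, N = M + 3 := ⟨N - 3, by have := h.two_lt; omega⟩
  rw [rowSum, ← sum_range_of_periodic (h.row_periodic i) i, Finset.sum_range_succ,
    show i + (M + 2) = i + (M + 3 - 1) by omega, h.row_add_pred, Finset.sum_range_succ',
    Finset.sum_range_succ', add_zero, add_zero, row_self, add_zero, add_comm]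
  congr 1
  exact Finset.sum_congr rfl fun j _ => congrArg _ (by omega)

theorem rowSum_succ_eq (h : LatticeCycle N v) (i : ℕ) :
    rowSum v N (i + 1) =
      ∑ j ∈ Finset.range (N - 3), row v (i + 1) (i + 2 + j) + row v (i + 1) (i + (N - 1)) := by
  obtain ⟨M, rfl⟩ : ∃ M, N = M + 3 := ⟨N - 3, by have := h.two_lt; omega⟩
  rw [rowSum, ← sum_range_of_periodic (h.row_periodic (i + 1)) (i + 1), Finset.sum_range_succ,
    show i + 1 + (M + 2) = i + 1 + (M + 3 - 1) by omega, h.row_add_pred, Finset.sum_range_succ',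
    add_zero, add_zero, row_self, add_zero, Finset.sum_range_succ]
  congr 1
  · exact Finset.sum_congr rfl fun j _ => congrArg _ (by omega)
  · exact congrArg _ (by omega)

theorem negTurn_pred_eq (h : LatticeCycle N v) (i : ℕ) :
    negTurn v (i + (N - 1)) = col v i (i + (N - 1)) + row v (i + 1) (i + (N - 1)) := by
  have hN := h.two_lt
  have e1 : i + (N - 1) + 1 = i + N := by omega
  have e2 : i + (N - 1) + 2 = i + 1 + N := by omega
  rw [negTurn, e1, e2, h.periodic, h.periodic, turnCross, col, row, e1, h.periodic, neg_sub, neg_sub]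
  have e : v (i + (N - 1)) - v i + (v i - v (i + 1)) = v (i + (N - 1)) - v (i + 1) := by abel
  rw [e]

/-- The strip of squares between rows i and i + 1 telescopes. What is left at its two ends, next to
edge i, is a turn and a reflected turn. -/
theorem rowSum_add_succ (h : LatticeCycle N v) (i : ℕ) :
    rowSum v N i + rowSum v N (i + 1) = turn v i + negTurn v (i + (N - 1)) := by
  have hN := h.two_lt
  have key := h.sum_row_square i (N - 3) (by omega)
  rw [Finset.sum_add_distrib, show i + 2 + (N - 3) = i + (N - 1) by omega] at key
  rw [h.rowSum_eq, h.rowSum_succ_eq, turn_eq, h.negTurn_pred_eq]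
  linear_combination key

theorem turn_add_negTurn (h : LatticeCycle N v) (i : ℕ) :
    turn v i + negTurn v i = stepClass (v (i + 1) - v i) + stepClass (v (i + 2) - v (i + 1)) := by
  refine turnCross_add_neg (h.step i) (h.step (i + 1)) ?_
  have e : v (i + 1) - v i + (v (i + 2) - v (i + 1)) = v (i + 2) - v i := by abel
  rw [e]
  exact h.ne_of_lt (by omega) (by have := h.two_lt; omega)

theorem negTurn_periodic (h : LatticeCycle N v) (i : ℕ) : negTurn v (i + N) = negTurn v i := by
  rw [negTurn, show i + N + 1 = i + 1 + N by omega, show i + N + 2 = i + 2 + N by omega, h.periodic,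
    h.periodic, h.periodic, negTurn]

/-- This quantity tells on which side of the polygon the odd faces lie. -/
theorem rowSum_add_const (h : LatticeCycle N v) (i : ℕ) :
    rowSum v N i + stepClass (v (i + 1) - v i) + negTurn v (i + (N - 1)) =
      rowSum v N 0 + stepClass (v 1 - v 0) + negTurn v (N - 1) := by
  induction i with
  | zero => simp
  | succ i ih =>
    rw [← ih]
    have hN := h.two_lt
    have a := h.rowSum_add_succ i
    have b := h.turn_add_negTurn i
    rw [show i + 1 + (N - 1) = i + N by omega, h.negTurn_periodic]
    have c := zmod_two_add_self (rowSum v N i)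
    have d := zmod_two_add_self (stepClass (v (i + 2) - v (i + 1)))
    linear_combination a + b - c + d

/-- The N equal quantities of `rowSum_add_const` add up to 0, as N is even. -/
theorem sum_rowSum (h : LatticeCycle N v) :
    ∑ i ∈ Finset.range N, rowSum v N i =
      ∑ i ∈ Finset.range N, stepClass (v (i + 1) - v i) + ∑ i ∈ Finset.range N, negTurn v i := by
  have hN : ((N : ℕ) : ZMod 2) = 0 := (ZMod.natCast_eq_zero_iff_even).2 h.even
  have key : ∑ i ∈ Finset.range N,
      (rowSum v N i + stepClass (v (i + 1) - v i) + negTurn v (N - 1 + i)) = 0 := by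
    rw [Finset.sum_congr rfl fun i _ => by rw [add_comm (N - 1) i, h.rowSum_add_const i]]
    rw [Finset.sum_const, Finset.card_range, nsmul_eq_mul, hN, zero_mul]
  rw [Finset.sum_add_distrib, Finset.sum_add_distrib, sum_range_of_periodic h.negTurn_periodic] at key
  have a := zmod_two_add_self (∑ i ∈ Finset.range N, stepClass (v (i + 1) - v i))
  have b := zmod_two_add_self (∑ i ∈ Finset.range N, negTurn v i)
  linear_combination key - a - b

/-- The turning number of a lattice polygon is odd, for a polygon starting at its extreme vertex. -/
theorem sum_turn_of_extreme (h : LatticeCycle N v)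
    (hmax : ∀ i, (v i).2 < (v 0).2 ∨ (v i).2 = (v 0).2 ∧ (v i).1 ≤ (v 0).1) :
    ∑ i ∈ Finset.range N, turn v i = 1 := by
  obtain ⟨M, hM⟩ : ∃ M, N = M + 3 := ⟨N - 3, by have := h.two_lt; omega⟩
  have hN : v N = v 0 := by simpa using h.periodic 0
  -- No vertex lies to the right of v 0 at its height or above it.
  have R0 : rowSum v N 0 = 0 := by
    refine Finset.sum_eq_zero fun j _ => ?_
    rw [row, rayCross, if_neg]
    have h1 := hmax j
    have h2 := hmax (j + 1)
    simp only [Prod.fst_sub, Prod.snd_sub]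
    omega
  -- No secant ending at the highest vertex v N = v 0 points downwards.
  have C0 : ∀ i, col v i N = 0 := by
    intro i
    rw [col, rayCross, if_neg]
    have h1 := hmax i
    have h2 := hmax (i + 1)
    simp only [Prod.fst_sub, Prod.snd_sub, hN]
    omega
  -- Hopf's triangle, filled strip by strip: the side j = N contributes nothing by `C0`, and the
  -- side along the diagonal contributes the turns.
  have hQ : ∀ k, k ≤ M + 1 →
      ∑ j ∈ Finset.range k, row v (N - 1 - k) (N - k + j) =
        ∑ j ∈ Finset.range k, turn v (N - 1 - k + j) := by
    intro k hk
    induction k with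
    | zero => simp
    | succ k ih =>
      have ih := ih (by omega)
      have e0 : N - 1 - (k + 1) + 1 = N - 1 - k := by omega
      have e1 : N - (k + 1) = N - 1 - (k + 1) + 1 := by omega
      have sq := h.sum_row_square (N - 1 - (k + 1)) k (by omega)
      rw [show N - 1 - (k + 1) + 2 + k = N by omega, C0, Finset.sum_add_distrib, e0] at sq
      rw [Finset.sum_range_succ', Finset.sum_range_succ', add_zero, add_zero, turn_eq, e1]
      have s1 : ∑ j ∈ Finset.range k, row v (N - 1 - (k + 1)) (N - 1 - (k + 1) + 1 + (j + 1)) =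
          ∑ j ∈ Finset.range k, row v (N - 1 - (k + 1)) (N - 1 - (k + 1) + 2 + j) :=
        Finset.sum_congr rfl fun j _ => congrArg _ (by omega)
      have s2 : ∑ j ∈ Finset.range k, turn v (N - 1 - (k + 1) + (j + 1)) =
          ∑ j ∈ Finset.range k, turn v (N - 1 - k + j) :=
        Finset.sum_congr rfl fun j _ => congrArg _ (by omega)
      have s3 : ∑ j ∈ Finset.range k, row v (N - 1 - k) (N - k + j) =
          ∑ j ∈ Finset.range k, row v (N - 1 - k) (N - 1 - (k + 1) + 2 + j) :=
        Finset.sum_congr rfl fun j _ => congrArg _ (by omega)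
      rw [s1, s2, ← ih, s3]
      have a := zmod_two_add_self (∑ j ∈ Finset.range k, row v (N - 1 - k) (N - 1 - (k + 1) + 2 + j))
      linear_combination sq - a
  have hQ1 := hQ (M + 1) le_rfl
  have R1 : rowSum v N 1 = ∑ j ∈ Finset.range (M + 1), turn v (1 + j) := by
    rw [show N - 1 - (M + 1) = 1 by omega, show N - (M + 1) = 2 by omega] at hQ1
    rw [h.rowSum_eq, ← hQ1, Finset.sum_range_succ', add_zero, add_comm,
      show N - 3 = M by omega]
    congr 1
    exact Finset.sum_congr rfl fun j _ => congrArg _ (by omega)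
  have a := h.rowSum_add_succ 0
  have b := h.turn_add_negTurn (N - 1)
  -- The polygon reaches its extreme vertex going right or up and leaves it going left or down.
  have hlast : stepClass (v (N - 1 + 1) - v (N - 1)) + stepClass (v (N - 1 + 2) - v (N - 1 + 1)) = 1 := by
    rw [show N - 1 + 1 = N by omega, show N - 1 + 2 = 1 + N by omega, h.periodic, hN]
    have m1 := hmax 1
    have m2 := hmax (N - 1)
    have s1 := h.step 0
    have s2 := h.step (N - 1)
    have ne : v (N - 1) - v 1 ≠ 0 := h.ne_of_lt (by omega) (by omega)
    rw [show N - 1 + 1 = N by omega, hN] at s2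
    simp only [IsUnitStep, Prod.ext_iff, Prod.fst_sub, Prod.snd_sub, zero_add, ne_eq, Prod.fst_zero,
      Prod.snd_zero] at s1 s2 ne
    simp only [stepClass, Prod.fst_sub, Prod.snd_sub]
    split_ifs <;> first | rfl | omega
  rw [hM, Finset.sum_range_succ, Finset.sum_range_succ', show M + 2 = N - 1 by omega]
  have s : ∑ j ∈ Finset.range (M + 1), turn v (j + 1) = ∑ j ∈ Finset.range (M + 1), turn v (1 + j) :=
    Finset.sum_congr rfl fun j _ => congrArg _ (by omega)
  rw [s, ← R1]
  rw [hlast] at b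
  rw [R0, zero_add, zero_add, zero_add] at a
  have c := zmod_two_add_self (turn v 0)
  linear_combination a + b + c

theorem exists_extreme (h : LatticeCycle N v) :
    ∃ k, ∀ i, (v i).2 < (v k).2 ∨ (v i).2 = (v k).2 ∧ (v i).1 ≤ (v k).1 := by
  have hN := h.two_lt
  obtain ⟨k, -, hk⟩ := Finset.exists_max_image (Finset.range N)
    (fun i => toLex ((v i).2, (v i).1)) ⟨0, by simp; omega⟩
  refine ⟨k, fun i => ?_⟩
  have hper : v i = v (i % N) := by
    have : ∀ q r, v (r + N * q) = v r := by
      intro q r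
      induction q with
      | zero => simp
      | succ q ih => rw [Nat.mul_succ, ← add_assoc, h.periodic, ih]
    conv_lhs => rw [← Nat.mod_add_div i N]
    exact this _ _
  have := hk (i % N) (Finset.mem_range.2 (Nat.mod_lt _ (by omega)))
  rw [← hper, Prod.Lex.le_iff] at this
  simpa using this

theorem turn_periodic (h : LatticeCycle N v) (i : ℕ) : turn v (i + N) = turn v i := by
  rw [turn, show i + N + 1 = i + 1 + N by omega, show i + N + 2 = i + 2 + N by omega, h.periodic,
    h.periodic, h.periodic, turn]

theorem sum_turn (h : LatticeCycle N v) : ∑ i ∈ Finset.range N, turn v i = 1 := by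
  obtain ⟨k, hk⟩ := h.exists_extreme
  rw [← sum_range_of_periodic h.turn_periodic k]
  exact (h.shift k).sum_turn_of_extreme fun i => hk (k + i)

/-- The sum of `turn_add_negTurn` telescopes around the polygon, so reflected turns and turns have
equal sums. -/
theorem sum_negTurn (h : LatticeCycle N v) : ∑ i ∈ Finset.range N, negTurn v i = 1 := by
  have hs : ∑ i ∈ Finset.range N, (turn v i + negTurn v i) = 0 := by
    rw [Finset.sum_congr rfl fun i _ => h.turn_add_negTurn i,
      sum_range_telescope_zmod_two fun i => stepClass (v (i + 1) - v i)]
    have e := h.periodic 1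
    have e0 := h.periodic 0
    rw [zero_add] at e0
    rw [add_comm] at e
    simp only [e, e0, zero_add]
    exact zmod_two_add_self _
  rw [Finset.sum_add_distrib, h.sum_turn] at hs
  have : (1 : ZMod 2) + 1 = 0 := by decide
  linear_combination hs - this

/-- The sum of the coordinates rises by 1 on steps to the right and up, falls by 1 on the others,
and returns to its initial value; hence half of the steps are of each class. -/
theorem sum_stepClass (h : LatticeCycle N v) :
    ∑ i ∈ Finset.range N, stepClass (v (i + 1) - v i) = ((N / 2 : ℕ) : ZMod 2) := by
  set s : ℕ → ℤ := fun i => if 0 < (v (i + 1) - v i).1 + (v (i + 1) - v i).2 then 1 else 0 with hs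
  have h1 : ∀ i, 2 * s i - 1 = ((v (i + 1)).1 + (v (i + 1)).2) - ((v i).1 + (v i).2) := by
    intro i
    have := h.step i
    simp only [IsUnitStep, Prod.ext_iff, Prod.fst_sub, Prod.snd_sub] at this
    simp only [hs, Prod.fst_sub, Prod.snd_sub]
    split_ifs <;> omega
  have h2 : ∑ i ∈ Finset.range N, (2 * s i - 1) = 0 := by
    rw [Finset.sum_congr rfl fun i _ => h1 i,
      Finset.sum_range_sub fun i => (v i).1 + (v i).2]
    have e0 := h.periodic 0
    rw [zero_add] at e0
    rw [e0, sub_self]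
  rw [Finset.sum_sub_distrib, ← Finset.mul_sum] at h2
  simp only [Finset.sum_const, Finset.card_range, nsmul_eq_mul, mul_one] at h2
  have h3 : ∑ i ∈ Finset.range N, s i = ((N / 2 : ℕ) : ℤ) := by
    have := h.even
    omega
  have h4 := congrArg (Int.cast : ℤ → ZMod 2) h3
  rw [Int.cast_sum, Int.cast_natCast] at h4
  rw [← h4]
  refine Finset.sum_congr rfl fun i _ => ?_
  simp only [stepClass, hs]
  split_ifs <;> simp

/-- The number of vertices of a lattice polygon whose lower right face is inside the polygon, modulo two. -/
theorem sum_rowSum_eq (h : LatticeCycle N v) :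
    ∑ i ∈ Finset.range N, rowSum v N i = ((N / 2 : ℕ) : ZMod 2) + 1 := by
  rw [h.sum_rowSum, h.sum_stepClass, h.sum_negTurn]

end LatticeCycle

end LatticePolygon

/-! ### Orientation signs of grid cycles -/

section GridCycle

open Equiv.Perm

/-- The sign character of `ℤ/2`. -/
def signChar (x : ZMod 2) : ℤ := if x = 0 then 1 else -1

theorem signChar_add (x y : ZMod 2) : signChar (x + y) = signChar x * signChar y := by
  revert x y; decide

theorem signChar_natCast (n : ℕ) : signChar (n : ZMod 2) = (-1) ^ n := by
  induction n with
  | zero => rfl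
  | succ n ih =>
    rw [Nat.cast_succ, signChar_add, ih, pow_succ]
    rfl

theorem signChar_sum {ι : Type*} (s : Finset ι) (f : ι → ZMod 2) :
    signChar (∑ i ∈ s, f i) = ∏ i ∈ s, signChar (f i) := by
  classical
  induction s using Finset.induction_on with
  | empty => rfl
  | insert i s hi ih => rw [Finset.sum_insert hi, Finset.prod_insert hi, signChar_add, ih]

theorem sum_support_eq_sum_range {V M : Type*} [Fintype V] [DecidableEq V] [AddCommMonoid M]
    {d : Equiv.Perm V} (hd : d.IsCycle) {u : V} (hu : u ∈ d.support) (F : V → M) :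
    ∑ w ∈ d.support, F w = ∑ i ∈ Finset.range d.support.card, F ((d ^ i) u) := by
  symm
  refine Finset.sum_bij (fun i _ => (d ^ i) u) ?_ ?_ ?_ ?_
  · exact fun i _ => pow_apply_mem_support.2 hu
  · intro i hi j hj h
    rw [Finset.mem_range, ← hd.orderOf] at hi hj
    have := hd.pow_eq_pow_iff.2 ⟨u, mem_support.1 hu, h⟩
    rw [pow_eq_pow_iff_modEq] at this
    exact Nat.ModEq.eq_of_lt_of_lt this hi hj
  · intro w hw
    obtain ⟨i, hi, h⟩ := (hd.sameCycle (mem_support.1 hu) (mem_support.1 hw)).exists_pow_eq'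
    rw [hd.orderOf] at hi
    exact ⟨i, Finset.mem_range.2 hi, h⟩
  · exact fun _ _ => rfl

variable {ℓ m : ℕ}

/-- A grid vertex as a lattice point. -/
def latticePos (u : Fin ℓ × Fin m) : ℤ × ℤ := ((u.1 : ℕ), (u.2 : ℕ))

theorem latticePos_injective : Function.Injective (latticePos (ℓ := ℓ) (m := m)) := by
  intro u v h
  simp only [latticePos, Prod.mk.injEq, Nat.cast_inj] at h
  exact Prod.ext (Fin.ext h.1) (Fin.ext h.2)

theorem isUnitStep_latticePos {u v : Fin ℓ × Fin m} (h : (planeGrid ℓ m).graph.Adj u v) :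
    IsUnitStep (latticePos v - latticePos u) := by
  rw [planeGrid_adj] at h
  simp only [IsUnitStep, latticePos, Prod.ext_iff, Prod.fst_sub, Prod.snd_sub]
  simp only [Fin.ext_iff] at h
  omega

theorem latticeCycle_of_isDirectedCycle {d : Equiv.Perm (Fin ℓ × Fin m)}
    (hd : IsDirectedCycle (planeGrid ℓ m).graph d) (h2 : 2 < d.support.card) {u : Fin ℓ × Fin m}
    (hu : u ∈ d.support) :
    LatticeCycle d.support.card fun i => latticePos ((d ^ i) u) where
  two_lt := h2
  even := even_of_planeGrid hd
  periodic i := by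
    rw [← hd.1.orderOf, pow_add, pow_orderOf_eq_one, mul_one]
  inj i j h := by
    have := hd.1.pow_eq_pow_iff.2 ⟨u, mem_support.1 hu, latticePos_injective h⟩
    rwa [pow_eq_pow_iff_modEq, hd.1.orderOf] at this
  step i := by
    rw [pow_succ']
    exact isUnitStep_latticePos (hd.2 _ (mem_support.1 (pow_apply_mem_support.2 hu)))

/-- The crossings modulo two of a grid cycle with the ray to the right of a lattice point, shifted
slightly downwards. -/
def crossParity (d : Equiv.Perm (Fin ℓ × Fin m)) (w : ℤ × ℤ) : ZMod 2 :=
  ∑ u ∈ d.support, rayCross (latticePos u - w) (latticePos (d u) - w)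

theorem sum_support_crossParity {d : Equiv.Perm (Fin ℓ × Fin m)}
    (hd : IsDirectedCycle (planeGrid ℓ m).graph d) (h2 : 2 < d.support.card) :
    ∑ w ∈ d.support, crossParity d (latticePos w) = ((d.support.card / 2 : ℕ) : ZMod 2) + 1 := by
  obtain ⟨u, hu⟩ : d.support.Nonempty := Finset.card_pos.1 (by omega)
  rw [← (latticeCycle_of_isDirectedCycle hd h2 hu).sum_rowSum_eq, sum_support_eq_sum_range hd.1 hu]
  refine Finset.sum_congr rfl fun i _ => ?_
  rw [crossParity, sum_support_eq_sum_range hd.1 hu]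
  refine Finset.sum_congr rfl fun j _ => ?_
  rw [LatticeCycle.row, pow_succ', Equiv.Perm.mul_apply]

/-- The abscissa of a vertical step. -/
def verticalTerm (p q : ℤ × ℤ) : ZMod 2 := if p.1 = q.1 then (p.1 : ZMod 2) else 0

/-- A vertical edge is met by the rays of the grid points to its left at the height of its upper
end; their number is its abscissa. -/
theorem sum_rayCross {u v : Fin ℓ × Fin m} (h : (planeGrid ℓ m).graph.Adj u v) :
    ∑ w : Fin ℓ × Fin m, rayCross (latticePos u - latticePos w) (latticePos v - latticePos w) =
      verticalTerm (latticePos u) (latticePos v) := by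
  rw [planeGrid_adj] at h
  rcases h with ⟨h, e⟩ | ⟨h, e⟩
  · rw [verticalTerm, if_neg (by simp only [latticePos]; omega)]
    refine Finset.sum_eq_zero fun w _ => ?_
    rw [rayCross, if_neg]
    simp only [latticePos, Prod.fst_sub]
    omega
  · rw [verticalTerm, if_pos (by simp only [latticePos, e])]
    obtain ⟨t, ht, ht'⟩ : ∃ t : Fin m, ((u.2 : ℕ) ≤ t ∧ (v.2 : ℕ) ≤ t) ∧
        ((t : ℕ) = u.2 ∨ (t : ℕ) = v.2) := by
      rcases h with h | h
      · exact ⟨v.2, by omega, by omega⟩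
      · exact ⟨u.2, by omega, by omega⟩
    have : ∀ w : Fin ℓ × Fin m,
        rayCross (latticePos u - latticePos w) (latticePos v - latticePos w) =
          if w.2 = t ∧ w.1 < u.1 then 1 else 0 := by
      intro w
      rw [rayCross]
      refine if_congr ?_ rfl rfl
      simp only [latticePos, Prod.fst_sub, Prod.snd_sub, Fin.ext_iff, Fin.lt_def, e, true_and]
      rcases h with h | h <;> constructor <;> rintro ⟨h1, h2⟩ <;> constructor <;> omega
    simp only [this]
    rw [Finset.sum_boole, show (Finset.univ.filter fun w : Fin ℓ × Fin m => w.2 = t ∧ w.1 < u.1) =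
      Finset.Iio u.1 ×ˢ {t} by
        ext w; simp only [Finset.mem_filter, Finset.mem_univ, true_and, Finset.mem_product,
          Finset.mem_Iio, Finset.mem_singleton, and_comm], Finset.card_product, Finset.card_singleton,
      Fin.card_Iio, mul_one]
    simp [latticePos]

theorem sum_crossParity {d : Equiv.Perm (Fin ℓ × Fin m)}
    (hd : IsDirectedCycle (planeGrid ℓ m).graph d) :
    ∑ w : Fin ℓ × Fin m, crossParity d (latticePos w) =
      ∑ u ∈ d.support, verticalTerm (latticePos u) (latticePos (d u)) := by
  unfold crossParity
  rw [Finset.sum_comm]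
  exact Finset.sum_congr rfl fun u hu => sum_rayCross (hd.2 u (mem_support.1 hu))

/-- The orientation sign of a grid step as a sum of local terms. -/
theorem stepSign_planeGrid {u v : Fin ℓ × Fin m} (h : (planeGrid ℓ m).graph.Adj u v) :
    stepSign (canonicalArc (planeGrid ℓ m)) u v =
      signChar ((((v.1 : ℕ) : ZMod 2) * ((v.2 : ℕ) : ZMod 2) + ((u.1 : ℕ) : ZMod 2) * ((u.2 : ℕ) : ZMod 2)) +
        verticalTerm (latticePos u) (latticePos v) +
        (1 + stepClass (latticePos v - latticePos u))) := by
  have key : ∀ y : ℕ, (signChar (y : ZMod 2) : ℝ) = (-1) ^ y := fun y => by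
    rw [signChar_natCast]; push_cast; rfl
  have h1 : signChar 1 = -1 := rfl
  have h0 : signChar 0 = 1 := rfl
  have h2 : (1 : ZMod 2) + 1 = 0 := by decide
  rcases planeGrid_adj.1 h with ⟨h | h, e⟩ | ⟨h | h, e⟩
  · rw [stepSign_planeGrid_right h e, verticalTerm, if_neg (by simp only [latticePos]; omega),
      stepClass, if_pos (by simp only [latticePos, Prod.fst_sub, Prod.snd_sub, e]; omega), ← h, e, ← key]
    congr 2
    have := zmod_two_add_self (((u.1 : ℕ) : ZMod 2) * ((v.2 : ℕ) : ZMod 2))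
    push_cast
    linear_combination -this - h2
  · rw [stepSign_planeGrid_left h e, verticalTerm, if_neg (by simp only [latticePos]; omega),
      stepClass, if_neg (by simp only [latticePos, Prod.fst_sub, Prod.snd_sub, e]; omega), ← h, e, ← key,
      add_zero, add_zero, signChar_add, h1, mul_neg_one, Int.cast_neg]
    congr 3
    have := zmod_two_add_self (((v.1 : ℕ) : ZMod 2) * ((v.2 : ℕ) : ZMod 2))
    push_cast
    linear_combination -this
  · rw [stepSign_planeGrid_up h e, verticalTerm, if_pos (by simp only [latticePos, e]),
      stepClass, if_pos (by simp only [latticePos, Prod.fst_sub, Prod.snd_sub, e]; omega), ← h, e, h2,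
      add_zero]
    have : ((v.1 : ℕ) : ZMod 2) * (((u.2 : ℕ) + 1 : ℕ) : ZMod 2) + ((v.1 : ℕ) : ZMod 2) * ((u.2 : ℕ) : ZMod 2)
        + ((latticePos u).1 : ZMod 2) = 0 := by
      have a := zmod_two_add_self (((v.1 : ℕ) : ZMod 2) * ((u.2 : ℕ) : ZMod 2))
      have b := zmod_two_add_self ((v.1 : ℕ) : ZMod 2)
      simp only [latticePos, e]
      push_cast
      linear_combination a + b
    rw [this, h0, Int.cast_one]
  · rw [stepSign_planeGrid_down h e, verticalTerm, if_pos (by simp only [latticePos, e]),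
      stepClass, if_neg (by simp only [latticePos, Prod.fst_sub, Prod.snd_sub, e]; omega), ← h, e,
      add_zero]
    have : ((v.1 : ℕ) : ZMod 2) * ((v.2 : ℕ) : ZMod 2) + ((v.1 : ℕ) : ZMod 2) * (((v.2 : ℕ) + 1 : ℕ) : ZMod 2)
        + ((latticePos u).1 : ZMod 2) = 0 := by
      have a := zmod_two_add_self (((v.1 : ℕ) : ZMod 2) * ((v.2 : ℕ) : ZMod 2))
      have b := zmod_two_add_self ((v.1 : ℕ) : ZMod 2)
      simp only [latticePos, e]
      push_cast
      linear_combination a + b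
    rw [this, zero_add, h1, Int.cast_neg, Int.cast_one]

theorem sum_support_comp {V M : Type*} [Fintype V] [DecidableEq V] [AddCommMonoid M]
    (d : Equiv.Perm V) (F : V → M) : ∑ v ∈ d.support, F (d v) = ∑ v ∈ d.support, F v := by
  refine Finset.sum_bij (fun v _ => d v) ?_ ?_ ?_ ?_
  · exact fun v hv => apply_mem_support.2 hv
  · exact fun u _ v _ h => d.injective h
  · exact fun v hv => ⟨d⁻¹ v, apply_mem_support.1 (by simpa using hv), by simp⟩
  · exact fun _ _ => rfl

/-- The orientation sign of a grid cycle is determined by the number of lattice points off the cycle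
with odd crossing parity. -/
theorem prod_stepSign_planeGrid {d : Equiv.Perm (Fin ℓ × Fin m)}
    (hd : IsDirectedCycle (planeGrid ℓ m).graph d) (h2 : 2 < d.support.card) :
    ∏ u ∈ d.support, stepSign (canonicalArc (planeGrid ℓ m)) u (d u) =
      signChar (∑ w ∈ d.supportᶜ, crossParity d (latticePos w) + 1) := by
  have h11 : (1 : ZMod 2) + 1 = 0 := by decide
  obtain ⟨u₀, hu₀⟩ : d.support.Nonempty := Finset.card_pos.1 (by omega)
  have hN : ((d.support.card : ℕ) : ZMod 2) = 0 :=
    (ZMod.natCast_eq_zero_iff_even).2 (even_of_planeGrid hd)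
  rw [Finset.prod_congr rfl fun u hu => stepSign_planeGrid (hd.2 u (mem_support.1 hu)),
    ← Int.cast_prod, ← signChar_sum]
  congr 2
  have hcl : ∑ u ∈ d.support, stepClass (latticePos (d u) - latticePos u) =
      ((d.support.card / 2 : ℕ) : ZMod 2) := by
    rw [← (latticeCycle_of_isDirectedCycle hd h2 hu₀).sum_stepClass, sum_support_eq_sum_range hd.1 hu₀]
    refine Finset.sum_congr rfl fun i _ => ?_
    rw [pow_succ', Equiv.Perm.mul_apply]
  -- The crossings are split into those of points on the cycle, N/2 + 1 in all, and of points off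
  -- it; N/2 cancels against the step classes.
  have hall := sum_crossParity hd
  rw [← Finset.sum_add_sum_compl d.support, sum_support_crossParity hd h2] at hall
  simp only [Finset.sum_add_distrib, Finset.sum_const, nsmul_eq_mul, hN, zero_mul, zero_add, hcl,
    ← hall]
  -- The change of the product of the coordinates sums to 0 around the cycle.
  rw [sum_support_comp d fun v => ((v.1 : ℕ) : ZMod 2) * ((v.2 : ℕ) : ZMod 2), zmod_two_add_self,
    zero_add]
  have := zmod_two_add_self ((d.support.card / 2 : ℕ) : ZMod 2)
  linear_combination this

end GridCycle

/-! ### Face parities of a grid cycle -/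

section FaceParity

open Equiv.Perm

variable {ℓ m : ℕ}

/-- The lattice edge with ends `p`, `q` is an edge of the cycle `d`. -/
def IsCycleEdge (d : Equiv.Perm (Fin ℓ × Fin m)) (p q : ℤ × ℤ) : Prop :=
  ∃ u ∈ d.support, latticePos u = p ∧ latticePos (d u) = q ∨ latticePos u = q ∧ latticePos (d u) = p

/-- The number modulo two of edges of the cycle `d` with ends `p`, `q`. -/
def edgeParity (d : Equiv.Perm (Fin ℓ × Fin m)) (p q : ℤ × ℤ) : ZMod 2 :=
  ∑ u ∈ d.support, if latticePos u = p ∧ latticePos (d u) = q ∨ latticePos u = q ∧ latticePos (d u) = p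
    then 1 else 0

/-- The parity of the unit square with lower left corner `f`. -/
def faceParity (d : Equiv.Perm (Fin ℓ × Fin m)) (f : ℤ × ℤ) : ZMod 2 := crossParity d (f.1, f.2 + 1)

theorem IsCycleEdge.symm {d : Equiv.Perm (Fin ℓ × Fin m)} {p q : ℤ × ℤ} (h : IsCycleEdge d p q) :
    IsCycleEdge d q p := by
  obtain ⟨u, hu, h⟩ := h
  exact ⟨u, hu, h.symm⟩

theorem edgeParity_eq_zero {d : Equiv.Perm (Fin ℓ × Fin m)} {p q : ℤ × ℤ} (h : ¬ IsCycleEdge d p q) :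
    edgeParity d p q = 0 :=
  Finset.sum_eq_zero fun u hu => if_neg fun hc => h ⟨u, hu, hc⟩

theorem edgeParity_comm (d : Equiv.Perm (Fin ℓ × Fin m)) (p q : ℤ × ℤ) :
    edgeParity d p q = edgeParity d q p :=
  Finset.sum_congr rfl fun _ _ => if_congr or_comm rfl rfl

theorem apply_apply_ne {V : Type*} [Fintype V] [DecidableEq V] {d : Equiv.Perm V} (hd : d.IsCycle)
    (h2 : 2 < d.support.card) {u : V} (hu : u ∈ d.support) : d (d u) ≠ u := by
  intro h
  have h' : (d ^ 2) u = (d ^ 0) u := by simpa [pow_two] using h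
  have := hd.pow_eq_pow_iff.2 ⟨u, mem_support.1 hu, h'⟩
  rw [pow_zero] at this
  have := orderOf_le_of_pow_eq_one (by norm_num) this
  rw [hd.orderOf] at this
  omega

/-- Length two is excluded because the doubled edge would be counted twice. -/
theorem edgeParity_eq_one {d : Equiv.Perm (Fin ℓ × Fin m)} (hd : d.IsCycle)
    (h2 : 2 < d.support.card) {p q : ℤ × ℤ} (h : IsCycleEdge d p q) : edgeParity d p q = 1 := by
  have main : ∀ u ∈ d.support, edgeParity d (latticePos u) (latticePos (d u)) = 1 := by
    intro u hu
    rw [edgeParity, Finset.sum_eq_single u]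
    · simp
    · intro w hw hne
      refine if_neg ?_
      rintro (⟨h, -⟩ | ⟨h, h'⟩)
      · exact hne (latticePos_injective h)
      · have e := latticePos_injective h
        have e' := latticePos_injective h'
        rw [e] at e'
        exact apply_apply_ne hd h2 hu e'
    · exact fun h => absurd hu h
  obtain ⟨u, hu, ⟨rfl, rfl⟩ | ⟨rfl, rfl⟩⟩ := h
  · exact main u hu
  · rw [edgeParity_comm]
    exact main u hu

/-- The rays through the two faces differ only in the edge between them. -/
theorem faceParity_add_left (d : Equiv.Perm (Fin ℓ × Fin m)) (a b : ℤ) :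
    faceParity d (a - 1, b) + faceParity d (a, b) = edgeParity d (a, b) (a, b + 1) := by
  unfold faceParity crossParity edgeParity
  rw [← Finset.sum_add_distrib]
  refine Finset.sum_congr rfl fun u hu => ?_
  obtain ⟨x, y⟩ := latticePos u
  obtain ⟨x', y'⟩ := latticePos (d u)
  simp only [rayCross, Prod.mk_sub_mk, Prod.mk.injEq]
  split_ifs <;> first | rfl | omega

/-- A degree count on the half-line of points to the right of (a, b), marked by φ. Edges within it
count twice. The others with one end on it are the vertical ones, each met by one of the two rays,
and the horizontal edge from (a, b). -/
theorem faceParity_add_down {d : Equiv.Perm (Fin ℓ × Fin m)}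
    (hd : IsDirectedCycle (planeGrid ℓ m).graph d) (a b : ℤ) :
    faceParity d (a, b - 1) + faceParity d (a, b) = edgeParity d (a, b) (a + 1, b) := by
  set φ : Fin ℓ × Fin m → ZMod 2 := fun u =>
    if (latticePos u).2 = b ∧ a < (latticePos u).1 then 1 else 0 with hφ
  have hsum : ∑ u ∈ d.support, (φ u + φ (d u)) = 0 := by
    rw [Finset.sum_add_distrib, sum_support_comp, zmod_two_add_self]
  have key : faceParity d (a, b - 1) + faceParity d (a, b) + edgeParity d (a, b) (a + 1, b) =
      ∑ u ∈ d.support, (φ u + φ (d u)) := by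
    unfold faceParity crossParity edgeParity
    rw [← Finset.sum_add_distrib, ← Finset.sum_add_distrib]
    refine Finset.sum_congr rfl fun u hu => ?_
    have hs := isUnitStep_latticePos (hd.2 u (mem_support.1 hu))
    simp only [hφ]
    generalize latticePos u = p at hs ⊢
    generalize latticePos (d u) = q at hs ⊢
    obtain ⟨x, y⟩ := p
    obtain ⟨x', y'⟩ := q
    simp only [IsUnitStep, rayCross, Prod.mk_sub_mk, Prod.mk.injEq] at hs ⊢
    split_ifs <;> first | rfl | decide | omega
  rw [hsum] at key
  have := zmod_two_add_self (edgeParity d (a, b) (a + 1, b))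
  linear_combination key - this

theorem faceParity_eq_zero_of_le {d : Equiv.Perm (Fin ℓ × Fin m)} {a b : ℤ}
    (h : (ℓ : ℤ) ≤ a ∨ b < 0 ∨ (m : ℤ) ≤ b) : faceParity d (a, b) = 0 := by
  refine Finset.sum_eq_zero fun u _ => if_neg ?_
  have h1 := u.1.2
  have h2 := (d u).2.2
  have h3 := u.2.2
  simp only [latticePos, Prod.fst_sub, Prod.snd_sub]
  omega

/-- Left of the grid no edge separates a face from the one above it, so the parity equals that of a
face above the grid. -/
theorem faceParity_eq_zero_of_neg {d : Equiv.Perm (Fin ℓ × Fin m)}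
    (hd : IsDirectedCycle (planeGrid ℓ m).graph d) {a b : ℤ} (ha : a < 0) :
    faceParity d (a, b) = 0 := by
  have hstep : ∀ b, faceParity d (a, b) = faceParity d (a, b + 1) := by
    intro b
    have h := faceParity_add_down hd a (b + 1)
    rw [add_sub_cancel_right, edgeParity_eq_zero] at h
    · have := zmod_two_add_self (faceParity d (a, b + 1))
      linear_combination h - this
    · rintro ⟨u, -, ⟨h, -⟩ | ⟨-, h⟩⟩ <;>
      · have := congrArg Prod.fst h
        simp only [latticePos] at this
        omega
  have hn : ∀ n : ℕ, faceParity d (a, b) = faceParity d (a, b + n) := by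
    intro n
    induction n with
    | zero => simp
    | succ n ih => rw [ih, hstep, Nat.cast_succ, add_assoc]
  rw [hn (m + b.natAbs)]
  exact faceParity_eq_zero_of_le (by omega)

theorem mem_box_of_faceParity {d : Equiv.Perm (Fin ℓ × Fin m)}
    (hd : IsDirectedCycle (planeGrid ℓ m).graph d) {a b : ℤ} (h : faceParity d (a, b) ≠ 0) :
    (0 ≤ a ∧ a < ℓ) ∧ 0 ≤ b ∧ b < m := by
  by_contra hc
  rcases lt_or_ge a 0 with ha | ha
  · exact h (faceParity_eq_zero_of_neg hd ha)
  · exact h (faceParity_eq_zero_of_le (by omega))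

/-- The change of a function on the faces across the lattice edge with ends `p`, `q`. -/
def edgeDiff (g : ℤ × ℤ → ZMod 2) (p q : ℤ × ℤ) : ZMod 2 :=
  if p.1 = q.1 then g (p.1 - 1, min p.2 q.2) + g (p.1, min p.2 q.2)
  else g (min p.1 q.1, p.2 - 1) + g (min p.1 q.1, p.2)

theorem edgeDiff_comm (g : ℤ × ℤ → ZMod 2) {p q : ℤ × ℤ} (h : IsUnitStep (q - p)) :
    edgeDiff g p q = edgeDiff g q p := by
  obtain ⟨x, y⟩ := p
  obtain ⟨x', y'⟩ := q
  simp only [IsUnitStep, Prod.mk_sub_mk, Prod.mk.injEq] at h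
  unfold edgeDiff
  simp only [min_comm y' y, min_comm x' x, eq_comm (a := x') (b := x)]
  split_ifs with hx
  · rw [hx]
  · rw [show y = y' by omega]

/-- Each of the four faces around p occurs twice. -/
theorem sum_edgeDiff (g : ℤ × ℤ → ZMod 2) (p : ℤ × ℤ) :
    ∑ s ∈ ({(1, 0), (-1, 0), (0, 1), (0, -1)} : Finset (ℤ × ℤ)), edgeDiff g p (p + s) = 0 := by
  obtain ⟨x, y⟩ := p
  rw [Finset.sum_insert (by decide), Finset.sum_insert (by decide), Finset.sum_insert (by decide),
    Finset.sum_singleton]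
  have a1 : min x (x + 1) = x := by omega
  have a2 : min x (x + -1) = x - 1 := by omega
  have a3 : min y (y + 1) = y := by omega
  have a4 : min y (y + -1) = y - 1 := by omega
  simp only [edgeDiff, Prod.mk_add_mk, a1, a2, a3, a4, add_zero, if_true,
    if_neg (show ¬ x = x + 1 by omega), if_neg (show ¬ x = x + -1 by omega)]
  have b1 := zmod_two_add_self (g (x, y))
  have b2 := zmod_two_add_self (g (x - 1, y))
  have b3 := zmod_two_add_self (g (x, y - 1))
  have b4 := zmod_two_add_self (g (x - 1, y - 1))
  linear_combination b1 + b2 + b3 + b4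

theorem mem_unitSteps {s : ℤ × ℤ} :
    s ∈ ({(1, 0), (-1, 0), (0, 1), (0, -1)} : Finset (ℤ × ℤ)) ↔ IsUnitStep s := by
  simp [IsUnitStep]

/-- If a function on the faces changes only across edges of the cycle, then its change is the same across
all edges of the cycle. -/
theorem edgeDiff_apply_eq {d : Equiv.Perm (Fin ℓ × Fin m)}
    (hd : IsDirectedCycle (planeGrid ℓ m).graph d) (h2 : 2 < d.support.card) {g : ℤ × ℤ → ZMod 2}
    (hg : ∀ p q, IsUnitStep (q - p) → ¬ IsCycleEdge d p q → edgeDiff g p q = 0)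
    {u : Fin ℓ × Fin m} (hu : u ∈ d.support) :
    edgeDiff g (latticePos (d u)) (latticePos (d (d u))) = edgeDiff g (latticePos u) (latticePos (d u)) := by
  have hu' := apply_mem_support.2 hu
  have st := isUnitStep_latticePos (hd.2 u (mem_support.1 hu))
  have s1 := isUnitStep_latticePos (hd.2 u (mem_support.1 hu)).symm
  have s2 := isUnitStep_latticePos (hd.2 _ (mem_support.1 hu'))
  set p := latticePos (d u) with hp
  have hne : latticePos u - p ≠ latticePos (d (d u)) - p := by
    intro h
    exact apply_apply_ne hd.1 h2 hu (latticePos_injective (sub_left_injective h)).symm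
  -- Of the four edges at p only the incoming and the outgoing one can contribute, so their changes
  -- agree.
  have hsum := sum_edgeDiff g p
  rw [← Finset.sum_subset (s₁ := {latticePos u - p, latticePos (d (d u)) - p}), Finset.sum_pair hne,
    add_sub_cancel, add_sub_cancel] at hsum
  · rw [edgeDiff_comm g st]
    have := zmod_two_add_self (edgeDiff g p (latticePos u))
    linear_combination hsum - this
  · intro s hs
    rw [Finset.mem_insert, Finset.mem_singleton] at hs
    rw [mem_unitSteps]
    rcases hs with rfl | rfl
    · exact s1
    · exact s2
  · intro s hs hs'
    rw [mem_unitSteps] at hs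
    rw [Finset.mem_insert, Finset.mem_singleton, not_or] at hs'
    refine hg _ _ (by simpa using hs) ?_
    rintro ⟨w, hw, ⟨e1, e2⟩ | ⟨e1, e2⟩⟩
    · have := latticePos_injective (e1.trans hp)
      subst this
      exact hs'.2 (by rw [e2]; abel)
    · have := d.injective (latticePos_injective (e2.trans hp))
      subst this
      exact hs'.1 (by rw [e1]; abel)

theorem edgeDiff_const {d : Equiv.Perm (Fin ℓ × Fin m)}
    (hd : IsDirectedCycle (planeGrid ℓ m).graph d) (h2 : 2 < d.support.card) {g : ℤ × ℤ → ZMod 2}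
    (hg : ∀ p q, IsUnitStep (q - p) → ¬ IsCycleEdge d p q → edgeDiff g p q = 0) :
    ∃ κ, ∀ p q, IsCycleEdge d p q → edgeDiff g p q = κ := by
  obtain ⟨u, hu⟩ : d.support.Nonempty := Finset.card_pos.1 (by omega)
  refine ⟨edgeDiff g (latticePos u) (latticePos (d u)), ?_⟩
  have hpow : ∀ i : ℕ, edgeDiff g (latticePos ((d ^ i) u)) (latticePos (d ((d ^ i) u))) =
      edgeDiff g (latticePos u) (latticePos (d u)) := by
    intro i
    induction i with
    | zero => simp
    | succ i ih =>
      rw [← ih, pow_succ', Equiv.Perm.mul_apply]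
      exact edgeDiff_apply_eq hd h2 hg (pow_apply_mem_support.2 hu)
  have main : ∀ w ∈ d.support, edgeDiff g (latticePos w) (latticePos (d w)) =
      edgeDiff g (latticePos u) (latticePos (d u)) := by
    intro w hw
    obtain ⟨i, -, rfl⟩ := (hd.1.sameCycle (mem_support.1 hu) (mem_support.1 hw)).exists_pow_eq'
    exact hpow i
  rintro p q ⟨w, hw, ⟨rfl, rfl⟩ | ⟨rfl, rfl⟩⟩
  · exact main w hw
  · rw [edgeDiff_comm g (isUnitStep_latticePos (hd.2 w (mem_support.1 hw)).symm)]
    exact main w hw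

/-- A function on the faces which changes only across edges of the cycle and vanishes far to the right
is a multiple of the parity. -/
theorem exists_eq_mul_faceParity {d : Equiv.Perm (Fin ℓ × Fin m)}
    (hd : IsDirectedCycle (planeGrid ℓ m).graph d) (h2 : 2 < d.support.card) {g : ℤ × ℤ → ZMod 2}
    (hg : ∀ p q, IsUnitStep (q - p) → ¬ IsCycleEdge d p q → edgeDiff g p q = 0) {R : ℤ}
    (hR : ∀ a b, R ≤ a → g (a, b) = 0) : ∃ κ, ∀ f, g f = κ * faceParity d f := by
  obtain ⟨κ, hκ⟩ := edgeDiff_const hd h2 hg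
  refine ⟨κ, fun ⟨a, b⟩ => ?_⟩
  have hstep : ∀ a, g (a - 1, b) + g (a, b) = κ * (faceParity d (a - 1, b) + faceParity d (a, b)) := by
    intro a
    have e : edgeDiff g (a, b) (a, b + 1) = g (a - 1, b) + g (a, b) := by
      simp [edgeDiff]
    rw [← e, faceParity_add_left]
    by_cases hc : IsCycleEdge d (a, b) (a, b + 1)
    · rw [hκ _ _ hc, edgeParity_eq_one hd.1 h2 hc, mul_one]
    · rw [hg _ _ (by simp [IsUnitStep]) hc, edgeParity_eq_zero hc, mul_zero]
  -- Both functions change by the same amount at every vertical edge of the row, and far to the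
  -- right both vanish.
  have hn : ∀ n : ℕ, g (a, b) + κ * faceParity d (a, b) = g (a + n, b) + κ * faceParity d (a + n, b) := by
    intro n
    induction n with
    | zero => simp
    | succ n ih =>
      have := hstep (a + n + 1)
      rw [add_sub_cancel_right] at this
      rw [ih, Nat.cast_succ, ← add_assoc]
      have x1 := zmod_two_add_self (g (a + n + 1, b))
      have x2 := zmod_two_add_self (κ * faceParity d (a + n, b))
      linear_combination this - x1 + x2
  obtain ⟨M, hM, hM'⟩ : ∃ M : ℕ, R ≤ a + M ∧ (ℓ : ℤ) ≤ a + M :=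
    ⟨R.natAbs + ℓ + a.natAbs, by omega, by omega⟩
  have h := hn M
  rw [hR _ _ hM, faceParity_eq_zero_of_le (Or.inl hM'), mul_zero, add_zero] at h
  have := zmod_two_add_self (κ * faceParity d (a, b))
  linear_combination h - this

end FaceParity

/-! ### The vertices enclosed by a grid cycle -/

section Enclosure

open Equiv.Perm Topology

variable {ℓ m : ℕ}

theorem isCycleEdge_of_mem_curve {d : Equiv.Perm (Fin ℓ × Fin m)}
    (hd : IsDirectedCycle (planeGrid ℓ m).graph d) {z : ℝ × ℝ} (hz : z ∈ curve (planeGrid ℓ m) d) :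
    ∃ a b : ℤ, (IsCycleEdge d (a, b) (a + 1, b) ∧ (a : ℝ) ≤ z.1 ∧ z.1 ≤ a + 1 ∧ z.2 = b) ∨
      (IsCycleEdge d (a, b) (a, b + 1) ∧ z.1 = a ∧ (b : ℝ) ≤ z.2 ∧ z.2 ≤ b + 1) := by
  simp only [curve, Set.mem_iUnion] at hz
  obtain ⟨u, hu, hz⟩ := hz
  obtain ⟨p, q, hpq, h⟩ := grid_edge (hd.2 u (mem_support.1 hu)) hz
  have hedge : IsCycleEdge d (latticePos p) (latticePos q) := by
    refine ⟨u, hu, ?_⟩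
    rcases hpq with ⟨rfl, rfl⟩ | ⟨rfl, rfl⟩
    · exact Or.inl ⟨rfl, rfl⟩
    · exact Or.inr ⟨rfl, rfl⟩
  refine ⟨(p.1 : ℕ), (p.2 : ℕ), ?_⟩
  rcases h with ⟨h1, h2, h3, h4, h5⟩ | ⟨h1, h2, h3, h4, h5⟩
  · refine Or.inl ⟨?_, by exact_mod_cast h3, ?_, by exact_mod_cast h5⟩
    · have e : latticePos q = (((p.1 : ℕ) : ℤ) + 1, ((p.2 : ℕ) : ℤ)) := by
        simp [latticePos, ← h1, ← h2]
      exact e ▸ hedge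
    · rw [← h1] at h4
      exact_mod_cast h4
  · refine Or.inr ⟨?_, by exact_mod_cast h5, by exact_mod_cast h3, ?_⟩
    · have e : latticePos q = (((p.1 : ℕ) : ℤ), ((p.2 : ℕ) : ℤ) + 1) := by
        simp [latticePos, ← h1, ← h2]
      exact e ▸ hedge
    · rw [← h2] at h4
      exact_mod_cast h4

theorem segment_subset_curve {d : Equiv.Perm (Fin ℓ × Fin m)} {a b a' b' : ℤ}
    (h : IsCycleEdge d (a, b) (a', b')) :
    segment ℝ ((a : ℝ), (b : ℝ)) ((a' : ℝ), (b' : ℝ)) ⊆ curve (planeGrid ℓ m) d := by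
  obtain ⟨u, hu, h⟩ := h
  have hpos : ∀ w : Fin ℓ × Fin m, ∀ x y : ℤ, latticePos w = (x, y) →
      (planeGrid ℓ m).pos w = ((x : ℝ), (y : ℝ)) := by
    intro w x y hw
    simp only [latticePos, Prod.mk.injEq] at hw
    simp only [planeGrid, gridPos, ← hw.1, ← hw.2, Int.cast_natCast]
  intro z hz
  simp only [curve, Set.mem_iUnion]
  refine ⟨u, hu, ?_⟩
  rcases h with ⟨h1, h2⟩ | ⟨h1, h2⟩
  · rwa [hpos _ _ _ h1, hpos _ _ _ h2]
  · rw [hpos _ _ _ h1, hpos _ _ _ h2]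
    rwa [segment_symm]

theorem mem_curve_horizontal {d : Equiv.Perm (Fin ℓ × Fin m)} {a b : ℤ} {z : ℝ × ℝ}
    (h : IsCycleEdge d (a, b) (a + 1, b)) (h1 : (a : ℝ) ≤ z.1) (h2 : z.1 ≤ a + 1) (h3 : z.2 = b) :
    z ∈ curve (planeGrid ℓ m) d := by
  refine segment_subset_curve h ⟨1 - (z.1 - a), z.1 - a, by linarith, by linarith, by ring, ?_⟩
  ext
  · simp only [Prod.smul_mk, Prod.mk_add_mk, smul_eq_mul]; push_cast; ring
  · simp only [Prod.smul_mk, Prod.mk_add_mk, smul_eq_mul, h3]; ring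

theorem mem_curve_vertical {d : Equiv.Perm (Fin ℓ × Fin m)} {a b : ℤ} {z : ℝ × ℝ}
    (h : IsCycleEdge d (a, b) (a, b + 1)) (h1 : z.1 = a) (h2 : (b : ℝ) ≤ z.2) (h3 : z.2 ≤ b + 1) :
    z ∈ curve (planeGrid ℓ m) d := by
  refine segment_subset_curve h ⟨1 - (z.2 - b), z.2 - b, by linarith, by linarith, by ring, ?_⟩
  ext
  · simp only [Prod.smul_mk, Prod.mk_add_mk, smul_eq_mul, h1]; ring
  · simp only [Prod.smul_mk, Prod.mk_add_mk, smul_eq_mul]; push_cast; ring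

theorem pos_notMem_curve_iff {d : Equiv.Perm (Fin ℓ × Fin m)}
    (hd : IsDirectedCycle (planeGrid ℓ m).graph d) (w : Fin ℓ × Fin m) :
    (planeGrid ℓ m).pos w ∉ curve (planeGrid ℓ m) d ↔ w ∉ d.support := by
  simp only [curve, Set.mem_iUnion, not_exists]
  constructor
  · exact fun h hw => h w hw (left_mem_segment ℝ _ _)
  · intro h u hu hw
    rcases (planeGrid ℓ m).vertex_on_edge u (d u) w (hd.2 u (mem_support.1 hu)) hw with rfl | rfl
    · exact h hu
    · exact h (apply_mem_support.2 hu)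

theorem not_isCycleEdge_of_notMem {d : Equiv.Perm (Fin ℓ × Fin m)} {w : Fin ℓ × Fin m}
    (hw : w ∉ d.support) (q : ℤ × ℤ) : ¬ IsCycleEdge d (latticePos w) q := by
  rintro ⟨u, hu, ⟨h, -⟩ | ⟨-, h⟩⟩
  · exact hw (latticePos_injective h ▸ hu)
  · exact hw (latticePos_injective h ▸ apply_mem_support.2 hu)

/-- The left side belongs to the lower right face at w, the right side to the upper right one; the
edge between them starts at w and is not on the cycle. -/
theorem crossParity_eq_faceParity {d : Equiv.Perm (Fin ℓ × Fin m)}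
    (hd : IsDirectedCycle (planeGrid ℓ m).graph d) {w : Fin ℓ × Fin m} (hw : w ∉ d.support) :
    crossParity d (latticePos w) = faceParity d (latticePos w) := by
  obtain ⟨a, b, hp⟩ : ∃ a b, latticePos w = (a, b) := ⟨_, _, rfl⟩
  rw [hp]
  have h := faceParity_add_down hd a b
  rw [edgeParity_eq_zero (hp ▸ not_isCycleEdge_of_notMem hw _), faceParity] at h
  simp only [sub_add_cancel] at h
  have := zmod_two_add_self (faceParity d (a, b))
  linear_combination h - this

theorem eventually_floor (t : ℝ) :
    ∀ᶠ t' in 𝓝 t, ⌊t'⌋ = ⌊t⌋ ∨ ⌊t'⌋ = ⌊t⌋ - 1 ∧ t = ⌊t⌋ := by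
  by_cases h : t = ⌊t⌋
  · filter_upwards [Ioo_mem_nhds (show t - 1 < t by linarith) (show t < t + 1 by linarith)] with t' ht'
    obtain ⟨h1, h2⟩ := ht'
    rw [h] at h1 h2
    rcases lt_or_ge t' ⌊t⌋ with h3 | h3
    · refine Or.inr ⟨Int.floor_eq_iff.2 ⟨?_, ?_⟩, h⟩ <;> push_cast <;> linarith
    · exact Or.inl (Int.floor_eq_iff.2 ⟨h3, h2⟩)
  · have h1 : (⌊t⌋ : ℝ) < t := lt_of_le_of_ne (Int.floor_le t) (Ne.symm h)
    filter_upwards [Ioo_mem_nhds h1 (Int.lt_floor_add_one t)] with t' ht'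
    exact Or.inl (Int.floor_eq_iff.2 ⟨ht'.1.le, ht'.2⟩)

/-- The parity of the face containing a point is locally constant off the curve. -/
theorem eventually_faceParity_floor {d : Equiv.Perm (Fin ℓ × Fin m)}
    (hd : IsDirectedCycle (planeGrid ℓ m).graph d) {z : ℝ × ℝ}
    (hz : z ∉ curve (planeGrid ℓ m) d) :
    ∀ᶠ z' in 𝓝 z, faceParity d (⌊z'.1⌋, ⌊z'.2⌋) = faceParity d (⌊z.1⌋, ⌊z.2⌋) := by
  have hV : ∀ a b : ℤ, z.1 = a → (b : ℝ) ≤ z.2 → z.2 ≤ b + 1 →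
      faceParity d (a - 1, b) = faceParity d (a, b) := by
    intro a b h1 h2 h3
    have h := faceParity_add_left d a b
    rw [edgeParity_eq_zero fun hc => hz (mem_curve_vertical hc h1 h2 h3)] at h
    have := zmod_two_add_self (faceParity d (a, b))
    linear_combination h - this
  have hH : ∀ a b : ℤ, (a : ℝ) ≤ z.1 → z.1 ≤ a + 1 → z.2 = b →
      faceParity d (a, b - 1) = faceParity d (a, b) := by
    intro a b h1 h2 h3
    have h := faceParity_add_down hd a b
    rw [edgeParity_eq_zero fun hc => hz (mem_curve_horizontal hc h1 h2 h3)] at h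
    have := zmod_two_add_self (faceParity d (a, b))
    linear_combination h - this
  have x1 := Int.floor_le z.1
  have x2 := (Int.lt_floor_add_one z.1).le
  have y1 := Int.floor_le z.2
  have y2 := (Int.lt_floor_add_one z.2).le
  filter_upwards [continuous_fst.continuousAt.eventually (eventually_floor z.1),
    continuous_snd.continuousAt.eventually (eventually_floor z.2)] with z' hx hy
  rcases hx with hx | ⟨hx, hx'⟩ <;> rcases hy with hy | ⟨hy, hy'⟩ <;> rw [hx, hy]
  · exact hH _ _ x1 x2 hy'
  · exact hV _ _ hx' y1 y2
  -- At a lattice point, the lower left face is reached from the upper right one through the lower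
  -- right one.
  · rw [hV _ _ hx' (by push_cast; linarith) (by push_cast; linarith), hH _ _ x1 x2 hy']

theorem faceParity_floor_const {d : Equiv.Perm (Fin ℓ × Fin m)}
    (hd : IsDirectedCycle (planeGrid ℓ m).graph d) {z z' : ℝ × ℝ}
    (hz : z ∉ curve (planeGrid ℓ m) d)
    (hz' : z' ∈ connectedComponentIn (curve (planeGrid ℓ m) d)ᶜ z) :
    faceParity d (⌊z'.1⌋, ⌊z'.2⌋) = faceParity d (⌊z.1⌋, ⌊z.2⌋) := by
  let _ : TopologicalSpace (ZMod 2) := ⊥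
  have : DiscreteTopology (ZMod 2) := ⟨rfl⟩
  refine isPreconnected_connectedComponentIn.constant (s := connectedComponentIn _ z)
    (f := fun z => faceParity d (⌊z.1⌋, ⌊z.2⌋)) ?_ hz' (mem_connectedComponentIn hz)
  intro y hy
  refine ContinuousAt.continuousWithinAt ?_
  exact (continuousAt_const (y := faceParity d (⌊y.1⌋, ⌊y.2⌋))).congr
    ((eventually_faceParity_floor hd (connectedComponentIn_subset _ _ hy)).mono fun _ h => h.symm)

theorem floor_pos (w : Fin ℓ × Fin m) :
    (⌊((planeGrid ℓ m).pos w).1⌋, ⌊((planeGrid ℓ m).pos w).2⌋) = latticePos w := by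
  simp [planeGrid, gridPos, latticePos]

/-- The face parity is constant on the component of w, and nonzero parities occur only inside the
box of the grid. -/
theorem encloses_of_faceParity {d : Equiv.Perm (Fin ℓ × Fin m)}
    (hd : IsDirectedCycle (planeGrid ℓ m).graph d) {w : Fin ℓ × Fin m} (hw : w ∉ d.support)
    (h : faceParity d (latticePos w) ≠ 0) : Encloses (planeGrid ℓ m) d w := by
  have hw' := (pos_notMem_curve_iff hd w).2 hw
  refine ⟨hw', ?_⟩
  refine (Bornology.IsBounded.prod (Metric.isBounded_Icc (0 : ℝ) ℓ)
    (Metric.isBounded_Icc (0 : ℝ) m)).subset fun z hz => ?_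
  have hc := faceParity_floor_const hd hw' hz
  rw [floor_pos] at hc
  rw [← hc] at h
  obtain ⟨⟨h1, h2⟩, h3, h4⟩ := mem_box_of_faceParity hd h
  have e2 : ((⌊z.1⌋ : ℝ) + 1) ≤ ℓ := by exact_mod_cast h2
  have e4 : ((⌊z.2⌋ : ℝ) + 1) ≤ m := by exact_mod_cast h4
  have f2 := Int.lt_floor_add_one z.1
  have f4 := Int.lt_floor_add_one z.2
  exact ⟨⟨Int.floor_nonneg.1 h1, by linarith⟩, Int.floor_nonneg.1 h3, by linarith⟩

/-! ### Connecting face centres off the curve. -/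

theorem mem_connectedComponentIn_of_segment {C : Set (ℝ × ℝ)} {p z z' : ℝ × ℝ}
    (h : segment ℝ z z' ⊆ Cᶜ) (hz : z ∈ connectedComponentIn Cᶜ p) :
    z' ∈ connectedComponentIn Cᶜ p := by
  rw [connectedComponentIn_eq hz]
  exact (convex_segment z z').isPreconnected.subset_connectedComponentIn (left_mem_segment ℝ _ _) h
    (right_mem_segment ℝ _ _)

/-- The centre of a face. -/
noncomputable def faceCentre (f : ℤ × ℤ) : ℝ × ℝ := ((f.1 : ℝ) + 1 / 2, (f.2 : ℝ) + 1 / 2)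

theorem intCast_ne_add_half (a b : ℤ) : (a : ℝ) ≠ b + 1 / 2 := by
  intro h
  have h' : (2 * a : ℝ) = 2 * b + 1 := by linarith
  have h2 : 2 * a = 2 * b + 1 := by exact_mod_cast h'
  omega

theorem int_eq_of_near {a b : ℤ} {t : ℝ} (h1 : (b : ℝ) ≤ t) (h2 : t ≤ b + 1) (h : t = a + 1 / 2) :
    b = a := by
  have h3 : (b : ℝ) < a + 1 := by linarith
  have h4 : (a : ℝ) < b + 1 := by linarith
  have h5 : b < a + 1 := by exact_mod_cast h3
  have h6 : a < b + 1 := by exact_mod_cast h4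
  omega

theorem int_eq_of_between {a b : ℤ} {t : ℝ} (h1 : (a : ℝ) - 1 + 1 / 2 ≤ t) (h2 : t ≤ a + 1 / 2)
    (h : t = b) : b = a := by
  have h3 : (b : ℝ) < a + 1 := by linarith
  have h4 : (a : ℝ) < b + 1 := by linarith
  have h5 : b < a + 1 := by exact_mod_cast h3
  have h6 : a < b + 1 := by exact_mod_cast h4
  omega

theorem segment_faceCentre_left {d : Equiv.Perm (Fin ℓ × Fin m)}
    (hd : IsDirectedCycle (planeGrid ℓ m).graph d) {a b : ℤ} (h : ¬ IsCycleEdge d (a, b) (a, b + 1)) :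
    segment ℝ (faceCentre (a - 1, b)) (faceCentre (a, b)) ⊆ (curve (planeGrid ℓ m) d)ᶜ := by
  intro z hz hc
  obtain ⟨h1, -, h3, -⟩ := mem_segment_prod hz
  simp only [faceCentre] at h1 h3
  obtain ⟨h1, h2⟩ := h1 (by push_cast; linarith)
  obtain ⟨h3, h4⟩ := h3 le_rfl
  have hz2 : z.2 = (b : ℝ) + 1 / 2 := le_antisymm h4 h3
  push_cast at h1
  obtain ⟨a', b', ⟨-, -, -, e⟩ | ⟨he, e1, e2, e3⟩⟩ := isCycleEdge_of_mem_curve hd hc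
  · exact intCast_ne_add_half b' b (e.symm.trans hz2)
  · have hb := int_eq_of_near e2 e3 hz2
    have ha := int_eq_of_between h1 h2 e1
    subst ha hb
    exact h he

theorem segment_faceCentre_down {d : Equiv.Perm (Fin ℓ × Fin m)}
    (hd : IsDirectedCycle (planeGrid ℓ m).graph d) {a b : ℤ} (h : ¬ IsCycleEdge d (a, b) (a + 1, b)) :
    segment ℝ (faceCentre (a, b - 1)) (faceCentre (a, b)) ⊆ (curve (planeGrid ℓ m) d)ᶜ := by
  intro z hz hc
  obtain ⟨h1, -, h3, -⟩ := mem_segment_prod hz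
  simp only [faceCentre] at h1 h3
  obtain ⟨h1, h2⟩ := h1 le_rfl
  obtain ⟨h3, h4⟩ := h3 (by push_cast; linarith)
  have hz1 : z.1 = (a : ℝ) + 1 / 2 := le_antisymm h2 h1
  push_cast at h3
  obtain ⟨a', b', ⟨he, e1, e2, e3⟩ | ⟨-, e, -, -⟩⟩ := isCycleEdge_of_mem_curve hd hc
  · have ha := int_eq_of_near e1 e2 hz1
    have hb := int_eq_of_between h3 h4 e3
    subst ha hb
    exact h he
  · exact intCast_ne_add_half a' a (e.symm.trans hz1)

/-- The diagonal into the upper right face meets the grid lines only at its start, which is off the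
cycle. -/
theorem segment_pos_faceCentre {d : Equiv.Perm (Fin ℓ × Fin m)}
    (hd : IsDirectedCycle (planeGrid ℓ m).graph d) {w : Fin ℓ × Fin m} (hw : w ∉ d.support) :
    segment ℝ ((planeGrid ℓ m).pos w) (faceCentre (latticePos w)) ⊆ (curve (planeGrid ℓ m) d)ᶜ := by
  rintro _ ⟨s, t, hs, ht, hst, rfl⟩ hc
  have e : s • (planeGrid ℓ m).pos w + t • faceCentre (latticePos w) =
      (((w.1 : ℕ) : ℝ) + t / 2, ((w.2 : ℕ) : ℝ) + t / 2) := by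
    obtain rfl : s = 1 - t := by linarith
    ext <;> simp [planeGrid, gridPos, faceCentre, latticePos] <;> ring
  rw [e] at hc
  have key : ∀ (i : ℕ) (j : ℤ), (i : ℝ) + t / 2 = j → t = 0 := by
    intro i j hij
    have h1 : (i : ℝ) ≤ j := by linarith
    have h2 : (j : ℝ) < i + 1 := by linarith
    have h3 : (i : ℤ) ≤ j := by exact_mod_cast h1
    have h4 : j < (i : ℤ) + 1 := by exact_mod_cast h2
    have h5 : j = i := by omega
    rw [h5, Int.cast_natCast] at hij
    linarith
  have ht0 : t = 0 := by
    obtain ⟨a', b', ⟨-, -, -, e⟩ | ⟨-, e, -, -⟩⟩ := isCycleEdge_of_mem_curve hd hc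
    · exact key _ _ e
    · exact key _ _ e
  rw [ht0, zero_div, add_zero, add_zero] at hc
  exact (pos_notMem_curve_iff hd w).2 hw hc

/-- If the component U of w were bounded, the indicator of the faces with centre in U would change
only across cycle edges and vanish far to the right. It would thus be a multiple of the parity and
vanish at the face of w, whose centre is in U. -/
theorem not_encloses_of_faceParity {d : Equiv.Perm (Fin ℓ × Fin m)}
    (hd : IsDirectedCycle (planeGrid ℓ m).graph d) (h2 : 2 < d.support.card) {w : Fin ℓ × Fin m}
    (hw : w ∉ d.support) (h : faceParity d (latticePos w) = 0) :
    ¬ Encloses (planeGrid ℓ m) d w := by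
  classical
  rintro ⟨hw', hb⟩
  set U := connectedComponentIn (curve (planeGrid ℓ m) d)ᶜ ((planeGrid ℓ m).pos w) with hU
  set g : ℤ × ℤ → ZMod 2 := fun f => if faceCentre f ∈ U then 1 else 0 with hg
  have hseg : ∀ f f', segment ℝ (faceCentre f) (faceCentre f') ⊆ (curve (planeGrid ℓ m) d)ᶜ →
      g f + g f' = 0 := by
    intro f f' hs
    have : faceCentre f ∈ U ↔ faceCentre f' ∈ U :=
      ⟨mem_connectedComponentIn_of_segment hs,
        mem_connectedComponentIn_of_segment (by rwa [segment_symm])⟩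
    simp only [hg, this, zmod_two_add_self]
  have hdiff : ∀ p q, IsUnitStep (q - p) → ¬ IsCycleEdge d p q → edgeDiff g p q = 0 := by
    rintro ⟨x, y⟩ ⟨x', y'⟩ hs hne
    have hne' : ¬ IsCycleEdge d (x', y') (x, y) := fun hc => hne hc.symm
    simp only [IsUnitStep, Prod.mk_sub_mk, Prod.mk.injEq] at hs
    simp only [edgeDiff]
    split_ifs with hx
    · refine hseg _ _ (segment_faceCentre_left hd ?_)
      subst hx
      rcases le_total y y' with hy | hy
      · rw [min_eq_left hy, show y + 1 = y' by omega]
        exact hne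
      · rw [min_eq_right hy, show y' + 1 = y by omega]
        exact hne'
    · refine hseg _ _ (segment_faceCentre_down hd ?_)
      obtain rfl : y = y' := by omega
      rcases le_total x x' with hy | hy
      · rw [min_eq_left hy, show x + 1 = x' by omega]
        exact hne
      · rw [min_eq_right hy, show x' + 1 = x by omega]
        exact hne'
  obtain ⟨R, hR⟩ : ∃ R : ℤ, ∀ a b, R ≤ a → g (a, b) = 0 := by
    obtain ⟨r, hr⟩ := hb.subset_closedBall 0
    refine ⟨⌈r⌉, fun a b hab => if_neg fun hc => ?_⟩
    have := hr hc
    rw [mem_closedBall_zero_iff, Prod.norm_def] at this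
    have h1 := (le_abs_self _).trans ((le_max_left _ _).trans this)
    simp only [faceCentre] at h1
    have h3 : (⌈r⌉ : ℝ) ≤ a := by exact_mod_cast hab
    have h4 := Int.le_ceil r
    linarith
  obtain ⟨κ, hκ⟩ := exists_eq_mul_faceParity hd h2 hdiff hR
  have h1 : g (latticePos w) = 1 := if_pos
    (mem_connectedComponentIn_of_segment (segment_pos_faceCentre hd hw) (mem_connectedComponentIn hw'))
  rw [hκ, h, mul_zero] at h1
  exact absurd h1 (by decide)

theorem encloses_iff {d : Equiv.Perm (Fin ℓ × Fin m)}
    (hd : IsDirectedCycle (planeGrid ℓ m).graph d) (h2 : 2 < d.support.card) (w : Fin ℓ × Fin m) :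
    Encloses (planeGrid ℓ m) d w ↔ w ∉ d.support ∧ crossParity d (latticePos w) ≠ 0 := by
  by_cases hw : w ∈ d.support
  · refine iff_of_false (fun h => (pos_notMem_curve_iff hd w).1 h.1 hw) fun h => h.1 hw
  · rw [crossParity_eq_faceParity hd hw]
    refine ⟨fun h => ⟨hw, fun h0 => not_encloses_of_faceParity hd h2 hw h0 h⟩,
      fun h => encloses_of_faceParity hd hw h.2⟩

theorem natCast_enclosedCount {d : Equiv.Perm (Fin ℓ × Fin m)}
    (hd : IsDirectedCycle (planeGrid ℓ m).graph d) (h2 : 2 < d.support.card) :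
    (enclosedCount (planeGrid ℓ m) d : ZMod 2) = ∑ w ∈ d.supportᶜ, crossParity d (latticePos w) := by
  classical
  have hval : ∀ x : ZMod 2, x = if x ≠ 0 then 1 else 0 := by decide
  rw [Finset.sum_congr rfl fun w _ => hval (crossParity d (latticePos w)), Finset.sum_boole,
    enclosedCount]
  congr 1
  rw [← Set.ncard_coe_finset]
  congr 1
  ext w
  simp [encloses_iff hd h2 w]

/-- A doubled edge encloses nothing. -/
theorem enclosedCount_eq_zero {V : Type} [Fintype V] [DecidableEq V] (Γ : LabelledPlaneGraph V)
    {d : Equiv.Perm V} (h2 : d.support.card = 2) : enclosedCount Γ d = 0 := by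
  rw [enclosedCount, Set.ncard_eq_zero]
  refine Set.eq_empty_of_forall_notMem fun w => ?_
  rintro ⟨hw, hb⟩
  obtain ⟨u, v, huv, rfl⟩ := card_support_eq_two.1 h2
  have hcurve : curve Γ (Equiv.swap u v) = segment ℝ (Γ.pos u) (Γ.pos v) := by
    rw [curve, support_swap huv]
    simp [segment_symm ℝ (Γ.pos v)]
  rw [hcurve] at hw hb
  set z := Γ.pos w with hz
  set a := Γ.pos u with ha
  have hne : z - a ≠ 0 := fun h => hw (by rw [sub_eq_zero.1 h]; exact left_mem_segment ℝ _ _)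
  -- The ray from z straight away from the end a is unbounded; if it met the segment, convexity
  -- would put z on the segment.
  set ray : Set (ℝ × ℝ) := (fun t : ℝ => z + t • (z - a)) '' Set.Ici 0 with hray
  have hsub : ray ⊆ (segment ℝ a (Γ.pos v))ᶜ := by
    rintro _ ⟨t, ht, rfl⟩ hc
    rw [Set.mem_Ici] at ht
    simp only at hc
    refine hw ((convex_segment a (Γ.pos v)).segment_subset (left_mem_segment ℝ _ _) hc ?_)
    have h1 : (0 : ℝ) < 1 + t := by linarith
    refine ⟨t / (1 + t), 1 / (1 + t), by positivity, by positivity, by field_simp; ring, ?_⟩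
    have e : z + t • (z - a) = (1 + t) • z - t • a := by module
    rw [e, smul_sub, smul_smul, smul_smul, one_div, inv_mul_cancel₀ h1.ne', one_smul,
      div_eq_inv_mul]
    abel
  have hpre : IsPreconnected ray :=
    (convex_Ici (0 : ℝ)).isPreconnected.image _ (by fun_prop)
  have hzr : z ∈ ray := ⟨0, Set.mem_Ici.2 le_rfl, by simp⟩
  obtain ⟨r, hr⟩ := (hb.subset (hpre.subset_connectedComponentIn hzr hsub)).subset_closedBall z
  have hpos : 0 < ‖z - a‖ := norm_pos_iff.2 hne
  have hmem := hr ⟨(|r| + 1) / ‖z - a‖, by rw [Set.mem_Ici]; positivity, rfl⟩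
  rw [Metric.mem_closedBall, dist_eq_norm, add_sub_cancel_left, norm_smul, Real.norm_eq_abs,
    abs_of_nonneg (by positivity), div_mul_cancel₀ _ hpos.ne'] at hmem
  linarith [le_abs_self r]

end Enclosure

/-! ### Cycle signs are orientation signs -/

section CycleSign

open Equiv.Perm

variable {V : Type} [Fintype V] [DecidableEq V]

/-- The clockwise clause concerns odd cycles only, which neither the grid nor the path has. -/
theorem cycleSign_of_even (Γ : LabelledPlaneGraph V) {d : Equiv.Perm V} (h : Even d.support.card) :
    cycleSign Γ d = (-1) ^ (enclosedCount Γ d + 1) :=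
  if_neg fun hc => Nat.not_even_iff_odd.2 hc.1 h

/-- The edge is traversed once in each direction, and nothing is enclosed; both sides are -1. -/
theorem cycleSign_of_card_eq_two (Γ : LabelledPlaneGraph V) {d : Equiv.Perm V}
    (hd : IsDirectedCycle Γ.graph d) (h2 : d.support.card = 2) :
    (cycleSign Γ d : ℝ) = ∏ u ∈ d.support, stepSign (canonicalArc Γ) u (d u) := by
  rw [cycleSign_of_even Γ (by rw [h2]; exact even_two), enclosedCount_eq_zero Γ h2]
  obtain ⟨u, v, huv, rfl⟩ := card_support_eq_two.1 h2
  have hadj : Γ.graph.Adj u v := by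
    have := hd.2 u (by rw [Equiv.swap_apply_left]; exact huv.symm)
    rwa [Equiv.swap_apply_left] at this
  rw [support_swap huv, Finset.prod_pair huv, Equiv.swap_apply_left, Equiv.swap_apply_right,
    stepSign_canonicalArc_swap Γ hadj]
  unfold stepSign
  split_ifs <;> simp

/-- The Kasteleyn property of the snake orientation: longer cycles combine the crossing count with
the Jordan theorem. -/
theorem cycleSign_planeGrid {ℓ m : ℕ} {d : Equiv.Perm (Fin ℓ × Fin m)}
    (hd : IsDirectedCycle (planeGrid ℓ m).graph d) :
    (cycleSign (planeGrid ℓ m) d : ℝ) =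
      ∏ u ∈ d.support, stepSign (canonicalArc (planeGrid ℓ m)) u (d u) := by
  rcases (two_le_card_support_of_ne_one hd.1.ne_one).eq_or_lt with h | h
  · exact cycleSign_of_card_eq_two _ hd h.symm
  · rw [cycleSign_of_even _ (even_of_planeGrid hd), prod_stepSign_planeGrid hd h,
      ← natCast_enclosedCount hd h, ← Nat.cast_succ, signChar_natCast]

/-- At the largest vertex of the cycle, predecessor and successor are both the only smaller
neighbour. -/
theorem card_support_planePath {n : ℕ} {d : Equiv.Perm (Fin n)}
    (hd : IsDirectedCycle (planePath n).graph d) : d.support.card = 2 := by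
  have hne : d.support.Nonempty :=
    Finset.card_pos.1 (by have := two_le_card_support_of_ne_one hd.1.ne_one; omega)
  obtain ⟨u, hu, hmax⟩ := Finset.exists_max_image d.support (fun v => (v : ℕ)) hne
  have hu' : d⁻¹ u ∈ d.support := apply_mem_support.1 (by simpa using hu)
  have h1 := planePath_adj.1 (hd.2 u (mem_support.1 hu))
  have h2 := planePath_adj.1 (hd.2 _ (mem_support.1 hu'))
  have h3 := hmax _ (apply_mem_support.2 hu)
  have h4 := hmax _ hu'
  rw [show d (d⁻¹ u) = u by simp] at h2
  have e : d⁻¹ u = d u := Fin.ext (by omega)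
  by_contra hc
  have hlt : 2 < d.support.card := by
    have := two_le_card_support_of_ne_one hd.1.ne_one
    omega
  refine apply_apply_ne hd.1 hlt hu ?_
  rw [← e]
  simp

theorem cycleSign_planePath {n : ℕ} {d : Equiv.Perm (Fin n)}
    (hd : IsDirectedCycle (planePath n).graph d) :
    (cycleSign (planePath n) d : ℝ) =
      ∏ u ∈ d.support, stepSign (canonicalArc (planePath n)) u (d u) :=
  cycleSign_of_card_eq_two _ hd (card_support_planePath hd)

/-- The right side depends only on T: this is why the choice of decomposition does not matter. -/
theorem familySign_eq {Γ : LabelledPlaneGraph V}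
    (hΓ : ∀ d, IsDirectedCycle Γ.graph d →
      (cycleSign Γ d : ℝ) = ∏ u ∈ d.support, stepSign (canonicalArc Γ) u (d u))
    {T : Multiset (V × V)} {D : Multiset (Equiv.Perm V)} (h : IsCompatibleDecomposition Γ T D) :
    (familySign Γ D : ℝ) = (T.map fun p => stepSign (canonicalArc Γ) p.1 p.2).prod := by
  rw [← h.2, Multiset.map_bind, Multiset.prod_bind, familySign,
    Int.cast_multiset_prod, Multiset.map_map]
  congr 1
  refine Multiset.map_congr rfl fun d hd => ?_
  rw [darts, Multiset.map_map]
  exact hΓ d (h.1 d hd)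

end CycleSign

/-! ### Decompositions of balanced families of directed edges -/

section Decomposition

open Equiv.Perm

variable {V : Type} [Fintype V] [DecidableEq V]

/-- A fixed-point-free self-map of a nonempty finite set contains a cycle. -/
theorem exists_isCycle_of_mapsTo {S : Finset V} (hS : S.Nonempty) {g : V → V}
    (hg : ∀ u ∈ S, g u ∈ S) (hne : ∀ u ∈ S, g u ≠ u) :
    ∃ d : Equiv.Perm V, d.IsCycle ∧ d.support ⊆ S ∧ ∀ u ∈ d.support, d u = g u := by
  classical
  -- By minimality g maps the smallest nonempty stable subset onto itself, so it permutes it.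
  obtain ⟨S', hS', hmin⟩ := Finset.exists_min_image
    (S.powerset.filter fun S' => S'.Nonempty ∧ ∀ u ∈ S', g u ∈ S') Finset.card
    ⟨S, by simp [hS]; exact hg⟩
  rw [Finset.mem_filter, Finset.mem_powerset] at hS'
  obtain ⟨hsub, hne', hmaps⟩ := hS'
  have himg : S'.image g = S' := by
    have hsub' : S'.image g ⊆ S' := Finset.image_subset_iff.2 hmaps
    refine Finset.eq_of_subset_of_card_le hsub' (hmin _ ?_)
    rw [Finset.mem_filter, Finset.mem_powerset]
    exact ⟨hsub'.trans hsub, hne'.image g,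
      fun u hu => Finset.mem_image_of_mem g (hsub' hu)⟩
  have hinj : Set.InjOn g S' := Finset.injOn_of_card_image_eq (by rw [himg])
  have hbij : Function.Bijective fun u : {u // u ∈ S'} => (⟨g u, hmaps u u.2⟩ : {u // u ∈ S'}) := by
    refine (Finite.injective_iff_bijective).1 fun u v h => Subtype.ext (hinj u.2 v.2 ?_)
    exact congrArg Subtype.val h
  set σ : Equiv.Perm V := ofSubtype (Equiv.ofBijective _ hbij) with hσ
  have hσg : ∀ u ∈ S', σ u = g u := fun u hu => by
    rw [hσ, ofSubtype_apply_of_mem _ hu]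
    rfl
  have hσid : ∀ u, u ∉ S' → σ u = u := fun u hu => ofSubtype_apply_of_not_mem _ hu
  obtain ⟨u, hu⟩ := hne'
  have hcyc : (σ.cycleOf u).IsCycle :=
    isCycle_cycleOf σ (by rw [hσg u hu]; exact hne u (hsub hu))
  have hsupp : (σ.cycleOf u).support ⊆ S' := by
    refine (support_cycleOf_le σ u).trans fun v hv => ?_
    by_contra hc
    exact mem_support.1 hv (hσid v hc)
  refine ⟨σ.cycleOf u, hcyc, hsupp.trans hsub, fun v hv => ?_⟩
  rw [← hσg v (hsupp hv)]
  exact ((mem_support_cycleOf_iff.1 hv).1).cycleOf_apply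

/-- A family of directed edges of a graph in which every vertex has equal in- and out-degree decomposes
into directed cycles. -/
theorem exists_cycle_decomposition (G : SimpleGraph V) (T : Multiset (V × V))
    (hadj : ∀ p ∈ T, G.Adj p.1 p.2) (hbal : T.map Prod.fst = T.map Prod.snd) :
    ∃ D : Multiset (Equiv.Perm V), (∀ d ∈ D, IsDirectedCycle G d) ∧ D.bind darts = T := by
  induction hn : T.card using Nat.strong_induction_on generalizing T with
  | _ n ih =>
    subst hn
    by_cases hT : T = 0
    · exact ⟨0, by simp, by simp [hT]⟩
    -- One outgoing edge is chosen at each tail; by balance its head is again a tail, so following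
    -- the choices closes up to a cycle.
    have hex : ∀ u : V, ∃ v, u ∈ T.map Prod.fst → (u, v) ∈ T := by
      intro u
      by_cases hu : u ∈ T.map Prod.fst
      · obtain ⟨⟨u', v⟩, hp, rfl⟩ := Multiset.mem_map.1 hu
        exact ⟨v, fun _ => hp⟩
      · exact ⟨u, fun h => absurd h hu⟩
    choose g hg using hex
    obtain ⟨d, hcyc, hsub, hdg⟩ := exists_isCycle_of_mapsTo (S := (T.map Prod.fst).toFinset) (g := g)
      (by
        obtain ⟨p, hp⟩ := Multiset.exists_mem_of_ne_zero hT
        exact ⟨p.1, Multiset.mem_toFinset.2 (Multiset.mem_map_of_mem _ hp)⟩)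
      (fun u hu => by
        rw [Multiset.mem_toFinset] at hu ⊢
        rw [hbal]
        exact Multiset.mem_map_of_mem Prod.snd (hg u hu))
      (fun u hu => (hadj _ (hg u (Multiset.mem_toFinset.1 hu))).ne')
    have hmem : ∀ u ∈ d.support, (u, d u) ∈ T := fun u hu => by
      rw [hdg u hu]
      exact hg u (Multiset.mem_toFinset.1 (hsub hu))
    have hle : darts d ≤ T := by
      refine (Multiset.le_iff_subset ?_).2 fun p hp => ?_
      · exact d.support.nodup.map fun u v h => congrArg Prod.fst h
      · obtain ⟨u, hu, rfl⟩ := Multiset.mem_map.1 hp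
        exact hmem u hu
    -- A cycle has each of its vertices once as a tail and once as a head, so its removal preserves
    -- balance.
    have hfst : (darts d).map Prod.fst = d.support.val := by simp [darts]
    have hsnd : (darts d).map Prod.snd = d.support.val := by
      have : (darts d).map Prod.snd = (d.support.map d.toEmbedding).val := by
        simp [darts]
      rw [this]
      congr 1
      ext v
      rw [Finset.mem_map_equiv]
      exact (apply_mem_support (f := d) (x := d.symm v)).symm.trans (by simp)
    obtain ⟨D, hD, hDT⟩ := ih (T - darts d).card
      (by
        rw [Multiset.card_sub hle]
        have h1 := Multiset.card_le_card hle
        have h2 : 0 < (darts d).card := by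
          rw [darts, Multiset.card_map, Finset.card_val]
          have := two_le_card_support_of_ne_one hcyc.ne_one
          omega
        omega) (T - darts d)
      (fun p hp => hadj p (Multiset.mem_of_le (Multiset.sub_le_self _ _) hp))
      (by
        have h1 := congrArg (Multiset.map Prod.fst) (Multiset.sub_add_cancel hle)
        have h2 := congrArg (Multiset.map Prod.snd) (Multiset.sub_add_cancel hle)
        rw [Multiset.map_add, hfst] at h1
        rw [Multiset.map_add, hsnd, ← hbal, ← h1] at h2
        exact (add_right_cancel h2).symm) rfl
    refine ⟨d ::ₘ D, ?_, ?_⟩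
    · intro e he
      rcases Multiset.mem_cons.1 he with rfl | he
      · exact ⟨hcyc, fun u hu => hadj _ (hmem u (mem_support.2 hu))⟩
      · exact hD e he
    · rw [Multiset.cons_bind, hDT, add_comm, Multiset.sub_add_cancel hle]

end Decomposition

/-! ### The monopole-dimer model as a loop-vertex model -/

section Product

open Equiv.Perm

variable {V₁ V₂ : Type} [Fintype V₁] [DecidableEq V₁] [Fintype V₂] [DecidableEq V₂]
  {Γ₁ : LabelledPlaneGraph V₁} {Γ₂ : LabelledPlaneGraph V₂} {f : Equiv.Perm (V₁ × V₂)}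

theorem adj_fst_of_snd_eq (hf : IsDirectedCycle (Γ₁.graph.boxProd Γ₂.graph) f) {v : V₁ × V₂}
    (hv : v ∈ f.support) (h : (f v).2 = v.2) : Γ₁.graph.Adj v.1 (f v).1 := by
  rcases SimpleGraph.boxProd_adj.1 (hf.2 v (mem_support.1 hv)) with h' | h'
  · exact h'.1
  · exact absurd h.symm h'.1.ne

theorem adj_snd_of_fst_eq (hf : IsDirectedCycle (Γ₁.graph.boxProd Γ₂.graph) f) {v : V₁ × V₂}
    (hv : v ∈ f.support) (h : (f v).1 = v.1) : Γ₂.graph.Adj v.2 (f v).2 := by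
  rcases SimpleGraph.boxProd_adj.1 (hf.2 v (mem_support.1 hv)) with h' | h'
  · exact absurd h.symm h'.1.ne
  · exact h'.1

theorem fst_eq_iff_snd_ne (hf : IsDirectedCycle (Γ₁.graph.boxProd Γ₂.graph) f) {v : V₁ × V₂}
    (hv : v ∈ f.support) : (f v).1 = v.1 ↔ ¬ (f v).2 = v.2 := by
  refine ⟨fun h h' => mem_support.1 hv (Prod.ext h h'), fun h => ?_⟩
  rcases SimpleGraph.boxProd_adj.1 (hf.2 v (mem_support.1 hv)) with h' | h'
  · exact absurd h'.2.symm h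
  · exact h'.2.symm

/-- The steps of a permutation along which a coordinate changes are balanced. -/
theorem map_filter_support_balanced {V W : Type*} [Fintype V] [DecidableEq V] (f : Equiv.Perm V)
    (π : V → W) (P : V → Prop) [DecidablePred P] (h : ∀ v ∈ f.support, ¬ P v → π (f v) = π v) :
    (f.support.filter P).val.map π = (f.support.filter P).val.map fun v => π (f v) := by
  have h1 : f.support.val.map π = f.support.val.map fun v => π (f v) := by
    have e : (f.support.map f.toEmbedding) = f.support := by
      ext v
      rw [Finset.mem_map_equiv]
      exact (apply_mem_support (f := f) (x := f.symm v)).symm.trans (by simp)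
    conv_lhs => rw [← e]
    simp
  rw [← Multiset.filter_add_not P f.support.val, Multiset.map_add, Multiset.map_add] at h1
  have h2 : (Multiset.filter (fun v => ¬ P v) f.support.val).map π =
      (Multiset.filter (fun v => ¬ P v) f.support.val).map fun v => π (f v) :=
    Multiset.map_congr rfl fun v hv => by
      obtain ⟨a, b⟩ := Multiset.mem_filter.1 hv
      exact (h v a b).symm
  rw [h2] at h1
  exact add_right_cancel h1

/-- Contracted steps do not change the projected vertex, so both projections are balanced. -/
theorem exists_isLoopSign (hf : IsDirectedCycle (Γ₁.graph.boxProd Γ₂.graph) f) :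
    ∃ ε, IsLoopSign Γ₁ Γ₂ f ε := by
  obtain ⟨D₁, h1, h1'⟩ := exists_cycle_decomposition Γ₁.graph (projection₁ f)
    (by
      intro p hp
      obtain ⟨v, hv, rfl⟩ := Multiset.mem_map.1 hp
      obtain ⟨a, b⟩ := Finset.mem_filter.1 hv
      exact adj_fst_of_snd_eq hf a b)
    (by
      rw [projection₁, Multiset.map_map, Multiset.map_map]
      exact map_filter_support_balanced f Prod.fst _ fun v hv h => (fst_eq_iff_snd_ne hf hv).2 h)
  obtain ⟨D₂, h2, h2'⟩ := exists_cycle_decomposition Γ₂.graph (projection₂ f)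
    (by
      intro p hp
      obtain ⟨v, hv, rfl⟩ := Multiset.mem_map.1 hp
      obtain ⟨a, b⟩ := Finset.mem_filter.1 hv
      exact adj_snd_of_fst_eq hf a b)
    (by
      rw [projection₂, Multiset.map_map, Multiset.map_map]
      refine map_filter_support_balanced f Prod.snd _ fun v hv h => ?_
      by_contra hc
      exact h ((fst_eq_iff_snd_ne hf hv).2 hc))
  exact ⟨_, D₁, D₂, ⟨h1, h1'⟩, ⟨h2, h2'⟩, rfl⟩

/-- If the signs of the cycles in both factors are orientation signs, then the sign of a loop is minus its
orientation sign for the oriented product. -/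
theorem isLoopSign_cast
    (h₁ : ∀ d, IsDirectedCycle Γ₁.graph d →
      (cycleSign Γ₁ d : ℝ) = ∏ u ∈ d.support, stepSign (canonicalArc Γ₁) u (d u))
    (h₂ : ∀ d, IsDirectedCycle Γ₂.graph d →
      (cycleSign Γ₂ d : ℝ) = ∏ u ∈ d.support, stepSign (canonicalArc Γ₂) u (d u))
    (hf : IsDirectedCycle (Γ₁.graph.boxProd Γ₂.graph) f) {ε : ℤ} (h : IsLoopSign Γ₁ Γ₂ f ε) :
    (ε : ℝ) = -∏ v ∈ f.support, stepSign (productArc Γ₁ Γ₂) v (f v) := by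
  obtain ⟨D₁, D₂, hD₁, hD₂, rfl⟩ := h
  push_cast
  rw [familySign_eq h₁ hD₁, familySign_eq h₂ hD₂, projection₁, projection₂, Multiset.map_map,
    Multiset.map_map, ← Finset.prod_filter_mul_prod_filter_not f.support (fun v => (f v).2 = v.2),
    ← mul_assoc]
  congr 2
  -- The count of edges in reversed layers becomes a product of layer signs, which turn the signs of
  -- the first factor into those of the oriented product.
  · have hrev : (-1 : ℝ) ^ reversedCount Γ₂ f =
        ∏ v ∈ f.support.filter (fun v => (f v).2 = v.2), (-1 : ℝ) ^ (Γ₂.label v.2 + 1) := by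
      have e : ∀ k : ℕ, (-1 : ℝ) ^ k = if Odd k then -1 else 1 := fun k => by
        split_ifs with hk
        · exact hk.neg_one_pow
        · exact (Nat.not_odd_iff_even.1 hk).neg_one_pow
      simp only [e (Γ₂.label _ + 1)]
      rw [← Finset.prod_filter, Finset.prod_const, Finset.filter_filter, reversedCount]
    rw [hrev]
    change _ * (∏ v ∈ f.support.filter (fun v => (f v).2 = v.2),
      stepSign (canonicalArc Γ₁) v.1 (f v).1) = _
    rw [← Finset.prod_mul_distrib]
    refine Finset.prod_congr rfl fun v hv => ?_
    obtain ⟨a, b⟩ := Finset.mem_filter.1 hv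
    exact (stepSign_productArc_fst Γ₁ Γ₂ (adj_fst_of_snd_eq hf a b) b.symm).symm
  · change (∏ v ∈ f.support.filter (fun v => (f v).1 = v.1),
      stepSign (canonicalArc Γ₂) v.2 (f v).2) = _
    rw [Finset.filter_congr fun v hv => fst_eq_iff_snd_ne hf hv]
    refine Finset.prod_congr rfl fun v hv => ?_
    obtain ⟨a, b⟩ := Finset.mem_filter.1 hv
    have b' := (fst_eq_iff_snd_ne hf a).2 b
    exact (stepSign_productArc_snd Γ₁ Γ₂ (adj_snd_of_fst_eq hf a b') b'.symm).symm

theorem existsUnique_isLoopSign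
    (h₁ : ∀ d, IsDirectedCycle Γ₁.graph d →
      (cycleSign Γ₁ d : ℝ) = ∏ u ∈ d.support, stepSign (canonicalArc Γ₁) u (d u))
    (h₂ : ∀ d, IsDirectedCycle Γ₂.graph d →
      (cycleSign Γ₂ d : ℝ) = ∏ u ∈ d.support, stepSign (canonicalArc Γ₂) u (d u))
    (hf : IsDirectedCycle (Γ₁.graph.boxProd Γ₂.graph) f) : ∃! ε, IsLoopSign Γ₁ Γ₂ f ε := by
  obtain ⟨ε, hε⟩ := exists_isLoopSign hf
  refine ⟨ε, hε, fun ε' hε' => ?_⟩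
  have := (isLoopSign_cast h₁ h₂ hf hε').trans (isLoopSign_cast h₁ h₂ hf hε).symm
  exact_mod_cast this

/-- The weights of each single loop agree, so the two sums agree term by term. -/
theorem monopoleDimerPartition_eq
    (h₁ : ∀ d, IsDirectedCycle Γ₁.graph d →
      (cycleSign Γ₁ d : ℝ) = ∏ u ∈ d.support, stepSign (canonicalArc Γ₁) u (d u))
    (h₂ : ∀ d, IsDirectedCycle Γ₂.graph d →
      (cycleSign Γ₂ d : ℝ) = ∏ u ∈ d.support, stepSign (canonicalArc Γ₂) u (d u))
    (x : V₁ × V₂ → ℝ) (a : V₁ × V₂ → V₁ × V₂ → ℝ) :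
    monopoleDimerPartition Γ₁ Γ₂ x a =
      loopVertexPartition (Γ₁.graph.boxProd Γ₂.graph) (productArc Γ₁ Γ₂) x a := by
  refine Finset.sum_congr rfl fun C hC => ?_
  rw [configWeight, configWeight]
  congr 1
  refine Finset.prod_congr rfl fun f hfC => ?_
  have hf : IsDirectedCycle (Γ₁.graph.boxProd Γ₂.graph) f :=
    ((mem_configurations.1 hC).1 f hfC).1
  have hex := exists_isLoopSign hf
  rw [monopoleDimerWeight, loopSign, dif_pos hex, isLoopSign_cast h₁ h₂ hf hex.choose_spec,
    loopVertexWeight, Finset.prod_mul_distrib, neg_mul]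

end Product

theorem gridPartition_eq (ℓ m n : ℕ) (x a b c : ℝ) :
    gridPartition ℓ m n x a b c = gridFormula ℓ m n x a b c := by
  rw [gridPartition, monopoleDimerPartition_eq (fun _ => cycleSign_planeGrid)
    (fun _ => cycleSign_planePath), loopVertexPartition_grid]

open MvPolynomial Real in
theorem exists_polynomial_gridFormula {ℓ m n : ℕ} (hℓ : Even ℓ) (hm : Even m) (hn : Even n) :
    ∃ Q : MvPolynomial (Fin 4) ℝ, ∀ x a b c : ℝ,
      gridFormula ℓ m n x a b c = (MvPolynomial.eval ![x, a, b, c] Q) ^ 4 := by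
  refine ⟨∏ j ∈ Finset.Icc 1 (n / 2), ∏ s ∈ Finset.Icc 1 (m / 2), ∏ k ∈ Finset.Icc 1 (ℓ / 2),
    (X 0 ^ 2 + 4 * X 1 ^ 2 * C (cos (π * k / (ℓ + 1)) ^ 2) +
      4 * X 2 ^ 2 * C (cos (π * s / (m + 1)) ^ 2) + 4 * X 3 ^ 2 * C (cos (π * j / (n + 1)) ^ 2)),
    fun x a b c => ?_⟩
  simp only [gridFormula, parityFactor, hℓ, hm, hn, if_true, mul_one, map_prod, map_add, map_mul,
    map_pow, eval_X, eval_C, map_ofNat, Finset.prod_pow]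
  rfl

end MonopoleDimer

theorem mainTheorem5 (ℓ m n : ℕ) :
    (∀ f : Equiv.Perm ((Fin ℓ × Fin m) × Fin n),
      MonopoleDimer.IsEvenLoop
        ((MonopoleDimer.planeGrid ℓ m).graph.boxProd (MonopoleDimer.planePath n).graph) f →
      ∃! ε : ℤ, MonopoleDimer.IsLoopSign
        (MonopoleDimer.planeGrid ℓ m) (MonopoleDimer.planePath n) f ε) ∧
    (∀ x a b c : ℝ,
      MonopoleDimer.gridPartition ℓ m n x a b c = MonopoleDimer.gridFormula ℓ m n x a b c ∧
      MonopoleDimer.loopVertexPartition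
        ((MonopoleDimer.planeGrid ℓ m).graph.boxProd (MonopoleDimer.planePath n).graph)
        (MonopoleDimer.productArc (MonopoleDimer.planeGrid ℓ m) (MonopoleDimer.planePath n))
        (fun _ => x) (MonopoleDimer.axisWeight a b c) =
          MonopoleDimer.gridFormula ℓ m n x a b c) ∧
    (Even ℓ → Even m → Even n → ∃ Q : MvPolynomial (Fin 4) ℝ, ∀ x a b c : ℝ,
      MonopoleDimer.gridPartition ℓ m n x a b c = (MvPolynomial.eval ![x, a, b, c] Q) ^ 4) := by
  refine ⟨fun f hf => MonopoleDimer.existsUnique_isLoopSign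
      (fun _ => MonopoleDimer.cycleSign_planeGrid) (fun _ => MonopoleDimer.cycleSign_planePath) hf.1,
    fun x a b c => ⟨MonopoleDimer.gridPartition_eq ℓ m n x a b c,
      MonopoleDimer.loopVertexPartition_grid ℓ m n x a b c⟩, fun hℓ hm hn => ?_⟩
  simp only [MonopoleDimer.gridPartition_eq]
  exact MonopoleDimer.exists_polynomial_gridFormula hℓ hm hn
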